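/- Let $n\ge 0$ be an integer, let $a_1,\dots,a_n,b_1,\dots,b_{n+3}\in\mathbb C$ all have positive real part, and put $B=b_1+\cdots+b_{n+3}$. Let $\Gamma$ be the classical gamma function, with $1/\Gamma$ understood as an entire function. Then the integral $$\frac{1}{(2\pi\mathrm i)^n}\int_{-\mathrm i\infty}^{\mathrm i\infty}\!\!\cdots\int_{-\mathrm i\infty}^{\mathrm i\infty} \prod_{j=1}^{n+1}\frac{\prod_{i=1}^{n}\Gamma(a_i+u_j)\,\prod_{i=1}^{n+3}\Gamma(b_i-u_j)}{\prod_{i=1}^{n}\Gamma(B+a_i-u_j)} \prod_{1\le i<j\le n+1}\frac{\Gamma(B-u_i-u_j)}{\Gamma(u_i-u_j)\,\Gamma(u_j-u_i)}\;\mathrm du_1\cdots\mathrm du_n ,$$ taken over the imaginary axis in each of $u_1,\dots,u_n$, with $u_{n+1}=-(u_1+\cdots+u_n)$, converges absolutely and equals $$(n+1)!\,\prod_{i=1}^{n}\prod_{j=1}^{n+3}\frac{\Gamma(a_i+b_j)}{\Gamma(B+a_i-b_j)}\;\prod_{1\le i<j\le n+3}\Gamma(B-b_i-b_j).$$ (For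 $n=0$ the integral is read as the value of the integrand at $u_1=0$.) -/

import Mathlib

open scoped BigOperators

/-- The integral of `F` over `n` complex variables, each running along the imaginary axis
from `-i∞` to `i∞`: with `u_j = i y_j` and `du_j = i dy_j`. -/
noncomputable def imagAxisIntegral (n : ℕ) (F : (Fin n → ℂ) → ℂ) : ℂ :=
  Complex.I ^ n * ∫ y : Fin n → ℝ, F (fun j => (y j : ℂ) * Complex.I)

/-- Absolute convergence of `imagAxisIntegral n F`. -/
def ImagAxisIntegrable (n : ℕ) (F : (Fin n → ℂ) → ℂ) : Prop :=
  MeasureTheory.Integrable (fun y : Fin n → ℝ => F (fun j => (y j : ℂ) * Complex.I))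

/-- The vector `(u_1, …, u_n, u_{n+1})` with `u_{n+1} = -(u_1 + ⋯ + u_n)`. -/
def sumZeroExtend {n : ℕ} (u : Fin n → ℂ) : Fin (n + 1) → ℂ :=
  Fin.snoc (α := fun _ => ℂ) u (-∑ j, u j)

/-- The kernel, as a function of `v = (u_1, …, u_{n+1})`. Mathlib's `Complex.Gamma` is `0` at the
poles of the gamma function, so that `1 / Complex.Gamma` is the entire function `1 / Γ`. -/
noncomputable def gammaKernel {n : ℕ} (a : Fin n → ℂ) (b : Fin (n + 3) → ℂ)
    (v : Fin (n + 1) → ℂ) : ℂ :=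
  (∏ j : Fin (n + 1),
    ((∏ i : Fin n, Complex.Gamma (a i + v j)) * ∏ i : Fin (n + 3), Complex.Gamma (b i - v j)) /
      ∏ i : Fin n, Complex.Gamma ((∑ k, b k) + a i - v j)) *
  ∏ i : Fin (n + 1), ∏ j ∈ Finset.Ioi i,
    Complex.Gamma ((∑ k, b k) - v i - v j) /
      (Complex.Gamma (v i - v j) * Complex.Gamma (v j - v i))

open Complex in
theorem norm_betaIntegral_le (u v : ℂ) :
    ‖betaIntegral u v‖ ≤ (betaIntegral u.re v.re).re := by
  have key : ∀ x ∈ Set.Ioo (0 : ℝ) 1,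
      ‖(x : ℂ) ^ (u - 1) * (1 - (x : ℂ)) ^ (v - 1)‖ = x ^ (u.re - 1) * (1 - x) ^ (v.re - 1) := by
    intro x hx
    rw [norm_mul, norm_cpow_eq_rpow_re_of_pos hx.1, ← ofReal_one, ← ofReal_sub,
      norm_cpow_eq_rpow_re_of_pos (sub_pos.2 hx.2)]
    simp
  have hre : betaIntegral u.re v.re
      = ((∫ x in (0 : ℝ)..1, ‖(x : ℂ) ^ (u - 1) * (1 - (x : ℂ)) ^ (v - 1)‖ : ℝ) : ℂ) := by
    rw [betaIntegral, ← intervalIntegral.integral_ofReal]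
    simp only [intervalIntegral.integral_of_le zero_le_one, MeasureTheory.integral_Ioc_eq_integral_Ioo]
    refine MeasureTheory.setIntegral_congr_fun measurableSet_Ioo (fun x hx => ?_)
    rw [key x hx, ofReal_mul, ofReal_cpow hx.1.le, ofReal_cpow (sub_nonneg.2 hx.2.le)]
    push_cast
    rfl
  rw [hre, ofReal_re]
  exact intervalIntegral.norm_integral_le_integral_norm zero_le_one

open Complex in
theorem norm_Gamma_mul_Gamma_le {w : ℂ} {s : ℝ} (hw : 0 < w.re) (hs : 0 < s) :
    ‖Gamma w‖ * Real.Gamma (w.re + s) ≤ Real.Gamma w.re * ‖Gamma (w + s)‖ := by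
  have hs' : 0 < (s : ℂ).re := by simpa using hs
  have hx' : 0 < (w.re : ℂ).re := by simpa using hw
  have h1 := Gamma_mul_Gamma_eq_betaIntegral hw hs'
  have h2 := Gamma_mul_Gamma_eq_betaIntegral hx' hs'
  have h3 := norm_betaIntegral_le w s
  have hβ : betaIntegral w.re s = ((Real.Gamma w.re * Real.Gamma s / Real.Gamma (w.re + s) : ℝ) : ℂ) := by
    have : Gamma ((w.re : ℂ) + s) ≠ 0 := Gamma_ne_zero_of_re_pos (by simpa using add_pos hw hs)
    rw [eq_comm, ofReal_div, ofReal_mul, ← Gamma_ofReal, ← Gamma_ofReal, ← Gamma_ofReal, ofReal_add,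
      div_eq_iff this, h2]
    ring
  have hΓs := Real.Gamma_pos_of_pos hs
  have hΓ := Real.Gamma_pos_of_pos (add_pos hw hs)
  have h4 : ‖betaIntegral w s‖ ≤ Real.Gamma w.re * Real.Gamma s / Real.Gamma (w.re + s) := by
    rwa [ofReal_re, hβ, ofReal_re] at h3
  have h5 : ‖Gamma w‖ * Real.Gamma s = ‖Gamma (w + s)‖ * ‖betaIntegral w s‖ := by
    rw [← norm_mul, ← h1, norm_mul, Gamma_ofReal, norm_real, Real.norm_of_nonneg hΓs.le]
  have h6 : ‖betaIntegral w s‖ * Real.Gamma (w.re + s) ≤ Real.Gamma w.re * Real.Gamma s :=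
    (le_div_iff₀ hΓ).1 h4
  have h7 := mul_le_mul_of_nonneg_left h6 (norm_nonneg (Gamma (w + s)))
  nlinarith

open Complex in
theorem norm_Gamma_half_sq (τ : ℝ) : ‖Gamma (1 / 2 + τ * I)‖ ^ 2 = Real.pi / Real.cosh (Real.pi * τ) := by
  have h := Gamma_mul_Gamma_one_sub (1 / 2 + τ * I)
  have hc : (1 : ℂ) - (1 / 2 + τ * I) = (starRingEnd ℂ) (1 / 2 + τ * I) := by
    apply Complex.ext <;> simp; norm_num
  rw [hc, Gamma_conj, mul_conj, normSq_eq_norm_sq] at h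
  have hs : sin (Real.pi * (1 / 2 + τ * I)) = ((Real.cosh (Real.pi * τ) : ℝ) : ℂ) := by
    rw [mul_add, ofReal_cosh, ← cos_mul_I, ← cos_pi_div_two_sub, ← cos_neg]
    congr 1
    push_cast
    ring
  rw [hs] at h
  exact_mod_cast h

open Complex in
theorem norm_Gamma_half_le (τ : ℝ) :
    ‖Gamma (1 / 2 + τ * I)‖ ≤ 3 * Real.exp (-(Real.pi / 2 * |τ|)) := by
  have h := norm_Gamma_half_sq τ
  refine le_of_sq_le_sq ?_ (by positivity)
  rw [h, mul_pow, ← Real.exp_nat_mul, div_le_iff₀ (Real.cosh_pos _), ← Real.cosh_abs, abs_mul,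
    abs_of_pos Real.pi_pos, Real.cosh_eq]
  have e : Real.exp (((2 : ℕ) : ℝ) * -(Real.pi / 2 * |τ|)) * Real.exp (Real.pi * |τ|) = 1 := by
    rw [← Real.exp_add]; convert Real.exp_zero using 2; push_cast; ring
  have := Real.pi_lt_four
  have := Real.exp_pos (((2 : ℕ) : ℝ) * -(Real.pi / 2 * |τ|))
  have := Real.exp_pos (-(Real.pi * |τ|))
  nlinarith [mul_pos ‹0 < Real.exp (((2 : ℕ) : ℝ) * -(Real.pi / 2 * |τ|))› ‹0 < Real.exp (-(Real.pi * |τ|))›]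

open Complex in
theorem exp_le_norm_Gamma_half (τ : ℝ) :
    Real.exp (-(Real.pi / 2 * |τ|)) ≤ ‖Gamma (1 / 2 + τ * I)‖ := by
  have h := norm_Gamma_half_sq τ
  refine le_of_sq_le_sq ?_ (by positivity)
  rw [h, ← Real.exp_nat_mul, le_div_iff₀ (Real.cosh_pos _), ← Real.cosh_abs, abs_mul,
    abs_of_pos Real.pi_pos, Real.cosh_eq]
  have e : Real.exp (((2 : ℕ) : ℝ) * -(Real.pi / 2 * |τ|)) * Real.exp (Real.pi * |τ|) = 1 := by
    rw [← Real.exp_add]; convert Real.exp_zero using 2; push_cast; ring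
  have e1 : Real.exp (((2 : ℕ) : ℝ) * -(Real.pi / 2 * |τ|)) ≤ 1 := by
    apply Real.exp_le_one_iff.2
    have : 0 ≤ Real.pi * |τ| := by positivity
    push_cast; linarith
  have e2 : Real.exp (-(Real.pi * |τ|)) ≤ 1 := by
    apply Real.exp_le_one_iff.2
    have : 0 ≤ Real.pi * |τ| := by positivity
    linarith
  have := Real.pi_gt_three
  nlinarith [Real.exp_pos (((2 : ℕ) : ℝ) * -(Real.pi / 2 * |τ|)), Real.exp_pos (-(Real.pi * |τ|))]

open Complex in
theorem norm_Gamma_nat_add_half_le (m : ℕ) (τ : ℝ) :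
    ‖Gamma (m + 1 / 2 + τ * I)‖ ≤ 3 * (m + 1 + |τ|) ^ m * Real.exp (-(Real.pi / 2 * |τ|)) := by
  induction m with
  | zero => simpa using norm_Gamma_half_le τ
  | succ m ih =>
    have hne : (m : ℂ) + 1 / 2 + τ * I ≠ 0 := by
      intro h
      have := congrArg re h
      simp at this
      norm_num at this
      have h2 : (0 : ℝ) ≤ m := Nat.cast_nonneg m
      linarith
    have hn : ‖(m : ℂ) + 1 / 2 + τ * I‖ ≤ m + 1 + 1 + |τ| := by
      refine (norm_add_le _ _).trans ?_
      have h1 : ‖(m : ℂ) + 1 / 2‖ ≤ m + 1 + 1 := by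
        refine (norm_add_le _ _).trans ?_
        simp; norm_num; linarith
      have h2 : ‖(τ : ℂ) * I‖ = |τ| := by simp
      linarith
    have e : ((m + 1 : ℕ) : ℂ) + 1 / 2 + τ * I = ((m : ℂ) + 1 / 2 + τ * I) + 1 := by push_cast; ring
    rw [e, Gamma_add_one _ hne, norm_mul]
    have h3 : ((m : ℝ) + 1 + |τ|) ^ m ≤ (m + 1 + 1 + |τ|) ^ m :=
      pow_le_pow_left₀ (by positivity) (by linarith) _
    calc _ ≤ (m + 1 + 1 + |τ|) * (3 * (m + 1 + 1 + |τ|) ^ m * Real.exp (-(Real.pi / 2 * |τ|))) := by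
          refine mul_le_mul hn (ih.trans ?_) (norm_nonneg _) (by positivity)
          gcongr
      _ = _ := by push_cast; ring

open Complex in
theorem exists_norm_Gamma_le {K : Set ℂ} (hK : IsCompact K) (hpos : ∀ c ∈ K, 0 < c.re) :
    ∃ C : ℝ, 0 ≤ C ∧ ∃ M : ℕ, ∀ c ∈ K, ∀ y : ℝ,
      ‖Gamma (c + y * I)‖ ≤ C * (1 + |y|) ^ M * Real.exp (-(Real.pi / 2 * |y|)) := by
  obtain ⟨R, hR⟩ := hK.isBounded.exists_norm_le
  have hcont : ContinuousOn (fun c : ℂ => Gamma (c.re : ℂ)) K := by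
    intro c hc
    have h1 : ContinuousAt Gamma (c.re : ℂ) := by
      refine (differentiableAt_Gamma _ fun m h => ?_).continuousAt
      have := congrArg re h
      simp at this
      have h2 := hpos c hc
      have h3 : (0 : ℝ) ≤ m := Nat.cast_nonneg m
      linarith
    exact (ContinuousAt.comp (f := fun c : ℂ => (c.re : ℂ)) h1 (by fun_prop)).continuousWithinAt
  obtain ⟨D, hD⟩ := hK.exists_bound_of_continuousOn hcont
  obtain ⟨m, hm⟩ := exists_nat_gt R
  have hΓm : 0 < Real.Gamma (m + 1 / 2) := Real.Gamma_pos_of_pos (by positivity)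
  rcases K.eq_empty_or_nonempty with rfl | ⟨c₀, hc₀⟩
  · exact ⟨0, le_rfl, 0, by simp⟩
  have hR0 : 0 ≤ R := (norm_nonneg _).trans (hR c₀ hc₀)
  have hD0 : 0 ≤ D := (norm_nonneg _).trans (hD c₀ hc₀)
  refine ⟨D / Real.Gamma (m + 1 / 2) * (3 * (m + 1 + R) ^ m) * Real.exp (Real.pi / 2 * R),
    by positivity, m, fun c hc y => ?_⟩
  have hcR := hR c hc
  have hre : c.re ≤ R := (le_abs_self _).trans ((abs_re_le_norm c).trans hcR)
  have him : |c.im| ≤ R := (abs_im_le_norm c).trans hcR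
  have hs : 0 < (m : ℝ) + 1 / 2 - c.re := by linarith
  have hw : 0 < (c + y * I).re := by simpa using hpos c hc
  have h1 := norm_Gamma_mul_Gamma_le hw hs
  have e1 : (c + y * I).re = c.re := by simp
  have e2 : c + y * I + ((m + 1 / 2 - c.re : ℝ) : ℂ) = m + 1 / 2 + ((c.im + y : ℝ) : ℂ) * I := by
    apply Complex.ext <;> simp
  rw [e1, e2, add_sub_cancel] at h1
  have h2 := norm_Gamma_nat_add_half_le m (c.im + y)
  have h3 : |c.im + y| ≤ R + |y| := (abs_add_le _ _).trans (by linarith)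
  have h4 : |y| - R ≤ |c.im + y| := by
    have := abs_sub_abs_le_abs_sub y (-c.im)
    rw [abs_neg] at this
    have e : y - -c.im = c.im + y := by ring
    rw [e] at this
    linarith
  have hDc : Real.Gamma c.re ≤ D := by
    have := hD c hc
    simp only [Gamma_ofReal, norm_real] at this
    exact (le_abs_self _).trans this
  have h5 : ((m : ℝ) + 1 + |c.im + y|) ^ m ≤ ((m + 1 + R) * (1 + |y|)) ^ m := by
    refine pow_le_pow_left₀ (by positivity) ?_ _
    nlinarith [abs_nonneg y, mul_nonneg hR0 (abs_nonneg y), mul_nonneg (Nat.cast_nonneg (α := ℝ) m) (abs_nonneg y)]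
  have h6 : Real.exp (-(Real.pi / 2 * |c.im + y|)) ≤ Real.exp (Real.pi / 2 * R) * Real.exp (-(Real.pi / 2 * |y|)) := by
    rw [← Real.exp_add]
    apply Real.exp_le_exp.2
    nlinarith [Real.pi_pos]
  calc ‖Gamma (c + y * I)‖ ≤ Real.Gamma c.re * ‖Gamma (m + 1 / 2 + ((c.im + y : ℝ) : ℂ) * I)‖ / Real.Gamma (m + 1 / 2) := by
        rw [le_div_iff₀ hΓm]; exact h1
    _ ≤ D * (3 * ((m + 1 + R) * (1 + |y|)) ^ m * (Real.exp (Real.pi / 2 * R) * Real.exp (-(Real.pi / 2 * |y|)))) / Real.Gamma (m + 1 / 2) := by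
        gcongr
        refine h2.trans ?_
        gcongr
    _ = _ := by rw [mul_pow]; ring

open Complex in
theorem exists_norm_inv_Gamma_le {K : Set ℂ} (hK : IsCompact K) (hpos : ∀ c ∈ K, 0 < c.re) :
    ∃ C : ℝ, 0 ≤ C ∧ ∃ M : ℕ, ∀ c ∈ K, ∀ y : ℝ,
      ‖(Gamma (c + y * I))⁻¹‖ ≤ C * (1 + |y|) ^ M * Real.exp (Real.pi / 2 * |y|) := by
  obtain ⟨R, hR⟩ := hK.isBounded.exists_norm_le
  have hcont : Continuous (fun c : ℂ => (Gamma ((c.re : ℂ) + 1))⁻¹) :=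
    differentiable_one_div_Gamma.continuous.comp (by fun_prop)
  obtain ⟨D, hD⟩ := hK.exists_bound_of_continuousOn hcont.continuousOn
  rcases K.eq_empty_or_nonempty with rfl | ⟨c₀, hc₀⟩
  · exact ⟨0, le_rfl, 0, by simp⟩
  have hR0 : 0 ≤ R := (norm_nonneg _).trans (hR c₀ hc₀)
  have hD0 : 0 ≤ D := (norm_nonneg _).trans (hD c₀ hc₀)
  have hΓh : 0 < Real.Gamma (1 / 2) := Real.Gamma_pos_of_pos (by positivity)
  refine ⟨(R + 1) * (Real.Gamma (1 / 2) * D * Real.exp (Real.pi / 2 * R)), by positivity, 1, fun c hc y => ?_⟩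
  have hcR := hR c hc
  have him : |c.im| ≤ R := (abs_im_le_norm c).trans hcR
  have hc0 := hpos c hc
  have hne : c + y * I ≠ 0 := fun h => by
    have := congrArg re h; simp at this; linarith
  have hs : 0 < c.re + 1 / 2 := by linarith
  have h1 := norm_Gamma_mul_Gamma_le (w := 1 / 2 + ((c.im + y : ℝ) : ℂ) * I) (by simp) hs
  have e1 : (1 / 2 + ((c.im + y : ℝ) : ℂ) * I).re = 1 / 2 := by simp
  have e2 : (1 / 2 + ((c.im + y : ℝ) : ℂ) * I) + ((c.re + 1 / 2 : ℝ) : ℂ) = c + y * I + 1 := by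
    apply Complex.ext <;> simp; ring
  have e3 : (1 / 2 : ℝ) + (c.re + 1 / 2) = c.re + 1 := by ring
  rw [e1, e2, e3, Gamma_add_one _ hne, norm_mul] at h1
  have h2 := exp_le_norm_Gamma_half (c.im + y)
  have h3 : |c.im + y| ≤ R + |y| := (abs_add_le _ _).trans (by linarith)
  have hG : 0 < Real.Gamma (c.re + 1) := Real.Gamma_pos_of_pos (by linarith)
  have hDc : (Real.Gamma (c.re + 1))⁻¹ ≤ D := by
    have := hD c hc
    rw [← ofReal_one, ← ofReal_add, Gamma_ofReal, norm_inv, norm_real] at this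
    rwa [Real.norm_of_nonneg hG.le] at this
  have hΓ0 : 0 < ‖Gamma (c + y * I)‖ := norm_pos_iff.2 (Gamma_ne_zero_of_re_pos (by simpa using hc0))
  have hn : ‖c + y * I‖ ≤ (R + 1) * (1 + |y|) := by
    refine (norm_add_le _ _).trans ?_
    have : ‖(y : ℂ) * I‖ = |y| := by simp
    nlinarith [abs_nonneg y, mul_nonneg hR0 (abs_nonneg y)]
  have h7 : Real.exp (-(Real.pi / 2 * (R + |y|))) ≤ Real.exp (-(Real.pi / 2 * |c.im + y|)) := by
    apply Real.exp_le_exp.2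
    nlinarith [Real.pi_pos]
  have h8 : Real.exp (-(Real.pi / 2 * (R + |y|))) * Real.Gamma (c.re + 1) ≤
      Real.Gamma (1 / 2) * ((R + 1) * (1 + |y|) * ‖Gamma (c + y * I)‖) := by
    calc _ ≤ _ := mul_le_mul_of_nonneg_right (h7.trans h2) hG.le
      _ ≤ _ := h1
      _ ≤ _ := by gcongr
  rw [Real.exp_neg, inv_mul_le_iff₀ (Real.exp_pos _)] at h8
  rw [norm_inv, inv_le_iff_one_le_mul₀ hΓ0]
  have h9 : 1 ≤ (Real.Gamma (c.re + 1))⁻¹ * (Real.exp (Real.pi / 2 * (R + |y|)) *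
      (Real.Gamma (1 / 2) * ((R + 1) * (1 + |y|) * ‖Gamma (c + y * I)‖))) := by
    rw [inv_mul_eq_div, le_div_iff₀ hG, one_mul]; exact h8
  refine h9.trans ?_
  calc _ ≤ D * (Real.exp (Real.pi / 2 * (R + |y|)) *
      (Real.Gamma (1 / 2) * ((R + 1) * (1 + |y|) * ‖Gamma (c + y * I)‖))) := by gcongr
    _ = _ := by rw [mul_add, Real.exp_add]; ring

/-- A family `Φ z y`, holomorphic in `z ∈ U`, jointly continuous, and bounded by a polynomial in `y`
times `exp (E y)`, locally uniformly in `z`. -/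
structure TameOn {n : ℕ} (U : Set ℂ) (E : (Fin n → ℝ) → ℝ) (Φ : ℂ → (Fin n → ℝ) → ℂ) : Prop where
  diff : ∀ y, DifferentiableOn ℂ (fun z => Φ z y) U
  cont : ContinuousOn (fun p : ℂ × (Fin n → ℝ) => Φ p.1 p.2) (U ×ˢ Set.univ)
  bound : ∀ K ⊆ U, IsCompact K → ∃ C : ℝ, 0 ≤ C ∧ ∃ M : ℕ, ∀ z ∈ K, ∀ y,
    ‖Φ z y‖ ≤ C * (1 + ‖y‖) ^ M * Real.exp (E y)

namespace TameOn

variable {n : ℕ} {U : Set ℂ} {E E' : (Fin n → ℝ) → ℝ} {Φ Ψ : ℂ → (Fin n → ℝ) → ℂ}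

theorem congr (h : TameOn U E Φ) (hE : ∀ y, E y ≤ E' y) (hΦ : ∀ z ∈ U, ∀ y, Ψ z y = Φ z y) :
    TameOn U E' Ψ where
  diff y := (h.diff y).congr fun z hz => hΦ z hz y
  cont := h.cont.congr fun p hp => hΦ p.1 hp.1 p.2
  bound K hK hK' := by
    obtain ⟨C, hC, M, hb⟩ := h.bound K hK hK'
    refine ⟨C, hC, M, fun z hz y => ?_⟩
    rw [hΦ z (hK hz)]
    refine (hb z hz y).trans ?_
    gcongr
    exact hE y

theorem mul (h : TameOn U E Φ) (h' : TameOn U E' Ψ) :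
    TameOn U (fun y => E y + E' y) (fun z y => Φ z y * Ψ z y) where
  diff y := (h.diff y).mul (h'.diff y)
  cont := h.cont.mul h'.cont
  bound K hK hK' := by
    obtain ⟨C, hC, M, hb⟩ := h.bound K hK hK'
    obtain ⟨C', hC', M', hb'⟩ := h'.bound K hK hK'
    refine ⟨C * C', mul_nonneg hC hC', M + M', fun z hz y => ?_⟩
    rw [norm_mul, pow_add, Real.exp_add]
    calc _ ≤ _ := mul_le_mul (hb z hz y) (hb' z hz y) (norm_nonneg _) (by positivity)
      _ = _ := by ring

theorem const (c : ℂ) : TameOn U (fun _ : Fin n → ℝ => 0) (fun _ _ => c) where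
  diff y := differentiableOn_const c
  cont := continuousOn_const
  bound K _ _ := ⟨‖c‖, norm_nonneg _, 0, fun z _ y => by simp⟩

theorem prod {ι : Type*} (s : Finset ι) {E : ι → (Fin n → ℝ) → ℝ} {Φ : ι → ℂ → (Fin n → ℝ) → ℂ}
    (h : ∀ i ∈ s, TameOn U (E i) (Φ i)) :
    TameOn U (fun y => ∑ i ∈ s, E i y) (fun z y => ∏ i ∈ s, Φ i z y) := by
  classical
  induction s using Finset.induction_on with
  | empty => simpa using const 1
  | insert a s ha ih =>
    refine ((h a (Finset.mem_insert_self a s)).mul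
      (ih fun i hi => h i (Finset.mem_insert_of_mem hi))).congr (fun y => ?_) (fun z _ y => ?_)
    · rw [Finset.sum_insert ha]
    · rw [Finset.prod_insert ha]

theorem abs_le (ℓ : (Fin n → ℝ) →ₗ[ℝ] ℝ) : ∃ D : ℝ, 0 ≤ D ∧ ∀ y, 1 + |ℓ y| ≤ (1 + D) * (1 + ‖y‖) := by
  refine ⟨‖LinearMap.toContinuousLinearMap ℓ‖, norm_nonneg _, fun y => ?_⟩
  have h := (LinearMap.toContinuousLinearMap ℓ).le_opNorm y
  rw [LinearMap.coe_toContinuousLinearMap', Real.norm_eq_abs] at h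
  nlinarith [norm_nonneg y, norm_nonneg (LinearMap.toContinuousLinearMap ℓ)]

open Complex in
theorem comp_affine {f : ℂ → ℂ} {V : Set ℂ} {κ : ℝ} (hf : DifferentiableOn ℂ f V)
    (hfV : ∀ c ∈ V, ∀ t : ℝ, c + t * I ∈ V)
    (hb : ∀ K ⊆ V, IsCompact K → ∃ C : ℝ, 0 ≤ C ∧ ∃ M : ℕ, ∀ c ∈ K, ∀ y : ℝ,
      ‖f (c + y * I)‖ ≤ C * (1 + |y|) ^ M * Real.exp (κ * |y|))
    {c : ℂ → ℂ} (hc : DifferentiableOn ℂ c U) (hcV : ∀ z ∈ U, c z ∈ V)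
    (ℓ : (Fin n → ℝ) →ₗ[ℝ] ℝ) :
    TameOn U (fun y => κ * |ℓ y|) (fun z y => f (c z + ℓ y * I)) where
  diff y := hf.comp (hc.add_const _) fun z hz => hfV _ (hcV z hz) _
  cont := by
    refine hf.continuousOn.comp ?_ (fun p hp => hfV _ (hcV p.1 hp.1) _)
    refine ContinuousOn.add (hc.continuousOn.comp continuousOn_fst fun p hp => hp.1) ?_
    have := ℓ.continuous_of_finiteDimensional
    fun_prop
  bound K hK hK' := by
    obtain ⟨C, hC, M, h⟩ := hb (c '' K) (Set.image_subset_iff.2 fun z hz => hcV z (hK hz))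
      (hK'.image_of_continuousOn (hc.continuousOn.mono hK))
    obtain ⟨D, hD, hℓ⟩ := abs_le ℓ
    refine ⟨C * (1 + D) ^ M, by positivity, M, fun z hz y => ?_⟩
    refine (h _ (Set.mem_image_of_mem c hz) _).trans ?_
    rw [mul_assoc C ((1 + D) ^ M), ← mul_pow]
    gcongr
    exact hℓ y

open Complex in
theorem gamma {c : ℂ → ℂ} (hc : DifferentiableOn ℂ c U) (hcV : ∀ z ∈ U, 0 < (c z).re)
    (ℓ : (Fin n → ℝ) →ₗ[ℝ] ℝ) :
    TameOn U (fun y => -(Real.pi / 2) * |ℓ y|) (fun z y => Gamma (c z + ℓ y * I)) := by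
  refine comp_affine (V := {c | 0 < c.re}) (fun z hz => ?_) (fun c hc t => by simpa using hc) ?_ hc hcV ℓ
  · refine (differentiableAt_Gamma _ fun m h => ?_).differentiableWithinAt
    have h1 := congrArg re h
    have h2 : 0 < z.re := hz
    have h3 : (0 : ℝ) ≤ m := Nat.cast_nonneg m
    simp at h1
    linarith
  · intro K hK hK'
    obtain ⟨C, hC, M, h⟩ := exists_norm_Gamma_le hK' hK
    exact ⟨C, hC, M, fun c hc y => by simpa using h c hc y⟩

open Complex in
theorem inv_gamma {c : ℂ → ℂ} (hc : DifferentiableOn ℂ c U) (hcV : ∀ z ∈ U, 0 < (c z).re)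
    (ℓ : (Fin n → ℝ) →ₗ[ℝ] ℝ) :
    TameOn U (fun y => (Real.pi / 2) * |ℓ y|) (fun z y => (Gamma (c z + ℓ y * I))⁻¹) := by
  refine comp_affine (f := fun z => (Gamma z)⁻¹) (V := {c | 0 < c.re})
    differentiable_one_div_Gamma.differentiableOn (fun c hc t => by simpa using hc) ?_ hc hcV ℓ
  intro K hK hK'
  exact exists_norm_inv_Gamma_le hK' hK

open Complex in
theorem norm_sin_le (w : ℂ) : ‖sin w‖ ≤ Real.exp |w.im| := by
  rw [sin]
  have h1 : ‖exp (-w * I)‖ ≤ Real.exp |w.im| := by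
    rw [norm_exp]; apply Real.exp_le_exp.2; simpa using le_abs_self w.im
  have h2 : ‖exp (w * I)‖ ≤ Real.exp |w.im| := by
    rw [norm_exp]; apply Real.exp_le_exp.2; simpa using neg_le_abs w.im
  rw [norm_div, norm_mul, norm_I, mul_one]
  have := norm_sub_le (exp (-w * I)) (exp (w * I))
  simp only [Complex.norm_ofNat]
  linarith

open Complex in
theorem sin_pi {c : ℂ → ℂ} (hc : DifferentiableOn ℂ c U) (ℓ : (Fin n → ℝ) →ₗ[ℝ] ℝ) :
    TameOn U (fun y => Real.pi * |ℓ y|) (fun z y => sin (Real.pi * (c z + ℓ y * I))) := by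
  refine comp_affine (f := fun z => sin (Real.pi * z)) (V := Set.univ)
    (by fun_prop) (fun c hc t => trivial) ?_ hc (fun _ _ => trivial) ℓ
  intro K _ hK'
  obtain ⟨R, hR⟩ := hK'.isBounded.exists_norm_le
  refine ⟨Real.exp (Real.pi * R), (Real.exp_pos _).le, 0, fun c hc y => ?_⟩
  refine (norm_sin_le _).trans ?_
  rw [pow_zero, mul_one, ← Real.exp_add]
  apply Real.exp_le_exp.2
  have h1 : (Real.pi * (c + y * I)).im = Real.pi * (c.im + y) := by simp
  rw [h1, abs_mul, abs_of_pos Real.pi_pos, ← mul_add]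
  gcongr
  exact (abs_add_le _ _).trans (by gcongr; exact (abs_im_le_norm c).trans (hR c hc))

open Complex in
theorem affine {c : ℂ → ℂ} (hc : DifferentiableOn ℂ c U) (ℓ : (Fin n → ℝ) →ₗ[ℝ] ℝ) :
    TameOn U (fun _ => 0) (fun z y => c z + ℓ y * I) := by
  refine (comp_affine (f := fun z => z) (κ := 0) (V := Set.univ)
    (by fun_prop) (fun c hc t => trivial) ?_ hc (fun _ _ => trivial) ℓ).congr (by simp) (by simp)
  intro K _ hK'
  obtain ⟨R, hR⟩ := hK'.isBounded.exists_norm_le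
  refine ⟨1 + |R|, by positivity, 1, fun c hc y => ?_⟩
  refine (norm_add_le _ _).trans ?_
  have h1 : ‖(y : ℂ) * I‖ = |y| := by simp
  have h2 := (hR c hc).trans (le_abs_self R)
  simp only [zero_mul, Real.exp_zero, mul_one, pow_one]
  nlinarith [mul_nonneg (abs_nonneg R) (abs_nonneg y), abs_nonneg R, abs_nonneg y]

theorem exists_pow_mul_exp_le {δ : ℝ} (hδ : 0 < δ) (k : ℕ) :
    ∃ C : ℝ, 0 ≤ C ∧ ∀ x : ℝ, 0 ≤ x → (1 + x) ^ k * Real.exp (-δ * x) ≤ C := by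
  refine ⟨k.factorial / δ ^ k * Real.exp δ, by positivity, fun x hx => ?_⟩
  have h := Real.pow_div_factorial_le_exp (x := δ * (1 + x)) (by positivity) k
  rw [div_le_iff₀ (by positivity), mul_pow] at h
  have e : Real.exp (δ * (1 + x)) * Real.exp (-δ * x) = Real.exp δ := by
    rw [← Real.exp_add]; congr 1; ring
  rw [div_mul_eq_mul_div, le_div_iff₀ (by positivity), ← e]
  have := Real.exp_pos (-δ * x)
  nlinarith

theorem bound_pow (h : TameOn U E Φ) {δ : ℝ} (hδ : 0 < δ) (hE : ∀ y, E y ≤ -δ * ‖y‖)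
    {K : Set ℂ} (hK : K ⊆ U) (hK' : IsCompact K) (r : ℕ) :
    ∃ C : ℝ, 0 ≤ C ∧ ∀ z ∈ K, ∀ y, ‖Φ z y‖ ≤ C * (1 + ‖y‖) ^ (-(r : ℝ)) := by
  obtain ⟨C, hC, M, hb⟩ := h.bound K hK hK'
  obtain ⟨D, hD, hd⟩ := exists_pow_mul_exp_le hδ (M + r)
  refine ⟨C * D, by positivity, fun z hz y => (hb z hz y).trans ?_⟩
  have h1 := hd ‖y‖ (norm_nonneg y)
  have h2 : 0 < 1 + ‖y‖ := by positivity
  rw [Real.rpow_neg h2.le, Real.rpow_natCast, ← div_eq_mul_inv, le_div_iff₀ (by positivity)]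
  calc _ ≤ C * (1 + ‖y‖) ^ M * Real.exp (-δ * ‖y‖) * (1 + ‖y‖) ^ r := by
        gcongr; exact hE y
    _ = C * ((1 + ‖y‖) ^ (M + r) * Real.exp (-δ * ‖y‖)) := by rw [pow_add]; ring
    _ ≤ _ := by gcongr

theorem integrable_pow (n : ℕ) : MeasureTheory.Integrable
    (fun y : Fin n → ℝ => (1 + ‖y‖) ^ (-((n + 1 : ℕ) : ℝ))) :=
  integrable_one_add_norm (by simp)

theorem continuous (h : TameOn U E Φ) {z : ℂ} (hz : z ∈ U) : Continuous (Φ z) := by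
  rw [← continuousOn_univ]
  exact h.cont.comp (f := fun y => (z, y)) (by fun_prop) fun y _ => ⟨hz, trivial⟩

theorem integrable (h : TameOn U E Φ) {δ : ℝ} (hδ : 0 < δ) (hE : ∀ y, E y ≤ -δ * ‖y‖)
    {z : ℂ} (hz : z ∈ U) : MeasureTheory.Integrable (Φ z) := by
  obtain ⟨C, hC, hb⟩ := h.bound_pow hδ hE (Set.singleton_subset_iff.2 hz) isCompact_singleton (n + 1)
  exact ((integrable_pow n).const_mul C).mono' (h.continuous hz).aestronglyMeasurable
    (Filter.Eventually.of_forall (hb z rfl))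

theorem differentiableOn_integral (h : TameOn U E Φ) (hU : IsOpen U) {δ : ℝ} (hδ : 0 < δ)
    (hE : ∀ y, E y ≤ -δ * ‖y‖) : DifferentiableOn ℂ (fun z => ∫ y, Φ z y) U := by
  intro z₀ hz₀
  obtain ⟨ρ, hρ, hball⟩ := Metric.isOpen_iff.1 hU z₀ hz₀
  have hK : Metric.closedBall z₀ (ρ / 2) ⊆ U :=
    (Metric.closedBall_subset_ball (by linarith)).trans hball
  obtain ⟨C, hC, hb⟩ := h.bound_pow hδ hE hK (isCompact_closedBall _ _) (n + 1)
  have hmem : ∀ z ∈ Metric.ball z₀ (ρ / 4), ∀ w, dist w z ≤ ρ / 4 → w ∈ Metric.closedBall z₀ (ρ / 2) := by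
    intro z hz w hw
    rw [Metric.mem_ball] at hz
    rw [Metric.mem_closedBall]
    linarith [dist_triangle w z z₀]
  have hderiv : ∀ y, ∀ z ∈ Metric.ball z₀ (ρ / 4),
      ‖deriv (fun z => Φ z y) z‖ ≤ C / (ρ / 4) * (1 + ‖y‖) ^ (-((n + 1 : ℕ) : ℝ)) := by
    intro y z hz
    have hd : DiffContOnCl ℂ (fun z => Φ z y) (Metric.ball z (ρ / 4)) := by
      refine DifferentiableOn.diffContOnCl_ball (U := U) (h.diff y) (fun w hw => hK (hmem z hz w hw))
    refine (Complex.norm_deriv_le_of_forall_mem_sphere_norm_le (by positivity) hd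
      (fun w hw => hb w (hmem z hz w (le_of_eq hw)) y)).trans (le_of_eq (by ring))
  have hsub : Metric.ball z₀ (ρ / 4) ⊆ U := fun z hz => hK (hmem z hz z (by simp; positivity))
  have hmeas : MeasureTheory.AEStronglyMeasurable (fun y => deriv (fun z => Φ z y) z₀)
      (MeasureTheory.volume : MeasureTheory.Measure (Fin n → ℝ)) := by
    obtain ⟨u, hu, hu'⟩ : ∃ u : ℕ → ℂ, (∀ k, u k ∈ Metric.ball z₀ (ρ / 4) ∧ u k ≠ z₀) ∧
        Filter.Tendsto u Filter.atTop (nhds z₀) := by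
      refine ⟨fun k => z₀ + ((ρ / 8 / (k + 1) : ℝ) : ℂ), fun k => ⟨?_, ?_⟩, ?_⟩
      · rw [Metric.mem_ball, dist_eq_norm, add_sub_cancel_left, Complex.norm_real,
          Real.norm_of_nonneg (by positivity), div_lt_iff₀ (by positivity)]
        have : (0 : ℝ) ≤ k := Nat.cast_nonneg k
        nlinarith
      · intro h0
        have h1 : ((ρ / 8 / (k + 1) : ℝ) : ℂ) = 0 := by simpa using h0
        have h2 : ρ / 8 / (k + 1) = 0 := by exact_mod_cast h1
        have : 0 < ρ / 8 / ((k : ℝ) + 1) := by positivity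
        linarith
      · have h0 : Filter.Tendsto (fun k : ℕ => ρ / 8 / ((k : ℝ) + 1)) Filter.atTop (nhds 0) := by
          refine Filter.Tendsto.div_atTop tendsto_const_nhds ?_
          exact Filter.tendsto_atTop_add_const_right _ _ tendsto_natCast_atTop_atTop
        have h1 := (Complex.continuous_ofReal.tendsto 0).comp h0
        simpa using tendsto_const_nhds (x := z₀) |>.add h1
    refine aestronglyMeasurable_of_tendsto_ae Filter.atTop
      (f := fun k y => (u k - z₀)⁻¹ * (Φ (u k) y - Φ z₀ y)) (fun k => ?_) ?_
    · exact (continuous_const.mul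
        ((h.continuous (hsub (hu k).1)).sub (h.continuous hz₀))).aestronglyMeasurable
    · refine Filter.Eventually.of_forall fun y => ?_
      have hd := ((h.diff y).differentiableAt (hU.mem_nhds hz₀)).hasDerivAt
      rw [hasDerivAt_iff_tendsto_slope] at hd
      have := hd.comp (tendsto_nhdsWithin_iff.2 ⟨hu', Filter.Eventually.of_forall fun k => (hu k).2⟩)
      refine this.congr fun k => ?_
      simp [slope_def_module]
  have := hasDerivAt_integral_of_dominated_loc_of_deriv_le (μ := MeasureTheory.volume)
    (F := Φ) (F' := fun z y => deriv (fun z => Φ z y) z) (x₀ := z₀)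
    (bound := fun y => C / (ρ / 4) * (1 + ‖y‖) ^ (-((n + 1 : ℕ) : ℝ)))
    (Metric.ball_mem_nhds z₀ (by positivity : 0 < ρ / 4))
    (Filter.eventually_of_mem (hU.mem_nhds hz₀) fun z hz => (h.continuous hz).aestronglyMeasurable)
    (h.integrable hδ hE hz₀) hmeas
    (Filter.Eventually.of_forall hderiv) ((integrable_pow n).const_mul _)
    (Filter.Eventually.of_forall fun y z hz =>
      ((h.diff y).differentiableAt (hU.mem_nhds (hsub hz))).hasDerivAt)
  exact this.2.differentiableAt.differentiableWithinAt

end TameOn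

/-- The product of `f i j` over the pairs `i < j` in `s`. -/
@[to_additive /-- The sum of `f i j` over the pairs `i < j` in `s`. -/]
def pairProd {ι M : Type*} [LinearOrder ι] [CommMonoid M] (s : Finset ι) (f : ι → ι → M) : M :=
  ∏ i ∈ s, ∏ j ∈ s with i < j, f i j

@[to_additive]
theorem pairProd_insert {ι M : Type*} [LinearOrder ι] [CommMonoid M] {t : Finset ι} {k : ι}
    (hk : k ∉ t) {f : ι → ι → M} (hf : ∀ i j, f i j = f j i) :
    pairProd (insert k t) f = (∏ j ∈ t, f k j) * pairProd t f := by
  simp only [pairProd, Finset.prod_filter]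
  rw [Finset.prod_insert hk, Finset.prod_insert hk, if_neg (lt_irrefl k), one_mul]
  have h1 : ∀ i ∈ t, (∏ j ∈ insert k t, if i < j then f i j else 1) =
      (if i < k then f i k else 1) * ∏ j ∈ t, if i < j then f i j else 1 :=
    fun i _ => Finset.prod_insert hk
  rw [Finset.prod_congr rfl h1, Finset.prod_mul_distrib, ← mul_assoc, ← Finset.prod_mul_distrib]
  congr 1
  refine Finset.prod_congr rfl fun j hj => ?_
  have hne : j ≠ k := fun h => hk (h ▸ hj)
  rcases lt_or_gt_of_ne hne with h | h
  · rw [if_neg h.not_gt, if_pos h, one_mul, hf]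
  · rw [if_pos h, if_neg h.not_gt, mul_one]

@[to_additive]
theorem pairProd_univ {n : ℕ} {M : Type*} [CommMonoid M] (f : Fin n → Fin n → M) :
    pairProd Finset.univ f = ∏ i : Fin n, ∏ j ∈ Finset.Ioi i, f i j := by
  unfold pairProd
  refine Finset.prod_congr rfl fun i _ => Finset.prod_congr ?_ fun _ _ => rfl
  ext j; simp

theorem pairProd_congr {ι M : Type*} [LinearOrder ι] [CommMonoid M] {s : Finset ι}
    {f g : ι → ι → M} (h : ∀ i ∈ s, ∀ j ∈ s, i < j → f i j = g i j) : pairProd s f = pairProd s g := by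
  refine Finset.prod_congr rfl fun i hi => Finset.prod_congr rfl fun j hj => ?_
  rw [Finset.mem_filter] at hj
  exact h i hi j hj.1 hj.2

/-- The indices other than `k` and `l`. -/
def others {n : ℕ} (k l : Fin n) : Finset (Fin n) := (Finset.univ.erase k).erase l

theorem mem_others {n : ℕ} {k l m : Fin n} : m ∈ others k l ↔ m ≠ l ∧ m ≠ k := by
  simp [others]

theorem insert_others {n : ℕ} (k l : Fin n) :
    insert k (insert l (others k l)) = Finset.univ := by
  ext m; simp only [Finset.mem_insert, mem_others, Finset.mem_univ, iff_true]; tauto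

@[to_additive]
theorem prod_eq_mul_others {n : ℕ} {M : Type*} [CommMonoid M] {k l : Fin n} (h : k ≠ l)
    (f : Fin n → M) : ∏ j, f j = f k * f l * ∏ m ∈ others k l, f m := by
  rw [← insert_others k l, Finset.prod_insert (by simp [mem_others, h]),
    Finset.prod_insert (by simp [mem_others]), mul_assoc]

@[to_additive]
theorem pairProd_eq_mul_others {n : ℕ} {M : Type*} [CommMonoid M] {k l : Fin n} (h : k ≠ l)
    {f : Fin n → Fin n → M} (hf : ∀ i j, f i j = f j i) :
    pairProd Finset.univ f =
      f k l * (∏ m ∈ others k l, f k m * f l m) * pairProd (others k l) f := by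
  rw [← insert_others k l, pairProd_insert (by simp [mem_others, h]) hf,
    Finset.prod_insert (by simp [mem_others]), pairProd_insert (by simp [mem_others]) hf,
    Finset.prod_mul_distrib]
  simp only [mul_assoc]

theorem sum_sum_eq_pairSum {ι : Type*} [LinearOrder ι] (s : Finset ι) {f : ι → ι → ℝ}
    (hf : ∀ i j, f i j = f j i) :
    ∑ i ∈ s, ∑ j ∈ s, f i j = 2 * pairSum s f + ∑ i ∈ s, f i i := by
  induction s using Finset.induction_on with
  | empty => simp [pairSum]
  | insert k t hk ih =>
    rw [pairSum_insert hk hf, Finset.sum_insert hk, Finset.sum_insert hk, Finset.sum_insert hk]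
    have h1 : ∀ i ∈ t, ∑ j ∈ insert k t, f i j = f k i + ∑ j ∈ t, f i j := fun i _ => by
      rw [Finset.sum_insert hk, hf]
    rw [Finset.sum_congr rfl h1, Finset.sum_add_distrib, ih]
    ring

/-- The kernel `min` is positive semidefinite on the nonnegative reals. -/
theorem sum_sum_mul_min_nonneg {ι : Type*} [DecidableEq ι] (s : Finset ι) (σ r : ι → ℝ)
    (hr : ∀ i ∈ s, 0 ≤ r i) : 0 ≤ ∑ i ∈ s, ∑ j ∈ s, σ i * σ j * min (r i) (r j) := by
  induction hn : s.card generalizing s r with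
  | zero => rw [Finset.card_eq_zero] at hn; simp [hn]
  | succ n ih =>
    obtain ⟨k, hk, hmin⟩ := s.exists_min_image r (Finset.card_pos.1 (by omega))
    have h1 := ih (s.erase k) (fun i => r i - r k)
      (fun i hi => sub_nonneg.2 (hmin i (Finset.mem_of_mem_erase hi)))
      (by rw [Finset.card_erase_of_mem hk]; omega)
    have h2 : ∑ i ∈ s.erase k, ∑ j ∈ s.erase k, σ i * σ j * min (r i - r k) (r j - r k) =
        ∑ i ∈ s, ∑ j ∈ s, σ i * σ j * min (r i - r k) (r j - r k) := by
      rw [← Finset.sum_erase_add _ _ hk]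
      have h3 : ∑ j ∈ s, σ k * σ j * min (r k - r k) (r j - r k) = 0 := by
        refine Finset.sum_eq_zero fun j hj => ?_
        rw [sub_self, min_eq_left (sub_nonneg.2 (hmin j hj)), mul_zero]
      rw [h3, add_zero]
      refine Finset.sum_congr rfl fun i hi => ?_
      rw [← Finset.sum_erase_add _ _ hk, sub_self,
        min_eq_right (sub_nonneg.2 (hmin i (Finset.mem_of_mem_erase hi))), mul_zero, add_zero]
    have h4 : ∑ i ∈ s, ∑ j ∈ s, σ i * σ j * min (r i) (r j) =
        ∑ i ∈ s, ∑ j ∈ s, σ i * σ j * min (r i - r k) (r j - r k) + r k * (∑ i ∈ s, σ i) ^ 2 := by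
      rw [sq, Finset.sum_mul_sum, Finset.mul_sum, ← Finset.sum_add_distrib]
      refine Finset.sum_congr rfl fun i _ => ?_
      rw [Finset.mul_sum, ← Finset.sum_add_distrib]
      refine Finset.sum_congr rfl fun j _ => ?_
      rw [min_sub_sub_right]
      ring
    rw [h4, ← h2]
    exact add_nonneg h1 (mul_nonneg (hr k hk) (sq_nonneg _))

theorem abs_add_sub_abs_sub (x y : ℝ) :
    |x + y| - |x - y| = 2 * (SignType.sign x * SignType.sign y * min |x| |y|) := by
  rcases lt_trichotomy x 0 with hx | rfl | hx <;> rcases lt_trichotomy y 0 with hy | rfl | hy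
  all_goals simp [*, abs_of_pos, abs_of_neg]
  · rw [abs_of_neg (by linarith)]
    rcases le_total x y with h | h
    · rw [abs_of_nonpos (by linarith), min_eq_right (by linarith)]; ring
    · rw [abs_of_nonneg (by linarith), min_eq_left (by linarith)]; ring
  · rw [abs_of_neg (by linarith : x - y < 0)]
    rcases le_total (-x) y with h | h
    · rw [abs_of_nonneg (by linarith), min_eq_left (by linarith)]; ring
    · rw [abs_of_nonpos (by linarith), min_eq_right (by linarith)]; ring
  · rw [abs_of_pos (by linarith : 0 < x - y)]
    rcases le_total x (-y) with h | h
    · rw [abs_of_nonpos (by linarith), min_eq_left (by linarith)]; ring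
    · rw [abs_of_nonneg (by linarith), min_eq_right (by linarith)]; ring
  · rw [abs_of_pos (by linarith : 0 < x + y)]
    rcases le_total x y with h | h
    · rw [abs_of_nonpos (by linarith), min_eq_left (by linarith)]; ring
    · rw [abs_of_nonneg (by linarith), min_eq_right (by linarith)]; ring

theorem pairSum_abs_sub_le {n : ℕ} (x : Fin n → ℝ) :
    pairSum Finset.univ (fun i j => |x i - x j|) ≤
      pairSum Finset.univ (fun i j => |x i + x j|) + ∑ i, |x i| := by
  have h1 := sum_sum_eq_pairSum Finset.univ (f := fun i j => |x i - x j|)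
    (fun i j => abs_sub_comm _ _)
  have h2 := sum_sum_eq_pairSum Finset.univ (f := fun i j => |x i + x j|)
    (fun i j => by rw [add_comm])
  have h3 := sum_sum_mul_min_nonneg Finset.univ (fun i => ((SignType.sign (x i) : ℤ) : ℝ))
    (fun i => |x i|) (fun i _ => abs_nonneg _)
  have h4 : ∑ i, ∑ j, |x i + x j| - ∑ i, ∑ j, |x i - x j| = 2 * ∑ i, ∑ j,
      ((SignType.sign (x i) : ℤ) : ℝ) * ((SignType.sign (x j) : ℤ) : ℝ) * min |x i| |x j| := by
    rw [← Finset.sum_sub_distrib, Finset.mul_sum]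
    refine Finset.sum_congr rfl fun i _ => ?_
    rw [← Finset.sum_sub_distrib, Finset.mul_sum]
    refine Finset.sum_congr rfl fun j _ => ?_
    rw [abs_add_sub_abs_sub]
    simp
  have h5 : ∑ i, |x i + x i| = 2 * ∑ i, |x i| := by
    rw [Finset.mul_sum]
    refine Finset.sum_congr rfl fun i _ => ?_
    rw [← two_mul, abs_mul, abs_two]
  simp only [sub_self, abs_zero, Finset.sum_const_zero, add_zero] at h1
  rw [h5] at h2
  linarith

theorem pairSum_abs_sub_le_card {n : ℕ} (x : Fin (n + 1) → ℝ) :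
    pairSum Finset.univ (fun i j => |x i - x j|) ≤ n * ∑ i, |x i| := by
  have h1 := sum_sum_eq_pairSum Finset.univ (f := fun i j => |x i| + |x j|)
    (fun i j => add_comm _ _)
  have h2 : ∑ i, ∑ j, (|x i| + |x j|) = 2 * (n + 1) * ∑ i, |x i| := by
    simp only [Finset.sum_add_distrib, Finset.sum_const, Finset.card_univ, Fintype.card_fin,
      nsmul_eq_mul, ← Finset.mul_sum]
    push_cast
    ring
  have h3 : pairSum Finset.univ (fun i j => |x i - x j|) ≤
      pairSum Finset.univ (fun i j => |x i| + |x j|) :=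
    Finset.sum_le_sum fun i _ => Finset.sum_le_sum fun j _ => abs_sub _ _
  have h4 : ∑ i, (|x i| + |x i|) = 2 * ∑ i, |x i| := by
    rw [Finset.sum_add_distrib, two_mul]
  rw [h2, h4] at h1
  linarith

theorem kernel_exponent_le {n : ℕ} (x : Fin (n + 1) → ℝ) :
    Real.pi * pairSum Finset.univ (fun i j => |x i - x j|)
      - Real.pi / 2 * pairSum Finset.univ (fun i j => |x i + x j|)
      - Real.pi / 2 * (n + 3) * ∑ i, |x i| ≤ -Real.pi * ∑ i, |x i| := by
  have h1 := pairSum_abs_sub_le x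
  have h2 := pairSum_abs_sub_le_card x
  have h3 : 2 * pairSum Finset.univ (fun i j => |x i - x j|) ≤
      pairSum Finset.univ (fun i j => |x i + x j|) + (n + 1) * ∑ i, |x i| := by linarith
  nlinarith [Real.pi_pos]

/-- The coordinates of the point `(y₁, …, yₙ, -(y₁ + ⋯ + yₙ))`. -/
noncomputable def hyperCoord {n : ℕ} (j : Fin (n + 1)) : (Fin n → ℝ) →ₗ[ℝ] ℝ :=
  Fin.snoc (α := fun _ => (Fin n → ℝ) →ₗ[ℝ] ℝ) (fun i => LinearMap.proj i)
    (-∑ i, LinearMap.proj i) j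

@[simp]
theorem hyperCoord_castSucc {n : ℕ} (i : Fin n) (y : Fin n → ℝ) :
    hyperCoord i.castSucc y = y i := by
  simp [hyperCoord]

@[simp]
theorem hyperCoord_last {n : ℕ} (y : Fin n → ℝ) : hyperCoord (Fin.last n) y = -∑ i, y i := by
  simp [hyperCoord, LinearMap.sum_apply]

theorem sum_hyperCoord {n : ℕ} (y : Fin n → ℝ) : ∑ j, hyperCoord j y = 0 := by
  simp [Fin.sum_univ_castSucc]

theorem hyperCoord_restrict {n : ℕ} {x : Fin (n + 1) → ℝ} (hx : ∑ j, x j = 0) (j : Fin (n + 1)) :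
    hyperCoord j (fun i => x i.castSucc) = x j := by
  rw [Fin.sum_univ_castSucc] at hx
  refine Fin.lastCases ?_ (fun i => ?_) j
  · rw [hyperCoord_last]; linarith
  · simp

theorem norm_le_sum_hyperCoord {n : ℕ} (y : Fin n → ℝ) : ‖y‖ ≤ ∑ j, |hyperCoord j y| := by
  rw [pi_norm_le_iff_of_nonneg (by positivity)]
  intro i
  rw [Real.norm_eq_abs, ← hyperCoord_castSucc i y]
  exact Finset.single_le_sum (f := fun j => |hyperCoord j y|) (fun _ _ => abs_nonneg _)
    (Finset.mem_univ _)

/-- The point of the complex hyperplane with imaginary coordinates given by `y`. -/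
noncomputable def imagPoint {n : ℕ} (y : Fin n → ℝ) : Fin (n + 1) → ℂ :=
  fun j => (hyperCoord j y : ℂ) * Complex.I

theorem sumZeroExtend_eq_imagPoint {n : ℕ} (y : Fin n → ℝ) :
    sumZeroExtend (fun j => (y j : ℂ) * Complex.I) = imagPoint y := by
  ext j
  refine Fin.lastCases ?_ (fun i => ?_) j
  · simp [sumZeroExtend, imagPoint, Finset.sum_mul]
  · simp [sumZeroExtend, imagPoint]

/-- The action of the transposition of `k` and `l` on the hyperplane. -/
noncomputable def hyperSwap {n : ℕ} (k l : Fin (n + 1)) : (Fin n → ℝ) →ₗ[ℝ] (Fin n → ℝ) :=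
  LinearMap.pi fun i => hyperCoord (Equiv.swap k l i.castSucc)

theorem hyperCoord_hyperSwap {n : ℕ} (k l j : Fin (n + 1)) (y : Fin n → ℝ) :
    hyperCoord j (hyperSwap k l y) = hyperCoord (Equiv.swap k l j) y := by
  refine hyperCoord_restrict (x := fun j => hyperCoord (Equiv.swap k l j) y) ?_ j
  rw [Equiv.sum_comp (Equiv.swap k l) (fun j => hyperCoord j y), sum_hyperCoord]

theorem hyperSwap_hyperSwap {n : ℕ} (k l : Fin (n + 1)) (y : Fin n → ℝ) :
    hyperSwap k l (hyperSwap k l y) = y := by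
  ext i
  rw [← hyperCoord_castSucc i (hyperSwap k l _), hyperCoord_hyperSwap, hyperCoord_hyperSwap, Equiv.swap_apply_self,
    hyperCoord_castSucc]

theorem measurePreserving_hyperSwap {n : ℕ} (k l : Fin (n + 1)) :
    MeasureTheory.MeasurePreserving (hyperSwap k l) := by
  have hdet : LinearMap.det (hyperSwap k l) * LinearMap.det (hyperSwap k l) = 1 := by
    rw [← LinearMap.det_comp, ← LinearMap.det_id (A := ℝ) (M := Fin n → ℝ)]
    congr 1
    ext1
    ext1
    simp [hyperSwap_hyperSwap]
  have h0 : LinearMap.det (hyperSwap k l) ≠ 0 := fun h => by simp [h] at hdet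
  have h1 : |LinearMap.det (hyperSwap k l)| = 1 := by
    have := abs_mul_abs_self (LinearMap.det (hyperSwap k l))
    rw [hdet] at this
    nlinarith [abs_nonneg (LinearMap.det (hyperSwap k l))]
  refine ⟨(hyperSwap k l).continuous_of_finiteDimensional.measurable, ?_⟩
  rw [MeasureTheory.Measure.map_linearMap_addHaar_eq_smul_addHaar _ h0, abs_inv, h1]
  simp

theorem integral_comp_swap {n : ℕ} (k l : Fin (n + 1)) (f : (Fin (n + 1) → ℂ) → ℂ) :
    ∫ y : Fin n → ℝ, f (imagPoint y ∘ Equiv.swap k l) = ∫ y : Fin n → ℝ, f (imagPoint y) := by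
  have hinv : Function.Involutive (hyperSwap (n := n) k l) := hyperSwap_hyperSwap k l
  have hemb : MeasurableEmbedding (hyperSwap (n := n) k l) :=
    (LinearEquiv.ofInvolutive (hyperSwap k l) hinv).toContinuousLinearEquiv.toHomeomorph.measurableEmbedding
  rw [← (measurePreserving_hyperSwap k l).integral_comp hemb]
  congr 1 with y
  congr 1 with j
  simp [imagPoint, hyperCoord_hyperSwap]

theorem imagPoint_add {n : ℕ} {d : Fin (n + 1) → ℝ} (hd : ∑ j, d j = 0) (y : Fin n → ℝ) (t : ℝ)
    (j : Fin (n + 1)) :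
    imagPoint (y + fun i => t * d i.castSucc) j = imagPoint y j + t * Complex.I * d j := by
  have h : ∑ j, t * d j = 0 := by rw [← Finset.mul_sum, hd, mul_zero]
  simp only [imagPoint, map_add, hyperCoord_restrict h]
  push_cast
  ring

/-- Shift of the contour of integration in the real direction `d` of the hyperplane. -/
theorem integral_shift_eq {n : ℕ} {U : Set ℂ} {E : (Fin n → ℝ) → ℝ} {f : (Fin (n + 1) → ℂ) → ℂ}
    {d : Fin (n + 1) → ℝ} (hd : ∑ j, d j = 0)
    (hf : TameOn U E (fun z y => f (fun j => imagPoint y j + z * d j)))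
    (hU : IsOpen U) (hU' : IsPreconnected U) {δ : ℝ} (hδ : 0 < δ)
    (hE : ∀ y, E y ≤ -δ * ‖y‖) {z w : ℂ} (hz : z ∈ U) (hw : w ∈ U) :
    ∫ y : Fin n → ℝ, f (fun j => imagPoint y j + z * d j) =
      ∫ y : Fin n → ℝ, f (fun j => imagPoint y j + w * d j) := by
  have hdiff := hf.differentiableOn_integral hU hδ hE
  have htrans : ∀ z : ℂ, ∀ t : ℝ, ∫ y : Fin n → ℝ, f (fun j => imagPoint y j + (z + t * Complex.I) * d j) =
      ∫ y : Fin n → ℝ, f (fun j => imagPoint y j + z * d j) := by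
    intro z t
    rw [← MeasureTheory.integral_add_right_eq_self
      (fun y : Fin n → ℝ => f (fun j => imagPoint y j + z * d j)) (fun i => t * d i.castSucc)]
    congr 1 with y
    congr 1 with j
    rw [imagPoint_add hd]
    ring
  refine hU.is_const_of_deriv_eq_zero hU' hdiff (fun z hz => ?_) hz hw
  have h1 := (hdiff.differentiableAt (hU.mem_nhds hz)).hasDerivAt
  have h2 : HasDerivAt (fun t : ℝ => z + (t : ℂ) * Complex.I) Complex.I 0 := by
    have := ((Complex.ofRealCLM.hasDerivAt (x := 0)).mul_const Complex.I).const_add z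
    simpa using this
  have h1' : HasDerivAt (fun z => ∫ y : Fin n → ℝ, f (fun j => imagPoint y j + z * d j))
      (deriv (fun z => ∫ y : Fin n → ℝ, f (fun j => imagPoint y j + z * d j)) z)
      ((fun t : ℝ => z + (t : ℂ) * Complex.I) 0) := by
    simp only [Complex.ofReal_zero, zero_mul, add_zero]
    exact h1
  have h3 := HasDerivAt.scomp (0 : ℝ) h1' h2
  have h4 : HasDerivAt ((fun z => ∫ y : Fin n → ℝ, f (fun j => imagPoint y j + z * d j)) ∘
      fun t : ℝ => z + (t : ℂ) * Complex.I) 0 0 := by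
    refine (hasDerivAt_const (0 : ℝ) (∫ y : Fin n → ℝ, f (fun j => imagPoint y j + z * d j))).congr_of_eventuallyEq ?_
    exact Filter.Eventually.of_forall fun t => htrans z t
  have h5 := h3.unique h4
  simpa using h5

theorem ae_imagPoint_ne {n : ℕ} {k l : Fin (n + 1)} (h : k ≠ l) :
    ∀ᵐ y : Fin n → ℝ, imagPoint y k ≠ imagPoint y l := by
  let S : Submodule ℝ (Fin n → ℝ) := LinearMap.ker (hyperCoord k - hyperCoord l)
  have hS : S ≠ ⊤ := by
    intro hT
    have h1 : ∑ j, ((if j = k then (1 : ℝ) else 0) - if j = l then 1 else 0) = 0 := by simp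
    have h2 : (fun i : Fin n => (if i.castSucc = k then (1 : ℝ) else 0) - if i.castSucc = l then 1 else 0) ∈ S := by
      rw [hT]; trivial
    rw [LinearMap.mem_ker, LinearMap.sub_apply,
      hyperCoord_restrict (x := fun j => (if j = k then (1 : ℝ) else 0) - if j = l then 1 else 0) h1,
      hyperCoord_restrict (x := fun j => (if j = k then (1 : ℝ) else 0) - if j = l then 1 else 0) h1] at h2
    simp [h, h.symm] at h2
  have h0 := MeasureTheory.Measure.addHaar_submodule MeasureTheory.volume S hS
  rw [MeasureTheory.ae_iff]
  convert h0 using 2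
  ext y
  simp only [not_not, Set.mem_ofPred_eq, SetLike.mem_coe, S, LinearMap.mem_ker, LinearMap.sub_apply,
    sub_eq_zero, imagPoint]
  constructor
  · intro h
    exact_mod_cast mul_right_cancel₀ Complex.I_ne_zero h
  · intro h
    rw [h]

theorem ae_injective_imagPoint (n : ℕ) : ∀ᵐ y : Fin n → ℝ, Function.Injective (imagPoint y) := by
  have h : ∀ᵐ y : Fin n → ℝ, ∀ p : {p : Fin (n + 1) × Fin (n + 1) // p.1 ≠ p.2},
      imagPoint y p.1.1 ≠ imagPoint y p.1.2 :=
    MeasureTheory.ae_all_iff.2 fun p => ae_imagPoint_ne p.2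
  filter_upwards [h] with y hy i j hij
  by_contra hne
  exact hy ⟨(i, j), hne⟩ hij

open Complex in
theorem inv_Gamma_mul_Gamma_neg (x : ℂ) :
    (Gamma x * Gamma (-x))⁻¹ = -x * sin (Real.pi * x) / Real.pi := by
  have hpi : (Real.pi : ℂ) ≠ 0 := ofReal_ne_zero.2 Real.pi_ne_zero
  rcases eq_or_ne x 0 with rfl | hx
  · simp
  have h1 := Gamma_mul_Gamma_one_sub x
  have h2 : Gamma (1 - x) = -x * Gamma (-x) := by
    rw [← Gamma_add_one (-x) (neg_ne_zero.2 hx)]; congr 1; ring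
  rw [h2] at h1
  have h3 : Gamma x * Gamma (-x) = -(Real.pi / sin (Real.pi * x)) / x := by
    rw [← h1]; field_simp
  rw [h3]
  rcases eq_or_ne (sin (Real.pi * x)) 0 with h | h
  · simp [h]
  · field_simp

/-- The factor of the kernel attached to one variable. -/
noncomputable def weight {n m : ℕ} (a : Fin n → ℂ) (b : Fin m → ℂ) (B z : ℂ) : ℂ :=
  ((∏ i, Complex.Gamma (a i + z)) * ∏ i, Complex.Gamma (b i - z)) / ∏ i, Complex.Gamma (B + a i - z)

/-- The factor of the kernel attached to a pair of variables. -/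
noncomputable def pairFactor (B x y : ℂ) : ℂ :=
  Complex.Gamma (B - x - y) / (Complex.Gamma (x - y) * Complex.Gamma (y - x))

theorem pairFactor_comm (B x y : ℂ) : pairFactor B x y = pairFactor B y x := by
  unfold pairFactor
  rw [mul_comm (Complex.Gamma (x - y)), sub_right_comm]

theorem pairFactor_eq (B x y : ℂ) : pairFactor B x y =
    -(x - y) / Real.pi * (Complex.Gamma (B - x - y) * Complex.sin (Real.pi * (x - y))) := by
  unfold pairFactor
  rw [div_eq_mul_inv, ← neg_sub x y, inv_Gamma_mul_Gamma_neg]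
  ring

theorem gammaKernel_eq {n : ℕ} (a : Fin n → ℂ) (b : Fin (n + 3) → ℂ) (v : Fin (n + 1) → ℂ) :
    gammaKernel a b v = (∏ j, weight a b (∑ k, b k) (v j)) *
      pairProd Finset.univ (fun i j => pairFactor (∑ k, b k) (v i) (v j)) := by
  rw [pairProd_univ]
  rfl

namespace TameOn

variable {n : ℕ} {U : Set ℂ}

theorem gamma_of {V : ℂ → (Fin n → ℝ) → ℂ} (c : ℂ → ℂ) (ℓ : (Fin n → ℝ) →ₗ[ℝ] ℝ)
    (hc : DifferentiableOn ℂ c U) (hpos : ∀ z ∈ U, 0 < (c z).re)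
    (hV : ∀ z y, V z y = c z + ℓ y * Complex.I) :
    TameOn U (fun y => -(Real.pi / 2) * |ℓ y|) (fun z y => Complex.Gamma (V z y)) :=
  (gamma hc hpos ℓ).congr (fun _ => le_rfl) fun z _ y => by rw [hV]

theorem inv_gamma_of {V : ℂ → (Fin n → ℝ) → ℂ} (c : ℂ → ℂ) (ℓ : (Fin n → ℝ) →ₗ[ℝ] ℝ)
    (hc : DifferentiableOn ℂ c U) (hpos : ∀ z ∈ U, 0 < (c z).re)
    (hV : ∀ z y, V z y = c z + ℓ y * Complex.I) :
    TameOn U (fun y => (Real.pi / 2) * |ℓ y|) (fun z y => (Complex.Gamma (V z y))⁻¹) :=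
  (inv_gamma hc hpos ℓ).congr (fun _ => le_rfl) fun z _ y => by rw [hV]

theorem sin_pi_of {V : ℂ → (Fin n → ℝ) → ℂ} (c : ℂ → ℂ) (ℓ : (Fin n → ℝ) →ₗ[ℝ] ℝ)
    (hc : DifferentiableOn ℂ c U)
    (hV : ∀ z y, V z y = c z + ℓ y * Complex.I) :
    TameOn U (fun y => Real.pi * |ℓ y|) (fun z y => Complex.sin (Real.pi * V z y)) :=
  (sin_pi hc ℓ).congr (fun _ => le_rfl) fun z _ y => by rw [hV]

theorem affine_of {V : ℂ → (Fin n → ℝ) → ℂ} (c : ℂ → ℂ) (ℓ : (Fin n → ℝ) →ₗ[ℝ] ℝ)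
    (hc : DifferentiableOn ℂ c U)
    (hV : ∀ z y, V z y = c z + ℓ y * Complex.I) :
    TameOn U (fun _ => 0) (fun z y => V z y) :=
  (affine hc ℓ).congr (fun _ => le_rfl) fun z _ y => by rw [hV]

theorem gamma_ratio {V : ℂ → (Fin n → ℝ) → ℂ} {s α β : ℂ → ℂ} {ℓ : (Fin n → ℝ) →ₗ[ℝ] ℝ}
    (hV : ∀ z y, V z y = s z + ℓ y * Complex.I)
    (hs : DifferentiableOn ℂ s U) (hα : DifferentiableOn ℂ α U) (hβ : DifferentiableOn ℂ β U)
    (h1 : ∀ z ∈ U, 0 < (α z + s z).re) (h2 : ∀ z ∈ U, 0 < (β z - s z).re) :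
    TameOn U (fun _ => 0)
      (fun z y => Complex.Gamma (α z + V z y) / Complex.Gamma (β z - V z y)) := by
  refine ((gamma_of (V := fun z y => α z + V z y) (fun z => α z + s z) ℓ (hα.add hs) h1
    (fun z y => by rw [hV]; ring)).mul (inv_gamma_of (V := fun z y => β z - V z y)
    (fun z => β z - s z) (-ℓ) (hβ.sub hs) h2 (fun z y => by
      rw [hV, LinearMap.neg_apply]; push_cast; ring))).congr (fun y => ?_) fun z _ y => ?_
  · rw [LinearMap.neg_apply, abs_neg]; apply le_of_eq; ring
  · rw [div_eq_mul_inv]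

theorem weight {m p : ℕ} {V : ℂ → (Fin n → ℝ) → ℂ} {s B : ℂ → ℂ} {ℓ : (Fin n → ℝ) →ₗ[ℝ] ℝ}
    {a : ℂ → Fin m → ℂ} {b : ℂ → Fin p → ℂ}
    (hV : ∀ z y, V z y = s z + ℓ y * Complex.I)
    (hs : DifferentiableOn ℂ s U) (hB : DifferentiableOn ℂ B U)
    (ha : ∀ i, DifferentiableOn ℂ (fun z => a z i) U)
    (hb : ∀ i, DifferentiableOn ℂ (fun z => b z i) U)
    (h1 : ∀ z ∈ U, ∀ i, 0 < (a z i + s z).re) (h2 : ∀ z ∈ U, ∀ i, 0 < (b z i - s z).re)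
    (h3 : ∀ z ∈ U, ∀ i, 0 < (B z + a z i - s z).re) :
    TameOn U (fun y => -(Real.pi / 2) * p * |ℓ y|)
      (fun z y => _root_.weight (a z) (b z) (B z) (V z y)) := by
  refine ((prod Finset.univ fun i _ => gamma_ratio (α := fun z => a z i) (β := fun z => B z + a z i)
    hV hs (ha i) (hB.add (ha i)) (fun z hz => h1 z hz i) (fun z hz => h3 z hz i)).mul
    (prod Finset.univ fun i _ => gamma_of (V := fun z y => b z i - V z y) (fun z => b z i - s z) (-ℓ)
      ((hb i).sub hs) (fun z hz => h2 z hz i) (fun z y => by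
        rw [hV, LinearMap.neg_apply]; push_cast; ring))).congr (fun y => ?_) fun z _ y => ?_
  · simp only [LinearMap.neg_apply, abs_neg, Finset.sum_const, Finset.card_univ, Fintype.card_fin,
      nsmul_eq_mul]
    apply le_of_eq; ring
  · rw [Finset.prod_div_distrib, _root_.weight]
    ring

theorem pairFactor {V W : ℂ → (Fin n → ℝ) → ℂ} {s t B : ℂ → ℂ} {ℓ ℓ' : (Fin n → ℝ) →ₗ[ℝ] ℝ}
    (hV : ∀ z y, V z y = s z + ℓ y * Complex.I) (hW : ∀ z y, W z y = t z + ℓ' y * Complex.I)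
    (hs : DifferentiableOn ℂ s U) (ht : DifferentiableOn ℂ t U) (hB : DifferentiableOn ℂ B U)
    (h : ∀ z ∈ U, 0 < (B z - s z - t z).re) :
    TameOn U (fun y => Real.pi * |ℓ y - ℓ' y| - Real.pi / 2 * |ℓ y + ℓ' y|)
      (fun z y => _root_.pairFactor (B z) (V z y) (W z y)) := by
  have e1 : ∀ z y, V z y - W z y = (s z - t z) + (ℓ - ℓ') y * Complex.I := fun z y => by
    rw [hV, hW, LinearMap.sub_apply]; push_cast; ring
  refine (((const (-1 / (Real.pi : ℂ))).mul (affine_of _ _ (hs.sub ht) e1)).mul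
    ((gamma_of (V := fun z y => B z - V z y - W z y) (fun z => B z - s z - t z) (-(ℓ + ℓ'))
      ((hB.sub hs).sub ht) h (fun z y => by
        rw [hV, hW, LinearMap.neg_apply, LinearMap.add_apply]; push_cast; ring)).mul
      (sin_pi_of _ _ (hs.sub ht) e1))).congr (fun y => ?_) fun z _ y => ?_
  · simp only [LinearMap.neg_apply, abs_neg, LinearMap.add_apply, LinearMap.sub_apply]
    apply le_of_eq; ring
  · rw [pairFactor_eq]; ring

theorem pairProd {N : ℕ} (S : Finset (Fin N)) {E : Fin N → Fin N → (Fin n → ℝ) → ℝ}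
    {Φ : Fin N → Fin N → ℂ → (Fin n → ℝ) → ℂ} (h : ∀ i ∈ S, ∀ j ∈ S, i < j → TameOn U (E i j) (Φ i j)) :
    TameOn U (fun y => pairSum S (fun i j => E i j y))
      (fun z y => _root_.pairProd S (fun i j => Φ i j z y)) :=
  prod S fun i hi => prod _ fun j hj => by
    rw [Finset.mem_filter] at hj
    exact h i hi j hj.1 hj.2

end TameOn

theorem pairSum_mul_sub {N : ℕ} (S : Finset (Fin N)) (c d : ℝ) (f g : Fin N → Fin N → ℝ) :
    pairSum S (fun i j => c * f i j - d * g i j) = c * pairSum S f - d * pairSum S g := by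
  simp only [pairSum, Finset.sum_sub_distrib, Finset.mul_sum]

theorem hyper_exponent_le {n : ℕ} (y : Fin n → ℝ) :
    ∑ j : Fin (n + 1), -(Real.pi / 2) * ((n + 3 : ℕ) : ℝ) * |hyperCoord j y| +
      pairSum Finset.univ (fun i j : Fin (n + 1) => Real.pi * |hyperCoord i y - hyperCoord j y| -
        Real.pi / 2 * |hyperCoord i y + hyperCoord j y|) ≤ -Real.pi * ∑ j, |hyperCoord j y| := by
  have h1 := kernel_exponent_le (fun j : Fin (n + 1) => hyperCoord j y)
  rw [pairSum_mul_sub, ← Finset.mul_sum]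
  push_cast at h1 ⊢
  linarith

theorem neg_pi_mul_le {n : ℕ} (y : Fin n → ℝ) :
    -Real.pi * ∑ j, |hyperCoord j y| ≤ -Real.pi * ‖y‖ := by
  nlinarith [norm_le_sum_hyperCoord y, Real.pi_pos]

theorem imagPoint_eq {n : ℕ} (y : Fin n → ℝ) (j : Fin (n + 1)) :
    imagPoint y j = 0 + (hyperCoord j y : ℂ) * Complex.I := by
  rw [imagPoint, zero_add]

/-- The kernel, for parameters depending holomorphically on `z`. -/
theorem tameOn_gammaKernel {n : ℕ} {U : Set ℂ} {a : ℂ → Fin n → ℂ} {b : ℂ → Fin (n + 3) → ℂ}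
    (ha : ∀ i, DifferentiableOn ℂ (fun z => a z i) U)
    (hb : ∀ i, DifferentiableOn ℂ (fun z => b z i) U)
    (ha0 : ∀ z ∈ U, ∀ i, 0 < (a z i).re) (hb0 : ∀ z ∈ U, ∀ i, 0 < (b z i).re) :
    TameOn U (fun y => -Real.pi * ‖y‖) (fun z y => gammaKernel (a z) (b z) (imagPoint y)) := by
  have hB : DifferentiableOn ℂ (fun z => ∑ k, b z k) U := DifferentiableOn.fun_sum fun i _ => hb i
  have hB0 : ∀ z ∈ U, 0 < (∑ k, b z k).re := fun z hz => by
    rw [Complex.re_sum]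
    exact Finset.sum_pos (fun i _ => hb0 z hz i) Finset.univ_nonempty
  refine ((TameOn.prod Finset.univ fun j _ => TameOn.weight (s := fun _ => 0)
    (V := fun z y => imagPoint y j) (fun z y => imagPoint_eq y j)
    (differentiableOn_const 0) hB ha hb (fun z hz i => by simpa using ha0 z hz i)
    (fun z hz i => by simpa using hb0 z hz i) (fun z hz i => ?_)).mul
    (TameOn.pairProd Finset.univ fun i _ j _ _ => TameOn.pairFactor (s := fun _ => 0) (t := fun _ => 0)
      (V := fun z y => imagPoint y i) (W := fun z y => imagPoint y j) (fun z y => imagPoint_eq y i)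
      (fun z y => imagPoint_eq y j) (differentiableOn_const 0) (differentiableOn_const 0) hB
      (fun z hz => by simpa using hB0 z hz))).congr
    (fun y => (hyper_exponent_le y).trans (neg_pi_mul_le y)) (fun z _ y => ?_)
  · have := hB0 z hz
    have := ha0 z hz i
    rw [sub_zero, Complex.add_re]; positivity
  · rw [gammaKernel_eq]

theorem sum_prod_sub_div_eq_zero {N : ℕ} {v b : Fin (N + 1) → ℂ} (hv : Function.Injective v)
    (h : ∑ i, v i = ∑ i, b i) :
    ∑ k, (∏ i, (b i - v k)) / ∏ m ∈ Finset.univ.erase k, (v k - v m) = 0 := by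
  let p : Polynomial ℂ := ∏ i, (Polynomial.X - Polynomial.C (b i))
  let q : Polynomial ℂ := ∏ i, (Polynomial.X - Polynomial.C (v i))
  have hp : p.Monic := Polynomial.monic_prod_of_monic _ _ fun i _ => Polynomial.monic_X_sub_C _
  have hq : q.Monic := Polynomial.monic_prod_of_monic _ _ fun i _ => Polynomial.monic_X_sub_C _
  have hpd : p.degree = ((N + 1 : ℕ) : WithBot ℕ) := by
    simp [p, Polynomial.degree_prod]
  have hqd : q.degree = ((N + 1 : ℕ) : WithBot ℕ) := by
    simp [q, Polynomial.degree_prod]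
  have hdeg : (p - q).degree < (Finset.univ : Finset (Fin (N + 1))).card := by
    rw [Finset.card_univ, Fintype.card_fin, ← hpd]
    exact Polynomial.degree_sub_lt_left (by rw [hpd, hqd]) hp.ne_zero (by rw [hp.leadingCoeff, hq.leadingCoeff])
  have hsum := Lagrange.coeff_eq_sum (hv.injOn (s := ((Finset.univ : Finset (Fin (N + 1))) : Set (Fin (N + 1))))) hdeg
  have hcoeff : (p - q).coeff ((Finset.univ : Finset (Fin (N + 1))).card - 1) = 0 := by
    have hc : 0 < (Finset.univ : Finset (Fin (N + 1))).card := by simp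
    rw [Polynomial.coeff_sub, Polynomial.prod_X_sub_C_coeff_card_pred _ _ hc,
      Polynomial.prod_X_sub_C_coeff_card_pred _ _ hc, h, sub_self]
  rw [hcoeff] at hsum
  have h2 : ∀ k, (∏ i, (b i - v k)) = (-1) ^ (N + 1) * (p - q).eval (v k) := by
    intro k
    have h3 : q.eval (v k) = 0 := by
      rw [Polynomial.eval_prod]
      exact Finset.prod_eq_zero (Finset.mem_univ k) (by simp)
    rw [Polynomial.eval_sub, h3, sub_zero, Polynomial.eval_prod]
    simp only [Polynomial.eval_sub, Polynomial.eval_X, Polynomial.eval_C]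
    have : ((-1 : ℂ)) ^ (N + 1) = ∏ _i : Fin (N + 1), (-1 : ℂ) := by simp
    rw [this, ← Finset.prod_mul_distrib]
    exact Finset.prod_congr rfl fun i _ => by ring
  simp only [h2, mul_div_assoc]
  rw [← Finset.mul_sum, ← hsum, mul_zero]

theorem prod_univ_erase {N : ℕ} (k : Fin N) (f : Fin N → ℂ) :
    ∏ m ∈ Finset.univ.erase k, f m = ∏ m, if m = k then 1 else f m := by
  rw [← Finset.mul_prod_erase _ _ (Finset.mem_univ k), if_pos rfl, one_mul]
  exact Finset.prod_congr rfl fun m hm => by rw [if_neg (Finset.ne_of_mem_erase hm)]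

/-- Partial fractions with the nodes `v k`, `-a` and `B + a`. -/
theorem sum_prod_div_eq {N : ℕ} {v : Fin (N + 1) → ℂ} {b : Fin (N + 3) → ℂ} {a B : ℂ}
    (hB : B = ∑ i, b i) (hv : Function.Injective v) (hv0 : ∑ i, v i = 0) (ha : ∀ k, a + v k ≠ 0)
    (hBa : ∀ k, B + a - v k ≠ 0) (hBaa : B + 2 * a ≠ 0) :
    ∑ k, (∏ i, (b i - v k)) / ((a + v k) * (B + a - v k) * ∏ m ∈ Finset.univ.erase k, (v k - v m)) =
      (-1) ^ (N + 1) / (B + 2 * a) *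
        ((∏ i, (B + a - b i)) / ∏ m, (B + a - v m) - (∏ i, (a + b i)) / ∏ m, (a + v m)) := by
  have hinj : Function.Injective (Fin.cons (-a) (Fin.cons (B + a) v) : Fin (N + 3) → ℂ) := by
    rw [Fin.cons_injective_iff, Fin.cons_injective_iff]
    refine ⟨?_, ?_, hv⟩
    · rintro ⟨j, hj⟩
      refine Fin.cases (fun h => ?_) (fun k h => ?_) j hj
      · rw [Fin.cons_zero] at h
        exact hBaa (by linear_combination h)
      · rw [Fin.cons_succ] at h
        exact ha k (by rw [h]; ring)
    · rintro ⟨k, h⟩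
      exact hBa k (by rw [h]; ring)
  have h := sum_prod_sub_div_eq_zero (b := b) hinj (by
    rw [Fin.sum_univ_succ, Fin.sum_univ_succ, ← hB]
    simp [hv0])
  obtain ⟨P, hP⟩ : ∃ P : ℂ → ℂ, ∀ z, ∏ i, (b i - z) = P z := ⟨_, fun _ => rfl⟩
  simp only [hP, prod_univ_erase] at h ⊢
  rw [Fin.sum_univ_succ, Fin.sum_univ_succ] at h
  simp only [Fin.prod_univ_succ (n := N + 2), Fin.prod_univ_succ (n := N + 1), Fin.cons_zero, Fin.cons_succ, if_true,
    Fin.succ_ne_zero, if_false, one_mul, (Fin.succ_ne_zero _).symm, Fin.succ_inj] at h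
  have hneg : ∀ (M : ℕ) (f g : Fin M → ℂ), (∀ i, f i = -g i) → ∏ i, f i = (-1) ^ M * ∏ i, g i := by
    intro M f g hfg
    have : ((-1 : ℂ)) ^ M = ∏ _i : Fin M, (-1 : ℂ) := by simp
    rw [this, ← Finset.prod_mul_distrib]
    exact Finset.prod_congr rfl fun i _ => by rw [hfg]; ring
  have e1 : P (-a) = ∏ i, (a + b i) := (hP _).symm.trans <| Finset.prod_congr rfl fun i _ => by ring
  have e2 := hneg _ (fun m => -a - v m) (fun m => a + v m) (fun m => by ring)
  have e3 := (hP _).symm.trans (hneg _ (fun i => b i - (B + a)) (fun i => B + a - b i) (fun i => by ring))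
  have e4 : ∀ k, P (v k) / ((v k - -a) * ((v k - (B + a)) *
      ∏ m, if m = k then 1 else v k - v m)) =
      -(P (v k) / ((a + v k) * (B + a - v k) * ∏ m, if m = k then 1 else v k - v m)) := by
    intro k
    rw [← div_neg]
    congr 1
    ring
  rw [e1, e2, e3, Finset.sum_congr rfl fun k _ => e4 k, Finset.sum_neg_distrib] at h
  have hsgn : ((-1 : ℂ) ^ (N + 1)) * (-1) ^ (N + 1) = 1 := by
    rw [← mul_pow]; simp
  have hW : ∏ m, (a + v m) ≠ 0 := Finset.prod_ne_zero_iff.2 fun m _ => ha m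
  have hY : ∏ m, (B + a - v m) ≠ 0 := Finset.prod_ne_zero_iff.2 fun m _ => hBa m
  have h1 : (∏ i, (a + b i)) / ((-a - (B + a)) * ((-1) ^ (N + 1) * ∏ m, (a + v m))) =
      -((-1) ^ (N + 1) / (B + 2 * a) * ((∏ i, (a + b i)) / ∏ m, (a + v m))) := by
    have : (-a - (B + a)) = -(B + 2 * a) := by ring
    rw [this]
    have hs : ((-1 : ℂ) ^ (N + 1))⁻¹ = (-1) ^ (N + 1) := inv_eq_of_mul_eq_one_left hsgn
    rw [div_eq_mul_inv, mul_inv, mul_inv, hs, inv_neg]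
    ring
  have h2 : ((-1) ^ (N + 3) * ∏ i, (B + a - b i)) / ((B + a - -a) * ∏ m, (B + a - v m)) =
      (-1) ^ (N + 1) / (B + 2 * a) * ((∏ i, (B + a - b i)) / ∏ m, (B + a - v m)) := by
    have : (B + a - -a) = B + 2 * a := by ring
    rw [this, pow_add _ N 3, pow_add _ N 1]
    field_simp
  rw [h1, h2] at h
  linear_combination -h

theorem sum_prod_add_div_eq_one {n N : ℕ} {s : Finset (Fin N)} (hs : s.card = n + 1) {ζ : Fin N → ℂ}
    (hζ : Set.InjOn ζ s) (c : Fin n → ℂ) :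
    ∑ l ∈ s, (∏ i, (c i + ζ l)) / ∏ m ∈ s.erase l, (ζ l - ζ m) = 1 := by
  let p : Polynomial ℂ := ∏ i, (Polynomial.X + Polynomial.C (c i))
  have hp : p.Monic := Polynomial.monic_prod_of_monic _ _ fun i _ => Polynomial.monic_X_add_C _
  have hpd : p.degree = (n : WithBot ℕ) := by
    simp [p, Polynomial.degree_prod]
  have h := Lagrange.leadingCoeff_eq_sum hζ (P := p) (by rw [hpd, hs]; norm_cast)
  rw [hp.leadingCoeff] at h
  rw [h]
  refine Finset.sum_congr rfl fun l _ => ?_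
  rw [Polynomial.eval_prod]
  simp [add_comm]

/-- The factor of the cross term attached to either of the two distinguished variables. -/
noncomputable def crossWeight {n m : ℕ} (a : ℂ) (a' : Fin n → ℂ) (b : Fin m → ℂ) (B z : ℂ) : ℂ :=
  Complex.Gamma (a + z) / Complex.Gamma (B + a + 1 - z) * weight a' (fun i => b i + 1) B z

/-- The factor of one variable in the common multiple of the kernels for `a` and `a + 1`. -/
noncomputable def raisedWeight {n m : ℕ} (a : ℂ) (a' : Fin n → ℂ) (b : Fin m → ℂ) (B z : ℂ) : ℂ :=
  Complex.Gamma (a + 1 + z) / Complex.Gamma (B + a - z) * weight a' b B z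

theorem crossWeight_eq {n m : ℕ} {a : ℂ} {a' : Fin n → ℂ} {b : Fin m → ℂ} {B z : ℂ}
    (ha : a + z ≠ 0) (hb : ∀ i, b i - z ≠ 0) (hB : B + a - z ≠ 0) :
    crossWeight a a' b B z =
      raisedWeight a a' b B z * ((∏ i, (b i - z)) / ((a + z) * (B + a - z))) := by
  unfold crossWeight raisedWeight weight
  have h1 : a + 1 + z = (a + z) + 1 := by ring
  have h2 : B + a + 1 - z = (B + a - z) + 1 := by ring
  have h3 : ∏ i, Complex.Gamma (b i + 1 - z) = (∏ i, (b i - z)) * ∏ i, Complex.Gamma (b i - z) := by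
    rw [← Finset.prod_mul_distrib]
    refine Finset.prod_congr rfl fun i _ => ?_
    rw [← Complex.Gamma_add_one _ (hb i)]
    congr 1; ring
  rw [h1, h2, h3, Complex.Gamma_add_one _ ha, Complex.Gamma_add_one _ hB]
  field_simp

theorem crossWeight_add_one_eq {n m : ℕ} {a : ℂ} {a' : Fin n → ℂ} {b : Fin m → ℂ} {B z : ℂ}
    (ha' : ∀ i, a' i + z ≠ 0) (hB' : ∀ i, B + a' i - 1 - z ≠ 0) :
    crossWeight a a' b B (z + 1) =
      raisedWeight a a' b B z * ∏ i, (a' i + z) * (B + a' i - 1 - z) := by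
  unfold crossWeight raisedWeight weight
  have h1 : a + (z + 1) = a + 1 + z := by ring
  have h2 : B + a + 1 - (z + 1) = B + a - z := by ring
  have h3 : ∏ i, Complex.Gamma (b i + 1 - (z + 1)) = ∏ i, Complex.Gamma (b i - z) :=
    Finset.prod_congr rfl fun i _ => by congr 1; ring
  have h4 : ∏ i, Complex.Gamma (a' i + (z + 1)) = (∏ i, (a' i + z)) * ∏ i, Complex.Gamma (a' i + z) := by
    rw [← Finset.prod_mul_distrib]
    refine Finset.prod_congr rfl fun i _ => ?_
    rw [← Complex.Gamma_add_one _ (ha' i)]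
    congr 1; ring
  have h5 : ∏ i, Complex.Gamma (B + a' i - z) =
      (∏ i, (B + a' i - 1 - z)) * ∏ i, Complex.Gamma (B + a' i - (z + 1)) := by
    rw [← Finset.prod_mul_distrib]
    refine Finset.prod_congr rfl fun i _ => ?_
    have e : B + a' i - z = (B + a' i - 1 - z) + 1 := by ring
    rw [e, Complex.Gamma_add_one _ (hB' i)]
    congr 2; ring
  have h6 : ∏ i, (B + a' i - 1 - z) ≠ 0 := Finset.prod_ne_zero_iff.2 fun i _ => hB' i
  rw [h1, h2, h3, h4, h5, Finset.prod_mul_distrib]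
  field_simp

/-- The function whose integral vanishes by antisymmetry after a shift of the contour. -/
noncomputable def crossTerm {n m N : ℕ} (a : ℂ) (a' : Fin n → ℂ) (b : Fin m → ℂ) (B : ℂ)
    (k l : Fin N) (v : Fin N → ℂ) : ℂ :=
  Complex.sin (Real.pi * (v k - v l)) * Complex.Gamma (B - v k - v l) *
    (crossWeight a a' b B (v k) * crossWeight a a' b B (v l + 1)) *
    (∏ m ∈ others k l, raisedWeight a a' b B (v m) *
      (Complex.sin (Real.pi * (v k - v m)) * Complex.sin (Real.pi * (v l - v m)) *
        (Complex.Gamma (B - v k - v m) * Complex.Gamma (B - (v l + 1) - v m)))) *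
    pairProd (others k l) (fun i j => pairFactor B (v i) (v j))

theorem crossTerm_swap {n m N : ℕ} (a : ℂ) (a' : Fin n → ℂ) (b : Fin m → ℂ) (B : ℂ)
    {k l : Fin N} {v w : Fin N → ℂ} (hk : w k = v l + 1) (hl : w l + 1 = v k)
    (hm : ∀ m ∈ others k l, w m = v m) :
    crossTerm a a' b B k l w = -crossTerm a a' b B k l v := by
  have hl' : w l = v k - 1 := by rw [← hl]; ring
  have s1 : ∀ x : ℂ, Complex.sin (Real.pi * (x + 1)) = -Complex.sin (Real.pi * x) := fun x => by
    rw [mul_add, mul_one, Complex.sin_add_pi]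
  have s2 : ∀ x : ℂ, Complex.sin (Real.pi * (x - 1)) = -Complex.sin (Real.pi * x) := fun x => by
    rw [mul_sub, mul_one, Complex.sin_sub_pi]
  have e1 : Complex.sin (Real.pi * (w k - w l)) = -Complex.sin (Real.pi * (v k - v l)) := by
    have : (Real.pi : ℂ) * (w k - w l) = -(Real.pi * (v k - v l)) + 2 * Real.pi := by
      rw [hk, hl']; ring
    rw [this, Complex.sin_add_two_pi, Complex.sin_neg]
  have e2 : B - w k - w l = B - v k - v l := by rw [hk, hl']; ring
  unfold crossTerm
  rw [e1, e2, hl, hk, Finset.prod_congr rfl (g := fun m => raisedWeight a a' b B (v m) *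
      (Complex.sin (Real.pi * (v k - v m)) * Complex.sin (Real.pi * (v l - v m)) *
        (Complex.Gamma (B - v k - v m) * Complex.Gamma (B - (v l + 1) - v m)))) (fun m hm' => ?_),
    pairProd_congr (g := fun i j => pairFactor B (v i) (v j))
      (fun i hi j hj _ => by rw [hm i hi, hm j hj])]
  · ring
  · have e3 : v l + 1 - v m = (v l - v m) + 1 := by ring
    have e4 : v k - 1 - v m = (v k - v m) - 1 := by ring
    rw [hm m hm', hl', e3, e4, s1, s2]
    ring

theorem prod_erase_eq_mul_others {N : ℕ} {k l : Fin N} (h : k ≠ l) (f : Fin N → ℂ) :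
    ∏ m ∈ Finset.univ.erase k, f m = f l * ∏ m ∈ others k l, f m := by
  rw [others, Finset.mul_prod_erase]
  simp [h.symm]

theorem card_others {N : ℕ} {k l : Fin (N + 2)} (h : k ≠ l) : (others k l).card = N := by
  rw [others, Finset.card_erase_of_mem (by simp [h.symm]), Finset.card_erase_of_mem (by simp)]
  simp

theorem crossTerm_eq {n m N : ℕ} {a : ℂ} {a' : Fin n → ℂ} {b : Fin m → ℂ} {B : ℂ}
    {k l : Fin (N + 2)} (hkl : k ≠ l) {v : Fin (N + 2) → ℂ} (hv : Function.Injective v)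
    (ha : ∀ k, a + v k ≠ 0) (hb : ∀ i k, b i - v k ≠ 0) (hBa : ∀ k, B + a - v k ≠ 0)
    (ha' : ∀ i k, a' i + v k ≠ 0) (hB' : ∀ i k, B + a' i - 1 - v k ≠ 0)
    (hB1 : ∀ k l, B - 1 - v k - v l ≠ 0) :
    crossTerm a a' b B k l v =
      -Real.pi * Real.pi ^ (2 * N) * ((∏ j, raisedWeight a a' b B (v j)) *
        pairProd Finset.univ (fun i j => pairFactor B (v i) (v j))) *
      ((∏ i, (b i - v k)) / ((a + v k) * (B + a - v k) * ∏ m ∈ Finset.univ.erase k, (v k - v m))) *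
      ((∏ i, (a' i * (B + a' i - 1) + v l * (B - 1 - v l))) /
        ∏ m ∈ others k l, (v l * (B - 1 - v l) - v m * (B - 1 - v m))) := by
  have hpi : (Real.pi : ℂ) ≠ 0 := Complex.ofReal_ne_zero.2 Real.pi_ne_zero
  have hsub : ∀ i j, i ≠ j → v i - v j ≠ 0 := fun i j h => sub_ne_zero.2 (hv.ne h)
  have hpf : ∀ i j, i ≠ j → Complex.Gamma (B - v i - v j) * Complex.sin (Real.pi * (v i - v j)) =
      -Real.pi / (v i - v j) * pairFactor B (v i) (v j) := by
    intro i j h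
    have := hsub i j h
    rw [pairFactor_eq]
    field_simp
  have hG : ∀ m, Complex.Gamma (B - (v l + 1) - v m) =
      Complex.Gamma (B - v l - v m) / (B - 1 - v l - v m) := by
    intro m
    have e : B - v l - v m = (B - 1 - v l - v m) + 1 := by ring
    rw [e, Complex.Gamma_add_one _ (hB1 l m), mul_div_cancel_left₀ _ (hB1 l m)]
    congr 1; ring
  have hprod : ∀ m ∈ others k l, raisedWeight a a' b B (v m) *
      (Complex.sin (Real.pi * (v k - v m)) * Complex.sin (Real.pi * (v l - v m)) *
        (Complex.Gamma (B - v k - v m) * Complex.Gamma (B - (v l + 1) - v m))) =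
      raisedWeight a a' b B (v m) * (pairFactor B (v k) (v m) * pairFactor B (v l) (v m)) *
        (Real.pi ^ 2 / ((v k - v m) * (v l * (B - 1 - v l) - v m * (B - 1 - v m)))) := by
    intro m hm
    rw [mem_others] at hm
    have h1 := hpf k m hm.2.symm
    have h2 := hpf l m hm.1.symm
    have e : v l * (B - 1 - v l) - v m * (B - 1 - v m) = (v l - v m) * (B - 1 - v l - v m) := by ring
    have h3 := hsub k m hm.2.symm
    have h4 := hsub l m hm.1.symm
    have h5 := hB1 l m
    rw [hG, e]
    calc _ = raisedWeight a a' b B (v m) * ((Complex.Gamma (B - v k - v m) * Complex.sin (Real.pi * (v k - v m))) *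
          (Complex.Gamma (B - v l - v m) * Complex.sin (Real.pi * (v l - v m)))) / (B - 1 - v l - v m) := by ring
      _ = _ := by rw [h1, h2]; field_simp
  unfold crossTerm
  rw [Finset.prod_congr rfl hprod, crossWeight_eq (ha k) (fun i => hb i k) (hBa k),
    crossWeight_add_one_eq (fun i => ha' i l) (fun i => hB' i l),
    mul_comm (Complex.sin _) (Complex.Gamma _), hpf k l hkl, prod_eq_mul_others hkl,
    pairProd_eq_mul_others hkl (fun i j => pairFactor_comm B (v i) (v j)),
    prod_erase_eq_mul_others hkl]
  simp only [Finset.prod_mul_distrib, Finset.prod_div_distrib, Finset.prod_const, card_others hkl]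
  have e5 : ∏ i, (a' i * (B + a' i - 1) + v l * (B - 1 - v l)) =
      (∏ i, (a' i + v l)) * ∏ i, (B + a' i - 1 - v l) := by
    rw [← Finset.prod_mul_distrib]
    exact Finset.prod_congr rfl fun i _ => by ring
  rw [e5, ← pow_mul]
  simp only [div_eq_mul_inv, mul_inv]
  ring

theorem isOpen_strip (r R : ℝ) : IsOpen {z : ℂ | r < z.re ∧ z.re < R} :=
  (isOpen_lt continuous_const Complex.continuous_re).inter
    (isOpen_lt Complex.continuous_re continuous_const)

theorem isPreconnected_strip (r R : ℝ) : IsPreconnected {z : ℂ | r < z.re ∧ z.re < R} :=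
  ((convex_halfSpace_re_gt r).inter (convex_halfSpace_re_lt R)).isPreconnected

theorem exists_pos_le {ι : Type*} [Finite ι] (f : ι → ℝ) (hf : ∀ i, 0 < f i) :
    ∃ ε, 0 < ε ∧ ∀ i, ε ≤ f i := by
  cases nonempty_fintype ι
  rcases isEmpty_or_nonempty ι with h | h
  · exact ⟨1, one_pos, fun i => h.elim i⟩
  · obtain ⟨i, -, hi⟩ := Finset.exists_min_image Finset.univ f Finset.univ_nonempty
    exact ⟨f i, hf i, fun j => hi j (Finset.mem_univ j)⟩

theorem TameOn.crossWeight {n m p : ℕ} {U : Set ℂ} {V : ℂ → (Fin n → ℝ) → ℂ} {s : ℂ → ℂ}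
    {ℓ : (Fin n → ℝ) →ₗ[ℝ] ℝ} {a B : ℂ} {a' : Fin m → ℂ} {b : Fin p → ℂ}
    (hV : ∀ z y, V z y = s z + ℓ y * Complex.I) (hs : DifferentiableOn ℂ s U)
    (h1 : ∀ z ∈ U, 0 < (a + s z).re) (h2 : ∀ z ∈ U, 0 < (B + a + 1 - s z).re)
    (h3 : ∀ z ∈ U, ∀ i, 0 < (a' i + s z).re) (h4 : ∀ z ∈ U, ∀ i, 0 < (b i + 1 - s z).re)
    (h5 : ∀ z ∈ U, ∀ i, 0 < (B + a' i - s z).re) :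
    TameOn U (fun y => -(Real.pi / 2) * p * |ℓ y|)
      (fun z y => _root_.crossWeight a a' b B (V z y)) := by
  refine ((TameOn.gamma_ratio (α := fun _ => a) (β := fun _ => B + a + 1) hV hs
    (differentiableOn_const _) (differentiableOn_const _) h1 h2).mul
    (TameOn.weight (a := fun _ => a') (b := fun _ i => b i + 1) (B := fun _ => B) hV hs
      (differentiableOn_const _) (fun _ => differentiableOn_const _) (fun _ => differentiableOn_const _)
      h3 h4 h5)).congr (fun y => by simp) (fun z _ y => rfl)

theorem TameOn.raisedWeight {n m p : ℕ} {U : Set ℂ} {V : ℂ → (Fin n → ℝ) → ℂ} {s : ℂ → ℂ}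
    {ℓ : (Fin n → ℝ) →ₗ[ℝ] ℝ} {a B : ℂ} {a' : Fin m → ℂ} {b : Fin p → ℂ}
    (hV : ∀ z y, V z y = s z + ℓ y * Complex.I) (hs : DifferentiableOn ℂ s U)
    (h1 : ∀ z ∈ U, 0 < (a + 1 + s z).re) (h2 : ∀ z ∈ U, 0 < (B + a - s z).re)
    (h3 : ∀ z ∈ U, ∀ i, 0 < (a' i + s z).re) (h4 : ∀ z ∈ U, ∀ i, 0 < (b i - s z).re)
    (h5 : ∀ z ∈ U, ∀ i, 0 < (B + a' i - s z).re) :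
    TameOn U (fun y => -(Real.pi / 2) * p * |ℓ y|)
      (fun z y => _root_.raisedWeight a a' b B (V z y)) := by
  refine ((TameOn.gamma_ratio (α := fun _ => a + 1) (β := fun _ => B + a) hV hs
    (differentiableOn_const _) (differentiableOn_const _) h1 h2).mul
    (TameOn.weight (a := fun _ => a') (b := fun _ => b) (B := fun _ => B) hV hs
      (differentiableOn_const _) (fun _ => differentiableOn_const _) (fun _ => differentiableOn_const _)
      h3 h4 h5)).congr (fun y => by simp) (fun z _ y => rfl)

/-- The direction `e_k - e_l`. -/
def rootDir {N : ℕ} (k l j : Fin N) : ℝ := (if j = k then 1 else 0) - if j = l then 1 else 0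

theorem sum_rootDir {N : ℕ} (k l : Fin N) : ∑ j, rootDir k l j = 0 := by
  simp [rootDir]

theorem rootDir_left {N : ℕ} {k l : Fin N} (h : k ≠ l) : rootDir k l k = 1 := by
  simp [rootDir, h]

theorem rootDir_right {N : ℕ} {k l : Fin N} (h : k ≠ l) : rootDir k l l = -1 := by
  simp [rootDir, h.symm]

theorem rootDir_others {N : ℕ} {k l m : Fin N} (h : m ∈ others k l) : rootDir k l m = 0 := by
  rw [mem_others] at h
  simp [rootDir, h.1, h.2]

section

variable {n : ℕ} {a B : ℂ} {a' : Fin n → ℂ} {b : Fin (n + 4) → ℂ}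

theorem tameOn_crossTerm (ha : 0 < a.re) (ha' : ∀ i, 0 < (a' i).re) (hb : ∀ i, 0 < (b i).re)
    (hB1 : 1 < B.re) {ε : ℝ} (h1 : ε ≤ a.re) (h2 : ∀ i, ε ≤ (a' i).re) (h3 : ∀ i, ε ≤ (b i).re)
    (h4 : ε ≤ B.re - 1) {k l : Fin (n + 2)} (hkl : k ≠ l) :
    TameOn {z : ℂ | -ε < z.re ∧ z.re < 1} (fun y => -Real.pi * ‖y‖)
      (fun z y => crossTerm a a' b B k l (fun j => imagPoint y j + z * rootDir k l j)) := by
  have hk : ∀ z (y : Fin (n + 1) → ℝ), imagPoint y k + z * rootDir k l k =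
      z + hyperCoord k y * Complex.I := fun z y => by
    rw [rootDir_left hkl, imagPoint]; push_cast; ring
  have hl : ∀ z (y : Fin (n + 1) → ℝ), imagPoint y l + z * rootDir k l l =
      -z + hyperCoord l y * Complex.I := fun z y => by
    rw [rootDir_right hkl, imagPoint]; push_cast; ring
  have hl1 : ∀ z (y : Fin (n + 1) → ℝ), imagPoint y l + z * rootDir k l l + 1 =
      (1 - z) + hyperCoord l y * Complex.I := fun z y => by
    rw [hl]; ring
  have hm : ∀ m ∈ others k l, ∀ z (y : Fin (n + 1) → ℝ), imagPoint y m + z * rootDir k l m =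
      0 + hyperCoord m y * Complex.I := fun m hm z y => by
    rw [rootDir_others hm, imagPoint]; push_cast; ring
  have dz : DifferentiableOn ℂ (fun z : ℂ => z) {z : ℂ | -ε < z.re ∧ z.re < 1} := differentiableOn_id
  have d0 : DifferentiableOn ℂ (fun z : ℂ => (0 : ℂ)) {z : ℂ | -ε < z.re ∧ z.re < 1} :=
    differentiableOn_const 0
  have T1 := (TameOn.sin_pi_of (fun z : ℂ => z - -z) (hyperCoord k - hyperCoord l) (by fun_prop)
    (V := fun z y => (imagPoint y k + z * rootDir k l k) - (imagPoint y l + z * rootDir k l l))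
    (U := {z : ℂ | -ε < z.re ∧ z.re < 1})
    (fun z y => by rw [hk, hl, LinearMap.sub_apply]; push_cast; ring)).mul
    (TameOn.gamma_of (fun _ : ℂ => B) (-(hyperCoord k + hyperCoord l)) (by fun_prop)
    (V := fun z y => B - (imagPoint y k + z * rootDir k l k) - (imagPoint y l + z * rootDir k l l))
    (fun z hz => by linarith)
    (fun z y => by rw [hk, hl, LinearMap.neg_apply, LinearMap.add_apply]; push_cast; ring))
  have T2 := (TameOn.crossWeight (a := a) (B := B) (a' := a') (b := b) hk dz
    (fun z hz => by simp only [Complex.add_re]; linarith [hz.1])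
    (fun z hz => by simp only [Complex.add_re, Complex.sub_re, Complex.one_re]; linarith [hz.2])
    (fun z hz i => by simp only [Complex.add_re]; linarith [hz.1, h2 i])
    (fun z hz i => by simp only [Complex.add_re, Complex.sub_re, Complex.one_re]; linarith [hz.2, hb i])
    (fun z hz i => by simp only [Complex.add_re, Complex.sub_re]; linarith [hz.2, ha' i])).mul
    (TameOn.crossWeight (a := a) (B := B) (a' := a') (b := b) hl1 (by fun_prop)
    (fun z hz => by simp only [Complex.add_re, Complex.sub_re, Complex.one_re]; linarith [hz.2])
    (fun z hz => by simp only [Complex.add_re, Complex.sub_re, Complex.one_re]; linarith [hz.1])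
    (fun z hz i => by simp only [Complex.add_re, Complex.sub_re, Complex.one_re]; linarith [hz.2, ha' i])
    (fun z hz i => by simp only [Complex.add_re, Complex.sub_re, Complex.one_re]; linarith [hz.1, h3 i])
    (fun z hz i => by simp only [Complex.add_re, Complex.sub_re, Complex.one_re]; linarith [hz.1, ha' i]))
  have T3 := TameOn.prod (others k l) fun m hm' =>
    (TameOn.raisedWeight (a := a) (B := B) (a' := a') (b := b) (hm m hm') d0
      (fun z hz => by simp only [Complex.add_re, Complex.zero_re, Complex.one_re]; linarith)
      (fun z hz => by simp only [Complex.add_re, Complex.sub_re, Complex.zero_re]; linarith)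
      (fun z hz i => by simp only [Complex.add_re, Complex.zero_re]; linarith [ha' i])
      (fun z hz i => by simp only [Complex.sub_re, Complex.zero_re]; linarith [hb i])
      (fun z hz i => by simp only [Complex.add_re, Complex.sub_re, Complex.zero_re]; linarith [ha' i])).mul
    (((TameOn.sin_pi_of (fun z : ℂ => z) (hyperCoord k - hyperCoord m) (by fun_prop)
      (V := fun z y => (imagPoint y k + z * rootDir k l k) - (imagPoint y m + z * rootDir k l m))
      (fun z y => by rw [hk, hm m hm', LinearMap.sub_apply]; push_cast; ring)).mul
    (TameOn.sin_pi_of (fun z : ℂ => -z) (hyperCoord l - hyperCoord m) (by fun_prop)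
      (V := fun z y => (imagPoint y l + z * rootDir k l l) - (imagPoint y m + z * rootDir k l m))
      (fun z y => by rw [hl, hm m hm', LinearMap.sub_apply]; push_cast; ring))).mul
    ((TameOn.gamma_of (fun z : ℂ => B - z) (-(hyperCoord k + hyperCoord m)) (by fun_prop)
      (V := fun z y => B - (imagPoint y k + z * rootDir k l k) - (imagPoint y m + z * rootDir k l m))
      (fun z hz => by simp only [Complex.sub_re]; linarith [hz.2])
      (fun z y => by rw [hk, hm m hm', LinearMap.neg_apply, LinearMap.add_apply]; push_cast; ring)).mul
    (TameOn.gamma_of (fun z : ℂ => B - 1 + z) (-(hyperCoord l + hyperCoord m)) (by fun_prop)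
      (V := fun z y => B - (imagPoint y l + z * rootDir k l l + 1) - (imagPoint y m + z * rootDir k l m))
      (fun z hz => by simp only [Complex.sub_re, Complex.add_re, Complex.one_re]; linarith [hz.1])
      (fun z y => by rw [hl, hm m hm', LinearMap.neg_apply, LinearMap.add_apply]; push_cast; ring))))
  have T4 := TameOn.pairProd (others k l) fun i hi j hj _ =>
    TameOn.pairFactor (B := fun _ => B) (hm i hi) (hm j hj) d0 d0 (by fun_prop)
    (fun z hz => by simp only [Complex.sub_re, Complex.zero_re]; linarith)
  refine (((T1.mul T2).mul T3).mul T4).congr (fun y => ?_) (fun z _ y => rfl)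
  refine le_trans ?_ ((hyper_exponent_le y).trans (neg_pi_mul_le y))
  rw [sum_eq_add_others hkl, pairSum_eq_add_others hkl (fun i j => by rw [abs_sub_comm, add_comm (hyperCoord i y)])]
  simp only [LinearMap.neg_apply, LinearMap.add_apply, LinearMap.sub_apply, abs_neg]
  simp only [Finset.sum_add_distrib, Finset.sum_sub_distrib, ← Finset.mul_sum,
    show n + 1 + 3 = n + 4 from rfl]
  linarith

theorem integral_crossTerm (ha : 0 < a.re) (ha' : ∀ i, 0 < (a' i).re) (hb : ∀ i, 0 < (b i).re)
    (hB1 : 1 < B.re) {k l : Fin (n + 2)} (hkl : k ≠ l) :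
    MeasureTheory.Integrable (fun y : Fin (n + 1) → ℝ => crossTerm a a' b B k l (imagPoint y)) ∧
    ∫ y : Fin (n + 1) → ℝ, crossTerm a a' b B k l (imagPoint y) = 0 := by
  obtain ⟨ε₁, hε₁, h2⟩ := exists_pos_le (fun i => (a' i).re) ha'
  obtain ⟨ε₂, hε₂, h3⟩ := exists_pos_le (fun i => (b i).re) hb
  have hT := tameOn_crossTerm (ε := min (min ε₁ ε₂) (min a.re (B.re - 1))) ha ha' hb hB1
    ((min_le_right _ _).trans (min_le_left _ _))
    (fun i => ((min_le_left _ _).trans (min_le_left _ _)).trans (h2 i))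
    (fun i => ((min_le_left _ _).trans (min_le_right _ _)).trans (h3 i))
    ((min_le_right _ _).trans (min_le_right _ _)) hkl
  have hε : 0 < min (min ε₁ ε₂) (min a.re (B.re - 1)) :=
    lt_min (lt_min hε₁ hε₂) (lt_min ha (by linarith))
  set ε := min (min ε₁ ε₂) (min a.re (B.re - 1))
  have hz0 : (0 : ℂ) ∈ {z : ℂ | -ε < z.re ∧ z.re < 1} := by simp [hε]
  have hz1 : (1 / 2 : ℂ) ∈ {z : ℂ | -ε < z.re ∧ z.re < 1} := by
    constructor <;> norm_num; linarith
  refine ⟨by simpa using hT.integrable Real.pi_pos (fun y => le_rfl) hz0, ?_⟩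
  have hshift := integral_shift_eq (sum_rootDir k l) hT (isOpen_strip _ _) (isPreconnected_strip _ _)
    Real.pi_pos (fun y => le_rfl) hz0 hz1
  have hswap := integral_comp_swap k l
    (fun v : Fin (n + 2) → ℂ => crossTerm a a' b B k l (fun j => v j + (1 / 2 : ℂ) * rootDir k l j))
  have hneg : ∀ y : Fin (n + 1) → ℝ,
      crossTerm a a' b B k l (fun j => (imagPoint y ∘ Equiv.swap k l) j + (1 / 2 : ℂ) * rootDir k l j) =
      -crossTerm a a' b B k l (fun j => imagPoint y j + (1 / 2 : ℂ) * rootDir k l j) := by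
    intro y
    refine crossTerm_swap a a' b B ?_ ?_ ?_
    · simp only [Function.comp, Equiv.swap_apply_left, rootDir_left hkl, rootDir_right hkl]
      push_cast; ring
    · simp only [Function.comp, Equiv.swap_apply_right, rootDir_left hkl, rootDir_right hkl]
      push_cast; ring
    · intro m hm
      have hm' := mem_others.1 hm
      simp only [Function.comp, Equiv.swap_apply_of_ne_of_ne hm'.2 hm'.1]
  simp only [hneg, MeasureTheory.integral_neg] at hswap
  simp only [zero_mul, add_zero] at hshift
  rw [hshift]
  linear_combination (-1 / 2 : ℂ) * hswap

theorem weight_cons {m p : ℕ} (a : ℂ) (a' : Fin m → ℂ) (b : Fin p → ℂ) (B z : ℂ) :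
    weight (Fin.cons a a' : Fin (m + 1) → ℂ) b B z =
      Complex.Gamma (a + z) / Complex.Gamma (B + a - z) * weight a' b B z := by
  unfold weight
  rw [Fin.prod_univ_succ, Fin.prod_univ_succ]
  simp only [Fin.cons_zero, Fin.cons_succ]
  rw [mul_assoc, mul_div_mul_comm]

theorem gammaKernel_cons (a : ℂ) (a' : Fin n → ℂ) (b : Fin (n + 4) → ℂ) (v : Fin (n + 2) → ℂ) :
    gammaKernel (Fin.cons a a' : Fin (n + 1) → ℂ) b v =
      (∏ j, Complex.Gamma (a + v j) / Complex.Gamma (∑ k, b k + a - v j)) *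
      ((∏ j, weight a' b (∑ k, b k) (v j)) *
        pairProd Finset.univ (fun i j => pairFactor (∑ k, b k) (v i) (v j))) := by
  rw [gammaKernel_eq, ← mul_assoc, ← Finset.prod_mul_distrib]
  congr 1
  exact Finset.prod_congr rfl fun j _ => weight_cons _ _ _ _ _

theorem add_imagPoint_ne_zero {c : ℂ} (hc : 0 < c.re) {N : ℕ} (y : Fin N → ℝ) (j : Fin (N + 1)) :
    c + imagPoint y j ≠ 0 := fun h => by
  have := congrArg Complex.re h
  simp [imagPoint] at this
  linarith

theorem sub_imagPoint_ne_zero {c : ℂ} (hc : 0 < c.re) {N : ℕ} (y : Fin N → ℝ) (j : Fin (N + 1)) :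
    c - imagPoint y j ≠ 0 := fun h => by
  have := congrArg Complex.re h
  simp [imagPoint] at this
  linarith

/-- The kernels for the parameters `a` and `a + 1` combine to a sum of cross terms. -/
theorem sum_crossTerm_eq (hB : B = ∑ i, b i) (ha : 0 < a.re) (ha' : ∀ i, 0 < (a' i).re)
    (hb : ∀ i, 0 < (b i).re) (hB1 : 1 < B.re) {y : Fin (n + 1) → ℝ}
    (hy : Function.Injective (imagPoint y)) :
    ∑ k, ∑ l ∈ Finset.univ.erase k, crossTerm a a' b B k l (imagPoint y) =
      (-1) ^ (n + 1) * Real.pi ^ (2 * n + 1) / (B + 2 * a) *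
        ((∏ i, (B + a - b i)) * gammaKernel (Fin.cons (a + 1) a' : Fin (n + 1) → ℂ) b (imagPoint y) -
          (∏ i, (a + b i)) * gammaKernel (Fin.cons a a' : Fin (n + 1) → ℂ) b (imagPoint y)) := by
  have h1 : ∀ k, a + imagPoint y k ≠ 0 := add_imagPoint_ne_zero ha y
  have h2 : ∀ i k, b i - imagPoint y k ≠ 0 := fun i => sub_imagPoint_ne_zero (hb i) y
  have h3 : ∀ k, B + a - imagPoint y k ≠ 0 :=
    sub_imagPoint_ne_zero (by rw [Complex.add_re]; linarith) y
  have h4 : ∀ i k, a' i + imagPoint y k ≠ 0 := fun i => add_imagPoint_ne_zero (ha' i) y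
  have h5 : ∀ i k, B + a' i - 1 - imagPoint y k ≠ 0 := fun i =>
    sub_imagPoint_ne_zero (by rw [Complex.sub_re, Complex.add_re, Complex.one_re]; linarith [ha' i]) y
  have h6 : ∀ k l, B - 1 - imagPoint y k - imagPoint y l ≠ 0 := fun k l h => by
    have := congrArg Complex.re h
    simp [imagPoint] at this
    linarith
  have h7 : B + 2 * a ≠ 0 := fun h => by
    have := congrArg Complex.re h
    simp at this
    linarith
  have hsum : ∀ k, ∑ l ∈ Finset.univ.erase k,
      ((∏ i, (a' i * (B + a' i - 1) + imagPoint y l * (B - 1 - imagPoint y l))) /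
        ∏ m ∈ others k l, (imagPoint y l * (B - 1 - imagPoint y l) -
          imagPoint y m * (B - 1 - imagPoint y m))) = 1 := by
    intro k
    refine sum_prod_add_div_eq_one (ζ := fun j => imagPoint y j * (B - 1 - imagPoint y j)) ?_ ?_
      (fun i => a' i * (B + a' i - 1))
    · rw [Finset.card_erase_of_mem (Finset.mem_univ k)]; simp
    · intro i _ j _ hij
      have : (imagPoint y i - imagPoint y j) * (B - 1 - imagPoint y i - imagPoint y j) = 0 := by
        linear_combination hij
      rcases mul_eq_zero.1 this with h | h
      · exact hy (sub_eq_zero.1 h)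
      · exact absurd h (h6 i j)
  have hk : ∀ k, ∑ l ∈ Finset.univ.erase k, crossTerm a a' b B k l (imagPoint y) =
      -Real.pi * Real.pi ^ (2 * n) * ((∏ j, raisedWeight a a' b B (imagPoint y j)) *
        pairProd Finset.univ (fun i j => pairFactor B (imagPoint y i) (imagPoint y j))) *
      ((∏ i, (b i - imagPoint y k)) / ((a + imagPoint y k) * (B + a - imagPoint y k) *
        ∏ m ∈ Finset.univ.erase k, (imagPoint y k - imagPoint y m))) := by
    intro k
    rw [← mul_one (_ * (_ / _)), ← hsum k, Finset.mul_sum]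
    refine Finset.sum_congr rfl fun l hl => ?_
    exact crossTerm_eq (Finset.ne_of_mem_erase hl).symm hy h1 h2 h3 h4 h5 h6
  rw [Finset.sum_congr rfl fun k _ => hk k, ← Finset.mul_sum,
    sum_prod_div_eq hB hy (by simp only [imagPoint, ← Finset.sum_mul, ← Complex.ofReal_sum, sum_hyperCoord]; simp) h1 h3 h7,
    gammaKernel_cons, gammaKernel_cons, ← hB]
  have e1 : (∏ j, Complex.Gamma (a + 1 + imagPoint y j) / Complex.Gamma (B + (a + 1) - imagPoint y j)) *
      (∏ j, weight a' b B (imagPoint y j)) =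
      (∏ j, raisedWeight a a' b B (imagPoint y j)) / ∏ m, (B + a - imagPoint y m) := by
    rw [← Finset.prod_mul_distrib, ← Finset.prod_div_distrib]
    refine Finset.prod_congr rfl fun j _ => ?_
    have e : B + (a + 1) - imagPoint y j = (B + a - imagPoint y j) + 1 := by ring
    rw [raisedWeight, e, Complex.Gamma_add_one _ (h3 j)]
    have := h3 j
    field_simp
  have e2 : (∏ j, Complex.Gamma (a + imagPoint y j) / Complex.Gamma (B + a - imagPoint y j)) *
      (∏ j, weight a' b B (imagPoint y j)) =
      (∏ j, raisedWeight a a' b B (imagPoint y j)) / ∏ m, (a + imagPoint y m) := by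
    rw [← Finset.prod_mul_distrib, ← Finset.prod_div_distrib]
    refine Finset.prod_congr rfl fun j _ => ?_
    have e : a + 1 + imagPoint y j = (a + imagPoint y j) + 1 := by ring
    rw [raisedWeight, e, Complex.Gamma_add_one _ (h1 j)]
    have := h1 j
    field_simp
  rw [← mul_assoc (∏ j, Complex.Gamma (a + 1 + imagPoint y j) / _), e1,
    ← mul_assoc (∏ j, Complex.Gamma (a + imagPoint y j) / _), e2]
  ring

theorem integrable_gammaKernel {n : ℕ} {a : Fin n → ℂ} {b : Fin (n + 3) → ℂ}
    (ha : ∀ i, 0 < (a i).re) (hb : ∀ i, 0 < (b i).re) :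
    MeasureTheory.Integrable (fun y : Fin n → ℝ => gammaKernel a b (imagPoint y)) :=
  (tameOn_gammaKernel (U := Set.univ) (a := fun _ => a) (b := fun _ => b)
    (fun _ => differentiableOn_const _) (fun _ => differentiableOn_const _) (fun _ _ => ha)
    (fun _ _ => hb)).integrable Real.pi_pos (fun _ => le_rfl) (Set.mem_univ 0)

theorem integral_gammaKernel_add_one (hB : B = ∑ i, b i) (ha : 0 < a.re)
    (ha' : ∀ i, 0 < (a' i).re) (hb : ∀ i, 0 < (b i).re) (hB1 : 1 < B.re) :
    (∏ i, (B + a - b i)) * ∫ y : Fin (n + 1) → ℝ,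
        gammaKernel (Fin.cons (a + 1) a' : Fin (n + 1) → ℂ) b (imagPoint y) =
      (∏ i, (a + b i)) * ∫ y : Fin (n + 1) → ℝ,
        gammaKernel (Fin.cons a a' : Fin (n + 1) → ℂ) b (imagPoint y) := by
  have hI1 := integrable_gammaKernel (a := (Fin.cons (a + 1) a' : Fin (n + 1) → ℂ)) (b := b)
    (fun i => Fin.cases (by rw [Fin.cons_zero, Complex.add_re, Complex.one_re]; linarith)
      (fun i => by rw [Fin.cons_succ]; exact ha' i) i) hb
  have hI2 := integrable_gammaKernel (a := (Fin.cons a a' : Fin (n + 1) → ℂ)) (b := b)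
    (fun i => Fin.cases (by rwa [Fin.cons_zero])
      (fun i => by rw [Fin.cons_succ]; exact ha' i) i) hb
  have hzero : ∫ y : Fin (n + 1) → ℝ,
      ∑ k, ∑ l ∈ Finset.univ.erase k, crossTerm a a' b B k l (imagPoint y) = 0 := by
    rw [MeasureTheory.integral_finsetSum _ fun k _ => MeasureTheory.integrable_finsetSum _ fun l hl =>
      (integral_crossTerm ha ha' hb hB1 (Finset.ne_of_mem_erase hl).symm).1]
    refine Finset.sum_eq_zero fun k _ => ?_
    rw [MeasureTheory.integral_finsetSum _ fun l hl =>
      (integral_crossTerm ha ha' hb hB1 (Finset.ne_of_mem_erase hl).symm).1]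
    exact Finset.sum_eq_zero fun l hl =>
      (integral_crossTerm ha ha' hb hB1 (Finset.ne_of_mem_erase hl).symm).2
  rw [MeasureTheory.integral_congr_ae ((ae_injective_imagPoint (n + 1)).mono fun y hy =>
    sum_crossTerm_eq hB ha ha' hb hB1 hy), MeasureTheory.integral_const_mul,
    MeasureTheory.integral_sub (hI1.const_mul _) (hI2.const_mul _),
    MeasureTheory.integral_const_mul, MeasureTheory.integral_const_mul] at hzero
  have h7 : B + 2 * a ≠ 0 := fun h => by
    have := congrArg Complex.re h
    simp at this
    linarith
  have hpi : (Real.pi : ℂ) ≠ 0 := Complex.ofReal_ne_zero.2 Real.pi_ne_zero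
  have hc : (-1 : ℂ) ^ (n + 1) * Real.pi ^ (2 * n + 1) / (B + 2 * a) ≠ 0 :=
    div_ne_zero (mul_ne_zero (pow_ne_zero _ (by norm_num)) (pow_ne_zero _ hpi)) h7
  exact sub_eq_zero.1 ((mul_eq_zero.1 hzero).resolve_left hc)

end

open Complex in
theorem tendsto_Gamma_div_cpow {s : ℂ} (hs : 0 < s.re) :
    Filter.Tendsto (fun N : ℕ => Gamma (s + N + 1) / ((N : ℂ) ^ s * (N.factorial : ℂ)))
      Filter.atTop (nhds 1) := by
  have h0 : Gamma s ≠ 0 := Gamma_ne_zero_of_re_pos hs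
  have h := (tendsto_const_nhds (x := Gamma s)).div (GammaSeq_tendsto_Gamma s) h0
  rw [div_self h0] at h
  refine h.congr fun N => ?_
  have hprod : Gamma (s + N + 1) = Gamma s * ∏ j ∈ Finset.range (N + 1), (s + j) := by
    induction N with
    | zero =>
      rw [zero_add, Finset.prod_range_one, Nat.cast_zero, add_zero, Gamma_add_one, mul_comm]
      rintro rfl; simp at hs
    | succ N ih =>
      rw [Finset.prod_range_succ, ← mul_assoc, ← ih, Gamma_add_one, mul_comm]
      · congr 2; push_cast; ring
      · intro h
        have := congrArg re h
        simp at this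
        have h2 : (0 : ℝ) ≤ N := Nat.cast_nonneg N
        linarith
  rw [hprod, Pi.div_apply, GammaSeq, div_div_eq_mul_div]

open Complex in
theorem tendsto_prod_Gamma_ratio {ι : Type*} [Fintype ι] {x y : ι → ℂ} (hx : ∀ i, 0 < (x i).re)
    (hy : ∀ i, 0 < (y i).re) (h : ∑ i, x i = ∑ i, y i) :
    Filter.Tendsto (fun N : ℕ => ∏ i, Gamma (x i + N + 1) / Gamma (y i + N + 1))
      Filter.atTop (nhds 1) := by
  have h1 : Filter.Tendsto (fun N : ℕ => ∏ i,
      (Gamma (x i + N + 1) / ((N : ℂ) ^ x i * (N.factorial : ℂ))) /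
        (Gamma (y i + N + 1) / ((N : ℂ) ^ y i * (N.factorial : ℂ))))
      Filter.atTop (nhds (∏ _i : ι, (1 / 1 : ℂ))) :=
    tendsto_finsetProd _ fun i _ =>
      (tendsto_Gamma_div_cpow (hx i)).div (tendsto_Gamma_div_cpow (hy i)) one_ne_zero
  simp only [div_one, Finset.prod_const_one] at h1
  refine h1.congr' ?_
  filter_upwards [Filter.eventually_gt_atTop 0] with N hN
  have hN' : (N : ℂ) ≠ 0 := Nat.cast_ne_zero.2 hN.ne'
  have hf : (N.factorial : ℂ) ≠ 0 := Nat.cast_ne_zero.2 N.factorial_ne_zero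
  have e : ∀ i, (Gamma (x i + N + 1) / ((N : ℂ) ^ x i * (N.factorial : ℂ))) /
        (Gamma (y i + N + 1) / ((N : ℂ) ^ y i * (N.factorial : ℂ))) =
      Gamma (x i + N + 1) / Gamma (y i + N + 1) * ((N : ℂ) ^ y i / (N : ℂ) ^ x i) := by
    intro i
    have h1 : (N : ℂ) ^ x i ≠ 0 := by simp [cpow_eq_zero_iff, hN']
    have h2 : (N : ℂ) ^ y i ≠ 0 := by simp [cpow_eq_zero_iff, hN']
    field_simp
  have e2 : ∀ z : ι → ℂ, ∏ i, (N : ℂ) ^ z i = (N : ℂ) ^ ∑ i, z i := fun z => by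
    simp only [cpow_def_of_ne_zero hN', ← exp_sum, Finset.mul_sum]
  have h3 : (N : ℂ) ^ ∑ i, y i ≠ 0 := by simp [cpow_eq_zero_iff, hN']
  rw [Finset.prod_congr rfl fun i _ => e i, Finset.prod_mul_distrib, Finset.prod_div_distrib (f := fun i => (N : ℂ) ^ y i), e2, e2, h,
    div_self h3, mul_one]

section

variable {n : ℕ} {a' : Fin n → ℂ} {b : Fin (n + 4) → ℂ}

theorem integrable_weight_mul_pairProd (ha' : ∀ i, 0 < (a' i).re) (hb : ∀ i, 0 < (b i).re) :
    MeasureTheory.Integrable (fun y : Fin (n + 1) → ℝ =>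
      (∏ j, weight a' b (∑ k, b k) (imagPoint y j)) *
        pairProd Finset.univ (fun i j => pairFactor (∑ k, b k) (imagPoint y i) (imagPoint y j))) := by
  have hB0 : 0 < (∑ k, b k).re := by
    rw [Complex.re_sum]
    exact Finset.sum_pos (fun i _ => hb i) Finset.univ_nonempty
  have hT := (TameOn.prod (U := Set.univ) Finset.univ fun j _ => TameOn.weight (s := fun _ => 0)
    (a := fun _ => a') (b := fun _ => b) (B := fun _ => ∑ k, b k)
    (V := fun z (y : Fin (n + 1) → ℝ) => imagPoint y j) (fun z y => imagPoint_eq y j)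
    (differentiableOn_const 0) (differentiableOn_const _) (fun _ => differentiableOn_const _)
    (fun _ => differentiableOn_const _) (fun z hz i => by simpa using ha' i)
    (fun z hz i => by simpa using hb i) (fun z hz i => by
      rw [sub_zero, Complex.add_re]; exact add_pos hB0 (ha' i))).mul
    (TameOn.pairProd Finset.univ fun i _ j _ _ => TameOn.pairFactor (s := fun _ => 0) (t := fun _ => 0)
      (B := fun _ => ∑ k, b k)
      (V := fun z y => imagPoint y i) (W := fun z y => imagPoint y j) (fun z y => imagPoint_eq y i)
      (fun z y => imagPoint_eq y j) (differentiableOn_const 0) (differentiableOn_const 0)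
      (differentiableOn_const _) (fun z hz => by simpa using hB0))
  exact hT.integrable Real.pi_pos (fun y => (hyper_exponent_le y).trans (neg_pi_mul_le y))
    (Set.mem_univ 0)

open Complex in
theorem norm_Gamma_ratio_le {x β : ℝ} (hx : 0 < x) (hβ : 0 < β) (t : ℝ) :
    ‖Gamma (x + t * I) / Gamma (β + x - t * I) * (Gamma (β + x) / Gamma x)‖ ≤ 1 := by
  have h := norm_Gamma_mul_Gamma_le (w := x + t * I) (by simpa using hx) hβ
  have e1 : ((x : ℂ) + t * I).re = x := by simp
  have e2 : (β : ℂ) + x - t * I = (starRingEnd ℂ) (x + t * I + β) := by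
    apply Complex.ext <;> simp; ring
  have e3 : Gamma ((β : ℂ) + x) = (Real.Gamma (x + β) : ℂ) := by
    rw [← ofReal_add, Gamma_ofReal, add_comm]
  have hp1 : 0 < Real.Gamma x := Real.Gamma_pos_of_pos hx
  have hp2 : 0 < Real.Gamma (x + β) := Real.Gamma_pos_of_pos (by linarith)
  have hp3 : 0 < ‖Gamma (x + t * I + β)‖ :=
    norm_pos_iff.2 (Gamma_ne_zero_of_re_pos (by simp; linarith))
  rw [e1] at h
  rw [e2, e3, Gamma_conj, Gamma_ofReal, norm_mul, norm_div, norm_div, norm_conj, norm_real, norm_real,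
    Real.norm_of_nonneg hp1.le, Real.norm_of_nonneg hp2.le, div_mul_div_comm,
    div_le_one (by positivity)]
  linarith

/-- The integral as a function of one parameter `a` alone, up to a constant factor. -/
theorem exists_integral_gammaKernel_eq {β : ℝ} (hβ : (β : ℂ) = ∑ i, b i) (hβ1 : 1 < β)
    (ha' : ∀ i, 0 < (a' i).re) (hb : ∀ i, 0 < (b i).re) :
    ∃ c : ℂ, ∀ a : ℝ, 0 < a →
      ∫ y : Fin (n + 1) → ℝ, gammaKernel (Fin.cons (a : ℂ) a' : Fin (n + 1) → ℂ) b (imagPoint y) =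
        c * ∏ i, Complex.Gamma (a + b i) / Complex.Gamma (β + a - b i) := by
  set J : ℝ → ℂ := fun a => ∫ y : Fin (n + 1) → ℝ,
    gammaKernel (Fin.cons (a : ℂ) a' : Fin (n + 1) → ℂ) b (imagPoint y) with hJ
  set R : ℝ → ℂ := fun a => ∏ i, Complex.Gamma (a + b i) / Complex.Gamma (β + a - b i) with hR
  have hbβ : ∀ i, (b i).re < β := by
    intro i
    have h1 : β = ∑ i, (b i).re := by
      rw [← Complex.re_sum, ← hβ, Complex.ofReal_re]
    rw [h1]
    refine Finset.single_lt_sum (i := i) (j := i + 1) (by simp) (Finset.mem_univ _)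
      (Finset.mem_univ _) (hb _) fun k _ _ => (hb k).le
  have hp1 : ∀ a : ℝ, 0 < a → ∀ i, 0 < ((a : ℂ) + b i).re := fun a ha i => by
    simpa using add_pos ha (hb i)
  have hp2 : ∀ a : ℝ, 0 < a → ∀ i, 0 < ((β : ℂ) + a - b i).re := fun a ha i => by
    have := hbβ i
    simp; linarith
  have hne : ∀ z : ℂ, 0 < z.re → z ≠ 0 := fun z hz h => by simp [h] at hz
  have hR0 : ∀ a, 0 < a → R a ≠ 0 := fun a ha => Finset.prod_ne_zero_iff.2 fun i _ =>
    div_ne_zero (Complex.Gamma_ne_zero_of_re_pos (hp1 a ha i))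
      (Complex.Gamma_ne_zero_of_re_pos (hp2 a ha i))
  have hstep : ∀ a : ℝ, 0 < a → J (a + 1) / R (a + 1) = J a / R a := by
    intro a ha
    have h1 := integral_gammaKernel_add_one (a := (a : ℂ)) hβ (by simpa using ha) ha' hb
      (by simpa using hβ1)
    have h2 : R (a + 1) * ∏ i, ((β : ℂ) + a - b i) = R a * ∏ i, ((a : ℂ) + b i) := by
      simp only [hR]
      rw [← Finset.prod_mul_distrib, ← Finset.prod_mul_distrib]
      refine Finset.prod_congr rfl fun i _ => ?_
      have e1 : ((a + 1 : ℝ) : ℂ) + b i = (a + b i) + 1 := by push_cast; ring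
      have e2 : (β : ℂ) + (a + 1 : ℝ) - b i = (β + a - b i) + 1 := by push_cast; ring
      rw [e1, e2, Complex.Gamma_add_one _ (hne _ (hp1 a ha i)),
        Complex.Gamma_add_one _ (hne _ (hp2 a ha i))]
      have := hne _ (hp2 a ha i)
      have := Complex.Gamma_ne_zero_of_re_pos (hp2 a ha i)
      field_simp
    have hP : ∏ i, ((β : ℂ) + a - b i) ≠ 0 :=
      Finset.prod_ne_zero_iff.2 fun i _ => hne _ (hp2 a ha i)
    have hJ1 : (∏ i, ((β : ℂ) + a - b i)) * J (a + 1) = (∏ i, ((a : ℂ) + b i)) * J a := by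
      simp only [hJ]
      rw [← h1]
      push_cast
      rfl
    rw [div_eq_div_iff (hR0 _ (by linarith)) (hR0 _ ha)]
    refine mul_right_cancel₀ hP ?_
    linear_combination R a * hJ1 - J a * h2
  have hstepN : ∀ a : ℝ, 0 < a → ∀ N : ℕ, J (a + N) / R (a + N) = J a / R a := by
    intro a ha N
    induction N with
    | zero => simp
    | succ N ih =>
      rw [← ih, ← hstep (a + N) (by positivity)]
      push_cast
      rw [add_assoc]
  set G : (Fin (n + 1) → ℝ) → ℂ := fun y => (∏ j, weight a' b (∑ k, b k) (imagPoint y j)) *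
        pairProd Finset.univ (fun i j => pairFactor (∑ k, b k) (imagPoint y i) (imagPoint y j)) with hG
  set S : ℝ → ℂ := fun x => (Complex.Gamma (β + x) / Complex.Gamma x) ^ (n + 2) with hS
  have hS0 : ∀ x : ℝ, 0 < x → S x ≠ 0 := fun x hx => pow_ne_zero _ (div_ne_zero
    (Complex.Gamma_ne_zero_of_re_pos (by simp; linarith))
    (Complex.Gamma_ne_zero_of_re_pos (by simpa using hx)))
  have hlimR : ∀ a : ℝ, 0 < a → Filter.Tendsto (fun N : ℕ => R (a + N + 1) * S (a + N + 1))
      Filter.atTop (nhds 1) := by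
    intro a ha
    have h := tendsto_prod_Gamma_ratio (ι := Fin (n + 4) ⊕ Fin (n + 2))
      (x := Sum.elim (fun i => (a : ℂ) + b i) (fun _ => (β : ℂ) + a))
      (y := Sum.elim (fun i => (β : ℂ) + a - b i) (fun _ => (a : ℂ)))
      (by rintro (i | j)
          · exact hp1 a ha i
          · simp; linarith)
      (by rintro (i | j)
          · exact hp2 a ha i
          · simpa using ha)
      (by simp only [Fintype.sum_sum_type, Sum.elim_inl, Sum.elim_inr, Finset.sum_add_distrib,
            Finset.sum_sub_distrib, ← hβ, Finset.sum_const, Finset.card_univ, Fintype.card_fin]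
          simp only [nsmul_eq_mul]; push_cast; ring)
    refine h.congr fun N => ?_
    simp only [Fintype.prod_sum_type, Sum.elim_inl, Sum.elim_inr, hR, hS, Finset.prod_const,
      Finset.card_univ, Fintype.card_fin]
    push_cast
    congr 1
    · refine Finset.prod_congr rfl fun i _ => ?_
      congr 2 <;> ring
    · congr 3; ring
  have hlimJ : ∀ a : ℝ, 0 < a → Filter.Tendsto (fun N : ℕ => J (a + N + 1) * S (a + N + 1))
      Filter.atTop (nhds (∫ y, G y)) := by
    intro a ha
    have hform : ∀ N : ℕ, J (a + N + 1) * S (a + N + 1) = ∫ y,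
        (∏ j, Complex.Gamma ((a + N + 1 : ℝ) + imagPoint y j) /
          Complex.Gamma (β + (a + N + 1 : ℝ) - imagPoint y j) *
          (Complex.Gamma (β + (a + N + 1 : ℝ)) / Complex.Gamma ((a + N + 1 : ℝ) : ℂ))) * G y := by
      intro N
      simp only [hJ]
      rw [← MeasureTheory.integral_mul_const]
      congr 1 with y
      rw [gammaKernel_cons, Finset.prod_mul_distrib, Finset.prod_const, Finset.card_univ,
        Fintype.card_fin, ← hβ]
      simp only [hG, hS, ← hβ]
      ring
    simp only [hform]
    have hGi : MeasureTheory.Integrable G := integrable_weight_mul_pairProd ha' hb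
    refine MeasureTheory.tendsto_integral_of_dominated_convergence (fun y => ‖G y‖) (fun N => ?_)
      hGi.norm (fun N => Filter.Eventually.of_forall fun y => ?_) (Filter.Eventually.of_forall fun y => ?_)
    · have hI := (integrable_gammaKernel (a := (Fin.cons ((a + N + 1 : ℝ) : ℂ) a' : Fin (n + 1) → ℂ)) (b := b)
        (fun i => Fin.cases (by rw [Fin.cons_zero, Complex.ofReal_re]; positivity)
        (fun i => by rw [Fin.cons_succ]; exact ha' i) i) hb).mul_const (S (a + N + 1))
      refine hI.aestronglyMeasurable.congr (Filter.Eventually.of_forall fun y => ?_)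
      simp only [gammaKernel_cons, Finset.prod_mul_distrib, Finset.prod_const, Finset.card_univ,
        Fintype.card_fin, hG, hS, ← hβ]
      ring
    · rw [norm_mul, norm_prod]
      refine mul_le_of_le_one_left (norm_nonneg _) ?_
      refine Finset.prod_le_one (fun _ _ => norm_nonneg _) fun j _ => ?_
      exact norm_Gamma_ratio_le (by positivity) (by linarith) _
    · have h := tendsto_prod_Gamma_ratio (ι := Fin (n + 2) ⊕ Fin (n + 2))
        (x := Sum.elim (fun j => (a : ℂ) + imagPoint y j) (fun _ => (β : ℂ) + a))
        (y := Sum.elim (fun j => (β : ℂ) + a - imagPoint y j) (fun _ => (a : ℂ)))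
        (by rintro (i | j)
            · simpa [imagPoint] using ha
            · simp; linarith)
        (by rintro (i | j)
            · simp [imagPoint]; linarith
            · simpa using ha)
        (by have : ∑ j, imagPoint y j = 0 := by
              simp only [imagPoint, ← Finset.sum_mul, ← Complex.ofReal_sum, sum_hyperCoord]; simp
            simp only [Fintype.sum_sum_type, Sum.elim_inl, Sum.elim_inr, Finset.sum_add_distrib,
              Finset.sum_sub_distrib, this, Finset.sum_const, Finset.card_univ, Fintype.card_fin]
            ring)
      have h' := h.mul_const (G y)
      rw [one_mul] at h'
      refine h'.congr fun N => ?_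
      congr 1
      simp only [Fintype.prod_sum_type, Sum.elim_inl, Sum.elim_inr]
      rw [← Finset.prod_mul_distrib]
      refine Finset.prod_congr rfl fun j _ => ?_
      push_cast
      congr 3 <;> ring
  refine ⟨∫ y, G y, fun a ha => ?_⟩
  have hlim := (hlimJ a ha).div (hlimR a ha) one_ne_zero
  rw [div_one] at hlim
  have hconst : Filter.Tendsto (fun N : ℕ => (J (a + N + 1) * S (a + N + 1)) / (R (a + N + 1) * S (a + N + 1)))
      Filter.atTop (nhds (J a / R a)) := by
    refine tendsto_const_nhds.congr fun N => ?_
    have hpos : 0 < a + N + 1 := by positivity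
    rw [mul_div_mul_right _ _ (hS0 _ hpos), ← hstepN a ha (N + 1)]
    push_cast
    rw [add_assoc]
  exact (div_eq_iff (hR0 a ha)).1 (tendsto_nhds_unique hconst hlim)

end

@[to_additive]
theorem pairProd_univ_succ {N : ℕ} {M : Type*} [CommMonoid M] (f : Fin (N + 1) → Fin (N + 1) → M) :
    pairProd Finset.univ f =
      (∏ j : Fin N, f 0 j.succ) * pairProd Finset.univ (fun i j : Fin N => f i.succ j.succ) := by
  rw [pairProd_univ, pairProd_univ, Fin.prod_univ_succ, Fin.prod_Ioi_zero]
  simp only [Fin.prod_Ioi_succ]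

theorem pairProd_comp_swap {N : ℕ} {f : Fin N → Fin N → ℂ} (hf : ∀ i j, f i j = f j i) (k l : Fin N) :
    pairProd Finset.univ (fun i j => f (Equiv.swap k l i) (Equiv.swap k l j)) =
      pairProd Finset.univ f := by
  rcases eq_or_ne k l with rfl | h
  · simp
  rw [pairProd_eq_mul_others h hf, pairProd_eq_mul_others h (fun i j => hf _ _),
    Equiv.swap_apply_left, Equiv.swap_apply_right, hf l k]
  have hs : ∀ m ∈ others k l, Equiv.swap k l m = m := fun m hm =>
    Equiv.swap_apply_of_ne_of_ne (mem_others.1 hm).2 (mem_others.1 hm).1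
  congr 1
  · congr 1
    refine Finset.prod_congr rfl fun m hm => ?_
    rw [hs m hm, mul_comm]
  · exact pairProd_congr fun i hi j hj _ => by rw [hs i hi, hs j hj]

theorem gammaKernel_comp_swap {n : ℕ} (a : Fin n → ℂ) (b : Fin (n + 3) → ℂ) (v : Fin (n + 1) → ℂ)
    (k l : Fin (n + 1)) : gammaKernel a b (v ∘ Equiv.swap k l) = gammaKernel a b v := by
  rw [gammaKernel_eq, gammaKernel_eq]
  congr 1
  · exact Equiv.prod_comp (Equiv.swap k l) (fun j => weight a b (∑ k, b k) (v j))
  · exact pairProd_comp_swap (fun i j => pairFactor_comm _ (v i) (v j)) k l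

theorem integrable_comp_swap {n : ℕ} (k l : Fin (n + 1)) {f : (Fin (n + 1) → ℂ) → ℂ}
    (hf : MeasureTheory.Integrable (fun y : Fin n → ℝ => f (imagPoint y))) :
    MeasureTheory.Integrable (fun y : Fin n → ℝ => f (imagPoint y ∘ Equiv.swap k l)) := by
  have h := (measurePreserving_hyperSwap k l).integrable_comp_of_integrable hf
  refine h.congr (Filter.Eventually.of_forall fun y => ?_)
  simp only [Function.comp_def]
  congr 1 with j
  simp [imagPoint, hyperCoord_hyperSwap]

/-- The value at `-a` of the Lagrange basis polynomial of the node `v k`. -/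
noncomputable def lagrangeAt {N : ℕ} (a : ℂ) (k : Fin N) (v : Fin N → ℂ) : ℂ :=
  ∏ i ∈ Finset.univ.erase k, (a + v i) / (v i - v k)

theorem sum_lagrangeAt {N : ℕ} (a : ℂ) {v : Fin (N + 1) → ℂ} (hv : Function.Injective v) :
    ∑ k, lagrangeAt a k v = 1 := by
  have h := congrArg (Polynomial.eval (-a))
    (Lagrange.sum_basis (s := Finset.univ) (hv.injOn) Finset.univ_nonempty)
  rw [Polynomial.eval_finsetSum, Polynomial.eval_one] at h
  rw [← h]
  refine Finset.sum_congr rfl fun k _ => ?_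
  rw [Lagrange.basis, Polynomial.eval_prod, lagrangeAt]
  refine Finset.prod_congr rfl fun i hi => ?_
  have hne : v i - v k ≠ 0 := sub_ne_zero.2 (hv.ne (Finset.ne_of_mem_erase hi))
  have hne' : v k - v i ≠ 0 := sub_ne_zero.2 (hv.ne (Finset.ne_of_mem_erase hi).symm)
  rw [Lagrange.basisDivisor, Polynomial.eval_mul, Polynomial.eval_C, Polynomial.eval_sub,
    Polynomial.eval_X, Polynomial.eval_C, inv_mul_eq_div, div_eq_div_iff hne hne']
  ring

theorem lagrangeAt_comp_swap {N : ℕ} (a : ℂ) (k l : Fin N) (v : Fin N → ℂ) :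
    lagrangeAt a k (v ∘ Equiv.swap k l) = lagrangeAt a l v := by
  unfold lagrangeAt
  rw [prod_univ_erase, prod_univ_erase, ← Equiv.prod_comp (Equiv.swap k l)]
  refine Finset.prod_congr rfl fun i _ => ?_
  have : Equiv.swap k l i = k ↔ i = l := by rw [Equiv.swap_apply_eq_iff, Equiv.swap_apply_left]
  simp only [Function.comp, this, Equiv.swap_apply_left, Equiv.swap_apply_self]

/-- The kernel times `lagrangeAt a 0`, without the two factors `Γ(a + v 0)` and `Γ(b₀ - v 0)`. -/
noncomputable def pinchedKernel {n : ℕ} (a : ℂ) (a' : Fin n → ℂ) (b₀ : ℂ) (b' : Fin (n + 3) → ℂ)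
    (B : ℂ) (v : Fin (n + 2) → ℂ) : ℂ :=
  (Complex.Gamma (B + a - v 0))⁻¹ * weight a' b' B (v 0) *
    (∏ j : Fin (n + 1), Complex.Gamma (a + 1 + v j.succ) / Complex.Gamma (B + a - v j.succ) *
      Complex.Gamma (b₀ - v j.succ) * weight a' b' B (v j.succ) *
      ((Real.pi : ℂ)⁻¹ * (Complex.Gamma (B - v 0 - v j.succ) *
        Complex.sin (Real.pi * (v 0 - v j.succ))))) *
    pairProd Finset.univ (fun i j : Fin (n + 1) => pairFactor B (v i.succ) (v j.succ))

theorem weight_cons_right {m p : ℕ} (a : Fin m → ℂ) (b₀ : ℂ) (b : Fin p → ℂ) (B z : ℂ) :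
    weight a (Fin.cons b₀ b : Fin (p + 1) → ℂ) B z = Complex.Gamma (b₀ - z) * weight a b B z := by
  unfold weight
  rw [Fin.prod_univ_succ]
  simp only [Fin.cons_zero, Fin.cons_succ]
  ring

theorem gammaKernel_mul_lagrangeAt {n : ℕ} {a b₀ B : ℂ} {a' : Fin n → ℂ} {b' : Fin (n + 3) → ℂ}
    (hB : B = b₀ + ∑ i, b' i) {v : Fin (n + 2) → ℂ} (hv : Function.Injective v)
    (ha : ∀ j, a + v j ≠ 0) :
    gammaKernel (Fin.cons a a' : Fin (n + 1) → ℂ) (Fin.cons b₀ b' : Fin (n + 4) → ℂ) v *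
        lagrangeAt a 0 v =
      Complex.Gamma (a + v 0) * Complex.Gamma (b₀ - v 0) * pinchedKernel a a' b₀ b' B v := by
  have hB' : ∑ k, (Fin.cons b₀ b' : Fin (n + 4) → ℂ) k = B := by
    rw [Fin.sum_univ_succ, hB]; simp
  have hL : lagrangeAt a 0 v = ∏ j : Fin (n + 1), (a + v j.succ) / (v j.succ - v 0) := by
    rw [lagrangeAt, prod_univ_erase, Fin.prod_univ_succ]
    simp [Fin.succ_ne_zero]
  rw [gammaKernel_eq, hB', hL, Fin.prod_univ_succ, pairProd_univ_succ, weight_cons_right, weight_cons,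
    pinchedKernel]
  have hj : ∀ j : Fin (n + 1), weight (Fin.cons a a' : Fin (n + 1) → ℂ)
      (Fin.cons b₀ b' : Fin (n + 4) → ℂ) B (v j.succ) * pairFactor B (v 0) (v j.succ) *
        ((a + v j.succ) / (v j.succ - v 0)) =
      Complex.Gamma (a + 1 + v j.succ) / Complex.Gamma (B + a - v j.succ) *
      Complex.Gamma (b₀ - v j.succ) * weight a' b' B (v j.succ) *
      ((Real.pi : ℂ)⁻¹ * (Complex.Gamma (B - v 0 - v j.succ) *
        Complex.sin (Real.pi * (v 0 - v j.succ)))) := by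
    intro j
    have hne : v j.succ - v 0 ≠ 0 := sub_ne_zero.2 (hv.ne (Fin.succ_ne_zero j))
    have e : a + 1 + v j.succ = (a + v j.succ) + 1 := by ring
    rw [weight_cons_right, weight_cons, pairFactor_eq, e, Complex.Gamma_add_one _ (ha _), neg_sub]
    field_simp
  rw [← Finset.prod_congr rfl fun j _ => hj j, Finset.prod_mul_distrib, Finset.prod_mul_distrib]
  ring

/-- The direction in which the first variable moves against all the others. -/
noncomputable def headDir (n : ℕ) : Fin (n + 2) → ℝ := Fin.cons 1 (fun _ => -(1 / (n + 1 : ℝ)))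

theorem sum_headDir (n : ℕ) : ∑ j, headDir n j = 0 := by
  rw [headDir, Fin.sum_univ_succ]
  have : (n + 1 : ℝ) ≠ 0 := by positivity
  simp
  field_simp
  ring

theorem abs_hyperCoord_zero_le {n : ℕ} (y : Fin (n + 1) → ℝ) :
    2 * |hyperCoord 0 y| ≤ ∑ j, |hyperCoord j y| := by
  have h1 := sum_hyperCoord y
  rw [Fin.sum_univ_succ] at h1 ⊢
  have h2 : hyperCoord 0 y = -∑ j : Fin (n + 1), hyperCoord j.succ y := by linarith
  have h3 : |hyperCoord 0 y| ≤ ∑ j : Fin (n + 1), |hyperCoord j.succ y| := by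
    rw [h2, abs_neg]; exact Finset.abs_sum_le_sum_abs _ _
  linarith

section

variable {n : ℕ} {b₀ B : ℂ} {a' : Fin n → ℂ} {b' : Fin (n + 3) → ℂ} {τ : ℝ} {U : Set ℂ} {α s : ℂ → ℂ}

theorem tameOn_pinchedKernel (hτ : τ < 1 / 2) (hbτ : b₀.re < τ) (hb₀ : 0 < b₀.re)
    (ha' : ∀ i, τ < (a' i).re) (hb' : ∀ i, τ < (b' i).re) (hB : 1 < B.re)
    (hα : DifferentiableOn ℂ α U) (hs : DifferentiableOn ℂ s U) (hα1 : ∀ z ∈ U, -τ < (α z).re)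
    (hs1 : ∀ z ∈ U, -b₀.re < (s z).re) (hs2 : ∀ z ∈ U, (s z).re < τ) :
    TameOn U (fun y => -Real.pi * ∑ j, |hyperCoord j y| + Real.pi * |hyperCoord 0 y|)
      (fun z y => pinchedKernel (α z) a' b₀ b' B (fun j => imagPoint y j + s z * headDir n j)) := by
  have h0 : ∀ z (y : Fin (n + 1) → ℝ), imagPoint y 0 + s z * headDir n 0 =
      s z + hyperCoord 0 y * Complex.I := fun z y => by
    rw [headDir, Fin.cons_zero, imagPoint]; push_cast; ring
  obtain ⟨q, hq⟩ : ∃ q : ℂ → ℂ, ∀ z, q z = -(s z * ((1 / (n + 1 : ℝ) : ℝ) : ℂ)) :=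
    ⟨_, fun _ => rfl⟩
  have hj : ∀ j : Fin (n + 1), ∀ z (y : Fin (n + 1) → ℝ),
      imagPoint y j.succ + s z * headDir n j.succ =
      q z + hyperCoord j.succ y * Complex.I := fun j z y => by
    rw [hq, headDir, Fin.cons_succ, imagPoint]; push_cast; ring
  have hd : DifferentiableOn ℂ q U := (hs.mul_const _).neg.congr fun z _ => hq z
  have hq0 : (0 : ℝ) < 1 / (n + 1 : ℝ) := by positivity
  have hq1 : 1 / (n + 1 : ℝ) ≤ 1 := by
    rw [div_le_one (by positivity)]
    have : (0 : ℝ) ≤ n := Nat.cast_nonneg n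
    linarith
  have hqre : ∀ z, (q z).re = -((s z).re * (1 / (n + 1 : ℝ))) := fun z => by
    rw [hq, Complex.neg_re, Complex.re_mul_ofReal]
  have hqτ : ∀ z ∈ U, -τ < (q z).re := fun z hz => by
    rw [hqre]; nlinarith [hs1 z hz, hs2 z hz]
  have hqb : ∀ z ∈ U, (q z).re < b₀.re := fun z hz => by
    rw [hqre]; nlinarith [hs1 z hz, hs2 z hz]
  have T0 := (TameOn.inv_gamma_of (V := fun z (y : Fin (n + 1) → ℝ) => B + α z - (imagPoint y 0 + s z * headDir n 0))
    (fun z => B + α z - s z) (-hyperCoord 0) (by fun_prop)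
    (fun z hz => by simp only [Complex.add_re, Complex.sub_re]; linarith [hα1 z hz, hs2 z hz])
    (fun z y => by rw [h0, LinearMap.neg_apply]; push_cast; ring)).mul
    (TameOn.weight (a := fun _ => a') (b := fun _ => b') (B := fun _ => B) h0 hs
      (differentiableOn_const _) (fun _ => differentiableOn_const _) (fun _ => differentiableOn_const _)
      (fun z hz i => by simp only [Complex.add_re]; linarith [ha' i, hs1 z hz])
      (fun z hz i => by simp only [Complex.sub_re]; linarith [hb' i, hs2 z hz])
      (fun z hz i => by simp only [Complex.add_re, Complex.sub_re]; linarith [ha' i, hs2 z hz]))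
  have T1 := TameOn.prod Finset.univ fun (j : Fin (n + 1)) _ =>
    (((TameOn.gamma_ratio (α := fun z => α z + 1) (β := fun z => B + α z) (hj j) hd (by fun_prop)
      (by fun_prop)
      (fun z hz => by simp only [Complex.add_re, Complex.one_re]; linarith [hα1 z hz, hqτ z hz])
      (fun z hz => by simp only [Complex.add_re, Complex.sub_re]; linarith [hα1 z hz, hqb z hz])).mul
    (TameOn.gamma_of (V := fun z (y : Fin (n + 1) → ℝ) => b₀ - (imagPoint y j.succ + s z * headDir n j.succ))
      (fun z => b₀ - q z) (-hyperCoord j.succ) (by fun_prop)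
      (fun z hz => by simp only [Complex.sub_re]; linarith [hqb z hz])
      (fun z y => by rw [hj, LinearMap.neg_apply]; push_cast; ring))).mul
    (TameOn.weight (a := fun _ => a') (b := fun _ => b') (B := fun _ => B) (hj j) hd
      (differentiableOn_const _) (fun _ => differentiableOn_const _) (fun _ => differentiableOn_const _)
      (fun z hz i => by simp only [Complex.add_re]; linarith [ha' i, hqτ z hz])
      (fun z hz i => by simp only [Complex.sub_re]; linarith [hb' i, hqb z hz])
      (fun z hz i => by simp only [Complex.add_re, Complex.sub_re]; linarith [ha' i, hqb z hz]))).mul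
    ((TameOn.const (Real.pi : ℂ)⁻¹).mul
    ((TameOn.gamma_of (V := fun z (y : Fin (n + 1) → ℝ) => B - (imagPoint y 0 + s z * headDir n 0) -
        (imagPoint y j.succ + s z * headDir n j.succ))
      (fun z => B - s z - q z) (-(hyperCoord 0 + hyperCoord j.succ)) (by fun_prop)
      (fun z hz => by simp only [Complex.sub_re]; linarith [hqb z hz, hs2 z hz])
      (fun z y => by rw [h0, hj, LinearMap.neg_apply, LinearMap.add_apply]; push_cast; ring)).mul
    (TameOn.sin_pi_of (V := fun z (y : Fin (n + 1) → ℝ) => (imagPoint y 0 + s z * headDir n 0) -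
        (imagPoint y j.succ + s z * headDir n j.succ))
      (fun z => s z - q z) (hyperCoord 0 - hyperCoord j.succ) (by fun_prop)
      (fun z y => by rw [h0, hj, LinearMap.sub_apply]; push_cast; ring))))
  have T2 := TameOn.pairProd Finset.univ fun (i : Fin (n + 1)) _ (j : Fin (n + 1)) _ _ =>
    TameOn.pairFactor (B := fun _ => B) (hj i) (hj j) hd hd (differentiableOn_const _)
    (fun z hz => by simp only [Complex.sub_re]; linarith [hqb z hz])
  refine ((T0.mul T1).mul T2).congr (fun y => ?_) (fun z _ y => rfl)
  have hE := hyper_exponent_le y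
  rw [Fin.sum_univ_succ, pairSum_univ_succ] at hE
  simp only [LinearMap.neg_apply, LinearMap.add_apply, LinearMap.sub_apply, abs_neg]
  simp only [Finset.sum_add_distrib, Finset.sum_sub_distrib, ← Finset.mul_sum] at hE ⊢
  push_cast at hE ⊢
  have : ∑ i : Fin (n + 1), (0 : ℝ) = 0 := Finset.sum_const_zero
  linarith

theorem pinched_exponent_le (y : Fin (n + 1) → ℝ) :
    -Real.pi * ∑ j, |hyperCoord j y| + Real.pi * |hyperCoord 0 y| ≤ -(Real.pi / 2) * ‖y‖ := by
  have h1 := abs_hyperCoord_zero_le y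
  have h2 := norm_le_sum_hyperCoord y
  nlinarith [Real.pi_pos]

theorem tameOn_gamma_mul_pinchedKernel (hτ : τ < 1 / 2) (hbτ : b₀.re < τ) (hb₀ : 0 < b₀.re)
    (ha' : ∀ i, τ < (a' i).re) (hb' : ∀ i, τ < (b' i).re) (hB : 1 < B.re)
    (hα : DifferentiableOn ℂ α U) (hs : DifferentiableOn ℂ s U)
    (hs1 : ∀ z ∈ U, -b₀.re < (s z).re) (hs2 : ∀ z ∈ U, (s z).re < b₀.re)
    (hαs : ∀ z ∈ U, 0 < (α z + s z).re) :
    TameOn U (fun y => -Real.pi * ‖y‖)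
      (fun z y => Complex.Gamma (α z + (imagPoint y 0 + s z * headDir n 0)) *
        Complex.Gamma (b₀ - (imagPoint y 0 + s z * headDir n 0)) *
        pinchedKernel (α z) a' b₀ b' B (fun j => imagPoint y j + s z * headDir n j)) := by
  have h0 : ∀ z (y : Fin (n + 1) → ℝ), imagPoint y 0 + s z * headDir n 0 =
      s z + hyperCoord 0 y * Complex.I := fun z y => by
    rw [headDir, Fin.cons_zero, imagPoint]; push_cast; ring
  refine (((TameOn.gamma_of (V := fun z (y : Fin (n + 1) → ℝ) => α z + (imagPoint y 0 + s z * headDir n 0))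
    (fun z => α z + s z) (hyperCoord 0) (by fun_prop) hαs
    (fun z y => by rw [h0]; ring)).mul
    (TameOn.gamma_of (V := fun z (y : Fin (n + 1) → ℝ) => b₀ - (imagPoint y 0 + s z * headDir n 0))
    (fun z => b₀ - s z) (-hyperCoord 0) (by fun_prop)
    (fun z hz => by rw [Complex.sub_re]; linarith [hs2 z hz])
    (fun z y => by rw [h0, LinearMap.neg_apply]; push_cast; ring))).mul
    (tameOn_pinchedKernel hτ hbτ hb₀ ha' hb' hB hα hs (fun z hz => ?_) hs1
      (fun z hz => (hs2 z hz).trans hbτ))).congr (fun y => ?_) (fun z _ y => rfl)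
  · have := hαs z hz
    rw [Complex.add_re] at this
    linarith [hs2 z hz]
  · rw [LinearMap.neg_apply, abs_neg]
    have h2 := neg_pi_mul_le y
    linarith

end

open Filter Topology in
theorem eqOn_of_eventually_ofReal {U : Set ℂ} (hU : IsOpen U) (hU' : IsPreconnected U) {f g : ℂ → ℂ}
    (hf : DifferentiableOn ℂ f U) (hg : DifferentiableOn ℂ g U) {x₀ : ℝ} (hx₀ : (x₀ : ℂ) ∈ U)
    (h : ∀ᶠ x : ℝ in 𝓝 x₀, f x = g x) : Set.EqOn f g U := by
  refine (hf.analyticOnNhd hU).eqOn_of_preconnected_of_frequently_eq (hg.analyticOnNhd hU) hU' hx₀ ?_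
  have h1 : Tendsto (fun x : ℝ => (x : ℂ)) (𝓝[≠] x₀) (𝓝[≠] (x₀ : ℂ)) :=
    tendsto_nhdsWithin_iff.2 ⟨(Complex.continuous_ofReal.tendsto x₀).mono_left nhdsWithin_le_nhds,
      eventually_nhdsWithin_of_forall fun x hx => by simpa using hx⟩
  exact h1.frequently (h.filter_mono nhdsWithin_le_nhds).frequently

theorem integral_mul_tail {n : ℕ} (f : ℝ → ℂ) (g : (Fin n → ℝ) → ℂ) :
    ∫ y : Fin (n + 1) → ℝ, f (y 0) * g (Fin.tail y) = (∫ t, f t) * ∫ x, g x := by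
  rw [← MeasureTheory.integral_prod_mul f g, ← MeasureTheory.Measure.volume_eq_prod,
    ← (MeasureTheory.volume_preserving_piFinSuccAbove (fun _ : Fin (n + 1) => ℝ) 0).integral_comp
      (MeasurableEquiv.measurableEmbedding _)]
  rfl

theorem integrable_mul_tail {n : ℕ} {f : ℝ → ℝ} {g : (Fin n → ℝ) → ℝ}
    (hf : MeasureTheory.Integrable f) (hg : MeasureTheory.Integrable g) :
    MeasureTheory.Integrable (fun y : Fin (n + 1) → ℝ => f (y 0) * g (Fin.tail y)) := by
  have h := hf.mul_prod hg
  rw [← MeasureTheory.Measure.volume_eq_prod] at h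
  exact (MeasureTheory.volume_preserving_piFinSuccAbove
    (fun _ : Fin (n + 1) => ℝ) 0).integrable_comp_of_integrable h

theorem integral_comp_scale_zero {n : ℕ} (f : (Fin (n + 1) → ℝ) → ℂ) {ε : ℝ} (hε : 0 < ε) :
    ε * ∫ y : Fin (n + 1) → ℝ, f (Fin.cons (ε * y 0) (Fin.tail y)) = ∫ y, f y := by
  set D : Fin (n + 1) → ℝ := Fin.cons ε 1 with hD
  have hdet : (Matrix.diagonal D).det = ε := by
    rw [Matrix.det_diagonal, Fin.prod_univ_succ]; simp [hD]
  have h := Real.smul_map_diagonal_volume_pi (D := D) (by rw [hdet]; exact hε.ne')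
  rw [hdet, abs_of_pos hε] at h
  have hL : ∀ y, Matrix.toLin' (Matrix.diagonal D) y = Fin.cons (ε * y 0) (Fin.tail y) := fun y => by
    ext j
    rw [Matrix.toLin'_apply, Matrix.mulVec_diagonal]
    refine Fin.cases ?_ (fun i => ?_) j <;> simp [hD, Fin.tail]
  have hemb : MeasurableEmbedding (Matrix.toLin' (Matrix.diagonal D)) := by
    refine Continuous.measurableEmbedding (LinearMap.continuous_of_finiteDimensional _) fun x y hxy => ?_
    rw [hL, hL] at hxy
    have h0 := congrFun hxy 0
    have h1 := congrArg (Fin.tail (α := fun _ => ℝ)) hxy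
    simp only [Fin.cons_zero, Fin.tail_cons] at h0 h1
    rw [← Fin.cons_self_tail x, ← Fin.cons_self_tail y, h1, mul_left_cancel₀ hε.ne' h0]
  conv_rhs => rw [← h]
  rw [MeasureTheory.integral_smul_measure, hemb.integral_map, ENNReal.toReal_ofReal hε.le,
    Complex.real_smul]
  simp only [hL]

section

variable {n : ℕ} {b₀ : ℝ} {B : ℂ} {a' : Fin n → ℂ} {b' : Fin (n + 3) → ℂ} {τ : ℝ}

/-- The kernel times `lagrangeAt a 0`, freed of its removable singularities. -/
noncomputable def pinchedIntegrand {n : ℕ} (a : ℂ) (a' : Fin n → ℂ) (b₀ : ℂ) (b' : Fin (n + 3) → ℂ)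
    (B : ℂ) (v : Fin (n + 2) → ℂ) : ℂ :=
  Complex.Gamma (a + v 0) * Complex.Gamma (b₀ - v 0) * pinchedKernel a a' b₀ b' B v

theorem integral_gammaKernel_eq_pinched (hτ : τ < 1 / 2) (hbτ : b₀ < τ) (hb₀ : 0 < b₀)
    (ha' : ∀ i, τ < (a' i).re) (hb' : ∀ i, τ < (b' i).re) (hB : B = b₀ + ∑ i, b' i) (hB1 : 1 < B.re)
    {a : ℂ} (ha : 0 < a.re) :
    ∫ y : Fin (n + 1) → ℝ, gammaKernel (Fin.cons a a' : Fin (n + 1) → ℂ)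
        (Fin.cons (b₀ : ℂ) b' : Fin (n + 4) → ℂ) (imagPoint y) =
      (n + 2) * ∫ y : Fin (n + 1) → ℝ, pinchedIntegrand a a' b₀ b' B (imagPoint y) := by
  have hint : MeasureTheory.Integrable
      (fun y : Fin (n + 1) → ℝ => pinchedIntegrand a a' b₀ b' B (imagPoint y)) := by
    have h := (tameOn_gamma_mul_pinchedKernel (U := {0}) (α := fun _ => a) (s := fun _ => 0) hτ
      (b₀ := b₀) hbτ hb₀ ha' hb' hB1 (differentiableOn_const _) (differentiableOn_const _)
      (fun _ _ => by simpa using hb₀) (fun _ _ => by simpa using hb₀)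
      (fun _ _ => by simpa using ha)).integrable Real.pi_pos (fun _ => le_rfl) (Set.mem_singleton _)
    simpa only [zero_mul, add_zero, pinchedIntegrand] using h
  have hae : ∀ᵐ y : Fin (n + 1) → ℝ, gammaKernel (Fin.cons a a' : Fin (n + 1) → ℂ)
        (Fin.cons (b₀ : ℂ) b' : Fin (n + 4) → ℂ) (imagPoint y) =
      ∑ k, pinchedIntegrand a a' b₀ b' B (imagPoint y ∘ Equiv.swap 0 k) := by
    filter_upwards [ae_injective_imagPoint (n + 1)] with y hy
    conv_lhs => rw [← mul_one (gammaKernel _ _ _), ← sum_lagrangeAt a hy, Finset.mul_sum]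
    refine Finset.sum_congr rfl fun k _ => ?_
    rw [pinchedIntegrand, ← gammaKernel_mul_lagrangeAt hB (hy.comp (Equiv.swap 0 k).injective)
      (fun j => add_imagPoint_ne_zero ha y _), gammaKernel_comp_swap, lagrangeAt_comp_swap]
  rw [MeasureTheory.integral_congr_ae hae, MeasureTheory.integral_finsetSum _
    fun k _ => integrable_comp_swap 0 k hint]
  simp only [integral_comp_swap, Finset.sum_const, Finset.card_univ, Fintype.card_fin, nsmul_eq_mul]
  push_cast
  ring

theorem integral_pinchedIntegrand_shift (hτ : τ < 1 / 2) (hbτ : b₀ < τ) (hb₀ : 0 < b₀)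
    (ha' : ∀ i, τ < (a' i).re) (hb' : ∀ i, τ < (b' i).re) (hB1 : 1 < B.re)
    {a : ℂ} (ha : 0 < a.re) {σ : ℝ} (hσ : 0 < σ) (hσ' : σ < b₀) :
    ∫ y : Fin (n + 1) → ℝ, pinchedIntegrand a a' b₀ b' B (imagPoint y) =
      ∫ y : Fin (n + 1) → ℝ, pinchedIntegrand a a' b₀ b' B
        (fun j => imagPoint y j + σ * headDir n j) := by
  have hm : 0 < min a.re b₀ := lt_min ha hb₀
  have T := tameOn_gamma_mul_pinchedKernel (U := {z : ℂ | -min a.re b₀ < z.re ∧ z.re < b₀})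
    (α := fun _ => a) (s := fun z => z) hτ (b₀ := b₀) hbτ hb₀ ha' hb' hB1
    (differentiableOn_const _) differentiableOn_id
    (fun z hz => by rw [Complex.ofReal_re]; linarith [hz.1, min_le_right a.re b₀]) (fun z hz => hz.2)
    (fun z hz => by rw [Complex.add_re]; linarith [hz.1, min_le_left a.re b₀])
  have h := integral_shift_eq (f := pinchedIntegrand a a' b₀ b' B) (sum_headDir n) T
    (isOpen_strip _ _) (isPreconnected_strip _ _) Real.pi_pos (fun _ => le_rfl) (z := 0) (w := σ)
    ⟨by simpa using ⟨ha, hb₀⟩, by simpa using hb₀⟩ ⟨by rw [Complex.ofReal_re]; linarith, hσ'⟩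
  simpa only [zero_mul, add_zero] using h

theorem differentiableOn_prod_gamma_div {N : ℕ} {U : Set ℂ} (b : Fin N → ℂ) (B : ℂ)
    (h : ∀ z ∈ U, ∀ i, 0 < (z + b i).re) :
    DifferentiableOn ℂ (fun z => ∏ i, Complex.Gamma (z + b i) / Complex.Gamma (B + z - b i)) U := by
  refine DifferentiableOn.fun_finsetProd fun i _ => ?_
  simp only [div_eq_mul_inv]
  refine DifferentiableOn.mul (fun z hz => ?_)
    ((Complex.differentiable_one_div_Gamma.comp (by fun_prop)).differentiableOn)
  refine ((Complex.differentiableAt_Gamma _ fun m hm => ?_).comp z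
    (by fun_prop : DifferentiableAt ℂ (fun z => z + b i) z)).differentiableWithinAt
  have := h z hz i
  rw [hm, Complex.neg_re, Complex.natCast_re] at this
  linarith [Nat.cast_nonneg (α := ℝ) m]

theorem integral_pinchedIntegrand_continued (hτ : τ < 1 / 2) (hbτ : b₀ < τ) (hb₀ : 0 < b₀)
    (ha' : ∀ i, τ < (a' i).re) (hb' : ∀ i, τ < (b' i).re) (hB : B = b₀ + ∑ i, b' i) (hB1 : 1 < B.re)
    {c : ℂ} (hc : ∀ a : ℝ, 0 < a →
      ∫ y : Fin (n + 1) → ℝ, gammaKernel (Fin.cons (a : ℂ) a' : Fin (n + 1) → ℂ)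
        (Fin.cons (b₀ : ℂ) b' : Fin (n + 4) → ℂ) (imagPoint y) =
        c * ∏ i, Complex.Gamma (a + (Fin.cons (b₀ : ℂ) b' : Fin (n + 4) → ℂ) i) /
          Complex.Gamma (B + a - (Fin.cons (b₀ : ℂ) b' : Fin (n + 4) → ℂ) i))
    {a : ℂ} {σ : ℝ} (hσ : 0 < σ) (hσ' : σ < b₀) (ha : -σ < a.re) :
    (n + 2) * ∫ y : Fin (n + 1) → ℝ, pinchedIntegrand a a' b₀ b' B
        (fun j => imagPoint y j + σ * headDir n j) =
      c * ∏ i, Complex.Gamma (a + (Fin.cons (b₀ : ℂ) b' : Fin (n + 4) → ℂ) i) /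
          Complex.Gamma (B + a - (Fin.cons (b₀ : ℂ) b' : Fin (n + 4) → ℂ) i) := by
  have hU : IsOpen {z : ℂ | -σ < z.re} := isOpen_lt continuous_const Complex.continuous_re
  have T := tameOn_gamma_mul_pinchedKernel (U := {z : ℂ | -σ < z.re})
    (α := fun z => z) (s := fun _ => σ) hτ (b₀ := b₀) hbτ hb₀ ha' hb' hB1
    differentiableOn_id (differentiableOn_const _)
    (fun z hz => by rw [Complex.ofReal_re, Complex.ofReal_re]; linarith) (fun z hz => hσ')
    (fun z hz => by rw [Complex.add_re, Complex.ofReal_re]; linarith [Set.mem_ofPred.1 hz])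
  refine eqOn_of_eventually_ofReal (x₀ := 1) hU (convex_halfSpace_re_gt _).isPreconnected
    ((T.differentiableOn_integral hU Real.pi_pos fun _ => le_rfl).const_mul _)
    ((differentiableOn_prod_gamma_div _ _ fun z hz i => ?_).const_mul _) ?_ ?_ ha
  · have hz' := Set.mem_ofPred.1 hz
    rw [Complex.add_re]
    refine Fin.cases ?_ (fun i => ?_) i
    · simp only [Fin.cons_zero, Complex.ofReal_re]; linarith
    · simp only [Fin.cons_succ]; linarith [hb' i]
  · simp only [Set.mem_ofPred, Complex.ofReal_re]; linarith
  · filter_upwards [lt_mem_nhds (zero_lt_one' ℝ)] with x hx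
    have hx' : 0 < (x : ℂ).re := hx
    rw [← hc x hx, integral_gammaKernel_eq_pinched hτ hbτ hb₀ ha' hb' hB hB1 hx',
      integral_pinchedIntegrand_shift hτ hbτ hb₀ ha' hb' hB1 hx' hσ hσ']
    rfl

end

theorem hyperCoord_zero {n : ℕ} (y : Fin (n + 1) → ℝ) : hyperCoord 0 y = y 0 :=
  hyperCoord_castSucc 0 y

theorem hyperCoord_succ_cons_zero {n : ℕ} (x : Fin n → ℝ) (j : Fin (n + 1)) :
    hyperCoord j.succ (Fin.cons 0 x : Fin (n + 1) → ℝ) = hyperCoord j x := by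
  refine Fin.lastCases ?_ (fun i => ?_) j
  · rw [Fin.succ_last, hyperCoord_last, hyperCoord_last, Fin.sum_univ_succ]
    simp
  · rw [Fin.succ_castSucc, hyperCoord_castSucc, hyperCoord_castSucc, Fin.cons_succ]

theorem Complex.norm_Gamma_le_Gamma_re {z : ℂ} (hz : 0 < z.re) :
    ‖Complex.Gamma z‖ ≤ Real.Gamma z.re := by
  rw [Complex.Gamma_eq_integral hz, Real.Gamma_eq_integral hz, Complex.GammaIntegral]
  refine (MeasureTheory.norm_integral_le_integral_norm _).trans_eq
    (MeasureTheory.setIntegral_congr_fun measurableSet_Ioi fun x hx => ?_)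
  rw [norm_mul, Complex.norm_cpow_eq_rpow_re_of_pos hx, Complex.norm_real, Real.norm_eq_abs,
    abs_of_pos (Real.exp_pos _), Complex.sub_re, Complex.one_re]

theorem norm_gamma_le_of_re_mem_Icc : ∃ C : ℝ, 0 ≤ C ∧
    ∀ z : ℂ, 1 ≤ z.re → z.re ≤ 2 → ‖Complex.Gamma z‖ ≤ C := by
  obtain ⟨C, hC⟩ := (isCompact_Icc (a := (1 : ℝ)) (b := 2)).exists_bound_of_continuousOn
    (f := Real.Gamma) fun x hx => (Real.differentiableAt_Gamma fun m hm => by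
      have := hx.1
      rw [hm] at this
      linarith [Nat.cast_nonneg (α := ℝ) m]).continuousAt.continuousWithinAt
  refine ⟨C, (norm_nonneg _).trans (hC 1 ⟨le_rfl, one_le_two⟩), fun z h1 h2 => ?_⟩
  refine (Complex.norm_Gamma_le_Gamma_re (by linarith)).trans ?_
  exact (le_abs_self _).trans (hC z.re ⟨h1, h2⟩)

/-- The product `ε² Γ(ε + iεt) Γ(ε - iεt)`, in a form that makes sense at `ε = 0`. -/
noncomputable def poissonFactor (ε t : ℝ) : ℂ :=
  Complex.Gamma (1 + ε + ε * t * Complex.I) * Complex.Gamma (1 + ε - ε * t * Complex.I) *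
    ((1 + t ^ 2)⁻¹ : ℝ)

theorem sq_mul_gamma_mul_gamma {ε : ℝ} (hε : 0 < ε) (t : ℝ) :
    (ε : ℂ) ^ 2 * (Complex.Gamma (ε + ε * t * Complex.I) * Complex.Gamma (ε - ε * t * Complex.I)) =
      poissonFactor ε t := by
  have h1 : (ε : ℂ) + ε * t * Complex.I ≠ 0 := fun h => by
    have := congrArg Complex.re h; simp at this; linarith
  have h2 : (ε : ℂ) - ε * t * Complex.I ≠ 0 := fun h => by
    have := congrArg Complex.re h; simp at this; linarith
  have e1 : 1 + (ε : ℂ) + ε * t * Complex.I = (ε + ε * t * Complex.I) + 1 := by ring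
  have e2 : 1 + (ε : ℂ) - ε * t * Complex.I = (ε - ε * t * Complex.I) + 1 := by ring
  have h3 : (1 + (t : ℂ) ^ 2) ≠ 0 := by
    have : (1 + t ^ 2 : ℝ) ≠ 0 := by positivity
    exact_mod_cast this
  rw [poissonFactor, e1, e2, Complex.Gamma_add_one _ h1, Complex.Gamma_add_one _ h2]
  push_cast
  field_simp
  ring_nf
  rw [Complex.I_sq]
  ring

open Filter Topology in
theorem tendsto_integral_poissonFactor {n : ℕ} {U : Set ℂ} {E : (Fin (n + 1) → ℝ) → ℝ}
    {Φ : ℂ → (Fin (n + 1) → ℝ) → ℂ} (hΦ : TameOn U E Φ) (hU : IsOpen U) (h0 : (0 : ℂ) ∈ U)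
    {δ : ℝ} (hδ : 0 < δ) (hE : ∀ y, E y ≤ -δ * ‖y‖) :
    Tendsto (fun ε : ℝ => ∫ y : Fin (n + 1) → ℝ, poissonFactor ε (y 0) *
        Φ ε (Fin.cons (ε * y 0) (Fin.tail y))) (𝓝[>] 0)
      (𝓝 (Real.pi * ∫ x : Fin n → ℝ, Φ 0 (Fin.cons 0 x))) := by
  obtain ⟨r, hr, hball⟩ := Metric.isOpen_iff.1 hU 0 h0
  set K : Set ℂ := Metric.closedBall 0 (r / 2)
  have hK : K ⊆ U := (Metric.closedBall_subset_ball (by linarith)).trans hball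
  obtain ⟨C, hC, hb⟩ := hΦ.bound_pow hδ hE hK (isCompact_closedBall _ _) (n + 1)
  obtain ⟨D, hD, hd⟩ := norm_gamma_le_of_re_mem_Icc
  have hlim : (Real.pi : ℂ) * ∫ x : Fin n → ℝ, Φ 0 (Fin.cons 0 x) =
      ∫ y : Fin (n + 1) → ℝ, (((1 + y 0 ^ 2)⁻¹ : ℝ) : ℂ) * Φ 0 (Fin.cons 0 (Fin.tail y)) := by
    rw [integral_mul_tail (fun t => (((1 + t ^ 2)⁻¹ : ℝ) : ℂ))
      (fun x => Φ 0 (Fin.cons 0 x : Fin (n + 1) → ℝ)), integral_complex_ofReal,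
      integral_univ_inv_one_add_sq]
  have hpos : ∀ᶠ ε : ℝ in 𝓝[>] 0, 0 < ε := eventually_mem_nhdsWithin
  have hK' : ∀ᶠ ε : ℝ in 𝓝[>] 0, (ε : ℂ) ∈ K := by
    have h1 : Tendsto (fun x : ℝ => (x : ℂ)) (𝓝[>] 0) (𝓝 0) :=
      (Complex.continuous_ofReal.tendsto' 0 0 Complex.ofReal_zero).mono_left nhdsWithin_le_nhds
    exact h1 (Metric.closedBall_mem_nhds 0 (by linarith))
  have h1 : ∀ᶠ ε : ℝ in 𝓝[>] 0, ε ≤ 1 :=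
    (eventually_le_nhds one_pos).filter_mono nhdsWithin_le_nhds
  have hne : ∀ w : ℂ, 0 < w.re → ∀ m : ℕ, w ≠ -m := fun w hw m hm => by
    rw [hm, Complex.neg_re, Complex.natCast_re] at hw
    linarith [Nat.cast_nonneg (α := ℝ) m]
  rw [hlim]
  refine MeasureTheory.tendsto_integral_filter_of_dominated_convergence
    (fun y => (D * D * C * (1 + y 0 ^ 2)⁻¹) * (1 + ‖Fin.tail y‖) ^ (-((n + 1 : ℕ) : ℝ))) ?_ ?_ ?_ ?_
  · filter_upwards [hpos, hK'] with ε hε hεK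
    have hG : ∀ c : ℂ, c.re = 0 →
        Continuous (fun y : Fin (n + 1) → ℝ => Complex.Gamma (1 + ε + c * y 0)) := fun c hc => by
      refine continuous_iff_continuousAt.2 fun y => ?_
      refine (Complex.differentiableAt_Gamma _ (hne _ ?_)).continuousAt.comp
        (f := fun y : Fin (n + 1) → ℝ => (1 + ε + c * y 0 : ℂ))
        (continuous_const.add (continuous_const.mul
          (Complex.continuous_ofReal.comp (continuous_apply 0)))).continuousAt
      simp [hc]; linarith
    refine Continuous.aestronglyMeasurable ?_
    unfold poissonFactor
    refine ((Continuous.mul ?_ ?_).mul ?_).mul ((hΦ.continuous (hK hεK)).comp ?_)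
    · refine (hG (ε * Complex.I) (by simp)).congr fun y => ?_
      congr 1; ring
    · refine (hG (-ε * Complex.I) (by simp)).congr fun y => ?_
      congr 1; ring
    · refine Complex.continuous_ofReal.comp (Continuous.inv₀ (by fun_prop) fun y => ?_)
      positivity
    · unfold Fin.tail
      refine continuous_pi fun j => ?_
      refine Fin.cases ?_ (fun i => ?_) j
      · simp only [Fin.cons_zero]; fun_prop
      · simp only [Fin.cons_succ]; fun_prop
  · filter_upwards [hpos, hK', h1] with ε hε hεK hε1
    refine Eventually.of_forall fun y => ?_
    have hg1 := hd (1 + ε + ε * y 0 * Complex.I) (by simp; linarith) (by simp; linarith)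
    have hg2 := hd (1 + ε - ε * y 0 * Complex.I) (by simp; linarith) (by simp; linarith)
    have hp : (0 : ℝ) ≤ (1 + y 0 ^ 2)⁻¹ := by positivity
    have hy : ‖Fin.tail y‖ ≤ ‖(Fin.cons (ε * y 0) (Fin.tail y) : Fin (n + 1) → ℝ)‖ :=
      (pi_norm_le_iff_of_nonneg (norm_nonneg _)).2 fun i => by
        have := norm_le_pi_norm (Fin.cons (ε * y 0) (Fin.tail y) : Fin (n + 1) → ℝ) i.succ
        rwa [Fin.cons_succ] at this
    have hΦb := (hb ε hεK (Fin.cons (ε * y 0) (Fin.tail y))).trans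
      (mul_le_mul_of_nonneg_left (Real.rpow_le_rpow_of_nonpos (by positivity)
        (add_le_add_right hy 1) (neg_nonpos.2 (Nat.cast_nonneg _))) hC)
    rw [norm_mul, poissonFactor, norm_mul, norm_mul, Complex.norm_real, Real.norm_of_nonneg hp]
    calc _ ≤ D * D * (1 + y 0 ^ 2)⁻¹ * (C * (1 + ‖Fin.tail y‖) ^ (-((n + 1 : ℕ) : ℝ))) := by
          gcongr
      _ = _ := by ring
  · exact integrable_mul_tail (integrable_inv_one_add_sq.const_mul _) (TameOn.integrable_pow n)
  · refine Eventually.of_forall fun y => ?_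
    refine Tendsto.mul ?_ ?_
    · have hG : ∀ c : ℂ, Tendsto (fun ε : ℝ => Complex.Gamma (1 + ε + ε * c)) (𝓝[>] 0) (𝓝 1) :=
        fun c => by
          have : ContinuousAt (fun ε : ℝ => Complex.Gamma (1 + ε + ε * c)) 0 := by
            refine ContinuousAt.comp (f := fun ε : ℝ => (1 + ε + ε * c : ℂ))
              (Complex.differentiableAt_Gamma _ (hne _ (by simp))).continuousAt (by fun_prop)
          have h2 := this.tendsto
          simp only [Complex.ofReal_zero, zero_mul, add_zero, Complex.Gamma_one] at h2
          exact h2.mono_left nhdsWithin_le_nhds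
      have h3 := ((hG (y 0 * Complex.I)).mul (hG (-(y 0 * Complex.I)))).mul_const
        (((1 + y 0 ^ 2)⁻¹ : ℝ) : ℂ)
      rw [one_mul, one_mul] at h3
      refine h3.congr fun ε => ?_
      rw [poissonFactor]
      congr 3 <;> ring
    · have hc : ContinuousWithinAt (fun p : ℂ × (Fin (n + 1) → ℝ) => Φ p.1 p.2) (U ×ˢ Set.univ)
          (0, Fin.cons 0 (Fin.tail y)) := hΦ.cont _ ⟨h0, trivial⟩
      refine hc.tendsto.comp (f := fun ε : ℝ => ((ε : ℂ), (Fin.cons (ε * y 0) (Fin.tail y) : Fin (n + 1) → ℝ)))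
        (tendsto_nhdsWithin_iff.2 ⟨?_, ?_⟩)
      · have : Continuous (fun ε : ℝ => ((ε : ℂ), (Fin.cons (ε * y 0) (Fin.tail y) : Fin (n + 1) → ℝ))) := by
          refine Complex.continuous_ofReal.prodMk (continuous_pi fun j => ?_)
          refine Fin.cases ?_ (fun i => ?_) j
          · simp only [Fin.cons_zero]; fun_prop
          · simp only [Fin.cons_succ]; fun_prop
        have h4 := this.tendsto 0
        rw [zero_mul, Complex.ofReal_zero] at h4
        exact h4.mono_left nhdsWithin_le_nhds
      · filter_upwards [hK'] with ε hε using ⟨hK hε, trivial⟩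

section

variable {n : ℕ} {b₀ : ℝ} {B : ℂ} {a' : Fin n → ℂ} {b' : Fin (n + 3) → ℂ} {τ : ℝ}

theorem two_mul_integral_pinchedIntegrand {ε : ℝ} (hε : 0 < ε) :
    2 * (ε : ℂ) * ∫ y : Fin (n + 1) → ℝ, pinchedIntegrand (-b₀ + 2 * ε) a' b₀ b' B
        (fun j => imagPoint y j + (b₀ - ε : ℝ) * headDir n j) =
      2 * ∫ y : Fin (n + 1) → ℝ, poissonFactor ε (y 0) * pinchedKernel (-b₀ + 2 * ε) a' b₀ b' B
        (fun j => imagPoint (Fin.cons (ε * y 0) (Fin.tail y) : Fin (n + 1) → ℝ) j +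
          (b₀ - ε) * headDir n j) := by
  rw [← integral_comp_scale_zero _ hε, ← MeasureTheory.integral_const_mul,
    ← MeasureTheory.integral_const_mul, ← MeasureTheory.integral_const_mul]
  refine MeasureTheory.integral_congr_ae (Filter.Eventually.of_forall fun y => ?_)
  have h0 : imagPoint (Fin.cons (ε * y 0) (Fin.tail y) : Fin (n + 1) → ℝ) 0 =
      ε * y 0 * Complex.I := by
    rw [imagPoint, hyperCoord_zero, Fin.cons_zero]; push_cast; ring
  have hd : headDir n 0 = 1 := rfl
  simp only [pinchedIntegrand, h0, hd]
  rw [← sq_mul_gamma_mul_gamma hε]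
  push_cast
  rw [show (-b₀ + 2 * ε + (ε * y 0 * Complex.I + (b₀ - ε) * 1) : ℂ) = ε + ε * y 0 * Complex.I by ring,
    show (b₀ - (ε * y 0 * Complex.I + (b₀ - ε) * 1) : ℂ) = ε - ε * y 0 * Complex.I by ring]
  ring

open Filter Topology in
theorem integral_pinchedKernel_eq (hτ : τ < 1 / 2) (hbτ : b₀ < τ) (hb₀ : 0 < b₀)
    (ha' : ∀ i, τ < (a' i).re) (hb' : ∀ i, τ < (b' i).re) (hB : B = b₀ + ∑ i, b' i) (hB1 : 1 < B.re)
    {c : ℂ} (hc : ∀ a : ℝ, 0 < a →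
      ∫ y : Fin (n + 1) → ℝ, gammaKernel (Fin.cons (a : ℂ) a' : Fin (n + 1) → ℂ)
        (Fin.cons (b₀ : ℂ) b' : Fin (n + 4) → ℂ) (imagPoint y) =
        c * ∏ i, Complex.Gamma (a + (Fin.cons (b₀ : ℂ) b' : Fin (n + 4) → ℂ) i) /
          Complex.Gamma (B + a - (Fin.cons (b₀ : ℂ) b' : Fin (n + 4) → ℂ) i)) :
    (n + 2) * (2 * (Real.pi * ∫ x : Fin n → ℝ, pinchedKernel (-b₀) a' b₀ b' B
        (fun j => imagPoint (Fin.cons 0 x : Fin (n + 1) → ℝ) j + b₀ * headDir n j))) =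
      c * ((Complex.Gamma (B - 2 * b₀))⁻¹ *
        ∏ i, Complex.Gamma (b' i - b₀) / Complex.Gamma (B - b₀ - b' i)) := by
  set U : Set ℂ := {z : ℂ | -((τ - b₀) / 2) < z.re ∧ z.re < b₀}
  have h0U : (0 : ℂ) ∈ U := ⟨by rw [Complex.zero_re]; linarith, by simpa using hb₀⟩
  have T := tameOn_pinchedKernel (U := U) (α := fun z => -b₀ + 2 * z) (s := fun z => b₀ - z) hτ
    (b₀ := b₀) hbτ hb₀ ha' hb' hB1 (by fun_prop) (by fun_prop)
    (fun z hz => by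
      simp only [Complex.add_re, Complex.neg_re, Complex.ofReal_re, Complex.mul_re,
        Complex.re_ofNat, Complex.im_ofNat, zero_mul, sub_zero]
      linarith [hz.1])
    (fun z hz => by simp only [Complex.sub_re, Complex.ofReal_re]; linarith [hz.2])
    (fun z hz => by simp only [Complex.sub_re, Complex.ofReal_re]; linarith [hz.1])
  have hL := (((tendsto_integral_poissonFactor T (isOpen_strip _ _) h0U (half_pos Real.pi_pos)
    pinched_exponent_le).const_mul (2 : ℂ)).const_mul (n + 2 : ℂ))
  simp only [mul_zero, add_zero, sub_zero] at hL
  have hpole : ∀ w : ℂ, 0 < w.re → ContinuousAt Complex.Gamma w := fun w hw =>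
    (Complex.differentiableAt_Gamma _ fun m hm => by
      rw [hm, Complex.neg_re, Complex.natCast_re] at hw
      linarith [Nat.cast_nonneg (α := ℝ) m]).continuousAt
  have hinv : Continuous fun w : ℂ => (Complex.Gamma w)⁻¹ := Complex.differentiable_one_div_Gamma.continuous
  have hR : Tendsto (fun ε : ℝ => c * (Complex.Gamma (1 + 2 * ε) * (Complex.Gamma (B - 2 * b₀ + 2 * ε))⁻¹ *
      ∏ i, Complex.Gamma (b' i - b₀ + 2 * ε) * (Complex.Gamma (B - b₀ - b' i + 2 * ε))⁻¹)) (𝓝[>] 0)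
      (𝓝 (c * (Complex.Gamma 1 * (Complex.Gamma (B - 2 * b₀))⁻¹ *
        ∏ i, Complex.Gamma (b' i - b₀) * (Complex.Gamma (B - b₀ - b' i))⁻¹))) := by
    have hΓ : ∀ w : ℂ, 0 < w.re →
        Tendsto (fun ε : ℝ => Complex.Gamma (w + 2 * ε)) (𝓝[>] 0) (𝓝 (Complex.Gamma w)) := fun w hw => by
      have h1 : Tendsto (fun ε : ℝ => w + 2 * (ε : ℂ)) (𝓝 0) (𝓝 w) :=
        (by fun_prop : Continuous fun ε : ℝ => w + 2 * (ε : ℂ)).tendsto' _ _ (by simp)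
      exact ((hpole w hw).tendsto.comp h1).mono_left nhdsWithin_le_nhds
    have hΓ' : ∀ w : ℂ,
        Tendsto (fun ε : ℝ => (Complex.Gamma (w + 2 * ε))⁻¹) (𝓝[>] 0) (𝓝 (Complex.Gamma w)⁻¹) := fun w => by
      have h1 : Tendsto (fun ε : ℝ => w + 2 * (ε : ℂ)) (𝓝 0) (𝓝 w) :=
        (by fun_prop : Continuous fun ε : ℝ => w + 2 * (ε : ℂ)).tendsto' _ _ (by simp)
      exact (hinv.continuousAt.tendsto.comp h1).mono_left nhdsWithin_le_nhds
    refine (((hΓ 1 (by simp)).mul (hΓ' _)).mul (tendsto_finsetProd _ fun i _ =>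
      (hΓ _ ?_).mul (hΓ' _))).const_mul c
    rw [Complex.sub_re, Complex.ofReal_re]
    linarith [hb' i]
  simp only [Complex.Gamma_one, one_mul] at hR
  simp only [div_eq_mul_inv]
  refine tendsto_nhds_unique hL (hR.congr' ?_)
  filter_upwards [Ioo_mem_nhdsGT hb₀] with ε hε
  have h1 := integral_pinchedIntegrand_continued hτ hbτ hb₀ ha' hb' hB hB1 hc (a := -b₀ + 2 * ε)
    (σ := b₀ - ε) (by linarith [hε.2]) (by linarith [hε.1])
    (by
      simp only [Complex.add_re, Complex.neg_re, Complex.ofReal_re, Complex.mul_re,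
        Complex.re_ofNat, Complex.im_ofNat, zero_mul, sub_zero]
      linarith [hε.1])
  rw [Fin.prod_univ_succ] at h1
  simp only [Fin.cons_zero, Fin.cons_succ] at h1
  have hε0 : (ε : ℂ) ≠ 0 := by exact_mod_cast hε.1.ne'
  have h2 := two_mul_integral_pinchedIntegrand (b₀ := b₀) (B := B) (a' := a') (b' := b') hε.1
  rw [← h2, mul_left_comm (n + 2 : ℂ), h1]
  rw [show (1 + 2 * ε : ℂ) = 2 * ε + 1 by ring, Complex.Gamma_add_one _ (mul_ne_zero two_ne_zero hε0),
    show (-b₀ + 2 * ε + b₀ : ℂ) = 2 * ε by ring,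
    show (B + (-b₀ + 2 * ε) - b₀ : ℂ) = B - 2 * b₀ + 2 * ε by ring]
  have h3 : ∀ i, Complex.Gamma (-b₀ + 2 * ε + b' i) / Complex.Gamma (B + (-b₀ + 2 * ε) - b' i) =
      Complex.Gamma (b' i - b₀ + 2 * ε) / Complex.Gamma (B - b₀ - b' i + 2 * ε) := fun i => by
    congr 2 <;> ring
  simp only [h3]
  simp only [div_eq_mul_inv]
  ring

end

/-- The value of `∫ y, gammaKernel a b (imagPoint y)`. -/
noncomputable def kernelIntegralValue {n : ℕ} (a : Fin n → ℂ) (b : Fin (n + 3) → ℂ) : ℂ :=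
  (2 * Real.pi) ^ n * (n + 1).factorial *
    (∏ i, ∏ j, Complex.Gamma (a i + b j) / Complex.Gamma ((∑ k, b k) + a i - b j)) *
    pairProd Finset.univ (fun i j => Complex.Gamma ((∑ k, b k) - b i - b j))

theorem gamma_one_sub_mul_gamma_mul_sin {w : ℂ} (h0 : 0 < w.re) (h1 : w.re < 1) :
    Complex.Gamma (1 - w) * Complex.Gamma w * ((Real.pi : ℂ)⁻¹ * Complex.sin (Real.pi * w)) = 1 := by
  have hpi : (Real.pi : ℂ) ≠ 0 := Complex.ofReal_ne_zero.2 Real.pi_ne_zero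
  have h := Complex.Gamma_mul_Gamma_one_sub w
  have hne : Complex.Gamma w * Complex.Gamma (1 - w) ≠ 0 :=
    mul_ne_zero (Complex.Gamma_ne_zero_of_re_pos h0)
      (Complex.Gamma_ne_zero_of_re_pos (by rw [Complex.sub_re, Complex.one_re]; linarith))
  have hs : Complex.sin (Real.pi * w) ≠ 0 := fun hs => by
    rw [hs, div_zero] at h; exact hne h
  rw [mul_comm (Complex.Gamma (1 - w)), h]
  field_simp

section

variable {n : ℕ} {b₀ : ℝ} {B : ℂ} {a' : Fin n → ℂ} {b' : Fin (n + 3) → ℂ} {τ : ℝ}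

theorem pinchedKernel_eq_gammaKernel (hτ : b₀ < 1 / 2) (hb₀ : 0 < b₀)
    (hb' : ∀ i, 0 < (b' i).re) (hB : B = b₀ + ∑ i, b' i) (x : Fin n → ℝ) :
    pinchedKernel (-b₀) a' b₀ b' B
        (fun j => imagPoint (Fin.cons 0 x : Fin (n + 1) → ℝ) j + b₀ * headDir n j) =
      (Complex.Gamma (B - 2 * b₀))⁻¹ * weight a' b' B b₀ *
        gammaKernel (fun i => a' i - b₀ / (n + 1)) (fun i => b' i + b₀ / (n + 1)) (imagPoint x) := by
  have hn : ((n : ℂ) + 1) ≠ 0 := Nat.cast_add_one_ne_zero n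
  have hnr : (0 : ℝ) < (n : ℝ) + 1 := by positivity
  obtain ⟨γ, hγ⟩ : ∃ γ : ℝ, γ = b₀ / (n + 1) := ⟨_, rfl⟩
  have hγc : (b₀ / (n + 1) : ℂ) = γ := by rw [hγ]; push_cast; ring
  have hγ0 : 0 < γ := by rw [hγ]; positivity
  have hγ1 : γ ≤ b₀ := by
    rw [hγ]; exact div_le_self hb₀.le (by linarith [Nat.cast_nonneg (α := ℝ) n])
  have hγb : (b₀ : ℂ) = (n + 1) * γ := by rw [← hγc]; field_simp
  have h0 : imagPoint (Fin.cons 0 x : Fin (n + 1) → ℝ) 0 + b₀ * headDir n 0 = b₀ := by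
    rw [imagPoint, hyperCoord_zero, headDir, Fin.cons_zero, Fin.cons_zero]; simp
  have hj : ∀ j : Fin (n + 1), imagPoint (Fin.cons 0 x : Fin (n + 1) → ℝ) j.succ +
      b₀ * headDir n j.succ = imagPoint x j - γ := fun j => by
    rw [imagPoint, hyperCoord_succ_cons_zero, headDir, Fin.cons_succ, ← hγc, imagPoint]
    push_cast; ring
  have hB' : ∑ k, (b' k + (γ : ℂ)) = B + 2 * γ := by
    rw [Finset.sum_add_distrib, hB, hγb]; simp; ring
  rw [hγc, gammaKernel_eq, hB', pinchedKernel]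
  simp only [h0, hj]
  rw [show B + -(b₀ : ℂ) - b₀ = B - 2 * b₀ by ring, mul_assoc _ (Finset.prod _ _)]
  congr 2
  · refine Finset.prod_congr rfl fun j _ => ?_
    have hre : (imagPoint x j).re = 0 := by simp [imagPoint]
    have hr := gamma_one_sub_mul_gamma_mul_sin (w := b₀ - (imagPoint x j - γ))
      (by simp [hre]; linarith) (by simp [hre]; linarith)
    have hne : Complex.Gamma (B - b₀ - (imagPoint x j - γ)) ≠ 0 :=
      Complex.Gamma_ne_zero_of_re_pos (by
        have h1 : (0 : ℝ) ≤ ∑ i, (b' i).re := Finset.sum_nonneg fun i _ => (hb' i).le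
        simp [hre, hB]; linarith)
    rw [show B + -(b₀ : ℂ) = B - b₀ by ring,
      show -(b₀ : ℂ) + 1 + (imagPoint x j - γ) = 1 - (b₀ - (imagPoint x j - γ)) by ring]
    have hw : weight (fun i => a' i - (γ : ℂ)) (fun i => b' i + (γ : ℂ)) (B + 2 * γ) (imagPoint x j) =
        weight a' b' B (imagPoint x j - γ) := by
      unfold weight
      congr 1
      · congr 1
        · exact Finset.prod_congr rfl fun i _ => by congr 1; ring
        · exact Finset.prod_congr rfl fun i _ => by congr 1; ring
      · exact Finset.prod_congr rfl fun i _ => by congr 1; ring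
    rw [hw]
    calc _ = (Complex.Gamma (1 - (b₀ - (imagPoint x j - γ))) * Complex.Gamma (b₀ - (imagPoint x j - γ)) *
          ((Real.pi : ℂ)⁻¹ * Complex.sin (Real.pi * (b₀ - (imagPoint x j - γ))))) *
          weight a' b' B (imagPoint x j - γ) *
          (Complex.Gamma (B - b₀ - (imagPoint x j - γ)) / Complex.Gamma (B - b₀ - (imagPoint x j - γ))) := by
          ring
      _ = _ := by rw [hr, div_self hne]; ring
  · refine pairProd_congr fun i _ j _ _ => ?_
    unfold pairFactor
    congr 2 <;> [ring; (congr 1; ring); (congr 1; ring)]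

end

section

variable {n : ℕ} {b₀ : ℝ} {B : ℂ} {a' : Fin n → ℂ} {b' : Fin (n + 3) → ℂ}

theorem kernelIntegralValue_sub_add (hB : B = b₀ + ∑ i, b' i) :
    kernelIntegralValue (fun i => a' i - (b₀ : ℂ) / (n + 1)) (fun i => b' i + (b₀ : ℂ) / (n + 1)) =
      (2 * Real.pi) ^ n * (n + 1).factorial *
        (∏ i, ∏ j, Complex.Gamma (a' i + b' j) / Complex.Gamma (B + a' i - b' j)) *
        pairProd Finset.univ (fun i j => Complex.Gamma (B - b' i - b' j)) := by
  have hn : ((n : ℂ) + 1) ≠ 0 := Nat.cast_add_one_ne_zero n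
  have hs : ∑ k, (b' k + (b₀ : ℂ) / (n + 1)) = B + 2 * (b₀ / (n + 1)) := by
    rw [Finset.sum_add_distrib, hB]
    simp only [Finset.sum_const, Finset.card_univ, Fintype.card_fin, nsmul_eq_mul]
    push_cast
    field_simp
    ring
  rw [kernelIntegralValue, hs]
  congr 1
  · congr 1
    refine Finset.prod_congr rfl fun i _ => Finset.prod_congr rfl fun j _ => ?_
    congr 2 <;> ring
  · refine pairProd_congr fun i _ j _ _ => ?_
    congr 1
    ring

theorem kernelIntegralValue_cons (a : ℂ) (hB : B = b₀ + ∑ i, b' i) :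
    kernelIntegralValue (Fin.cons a a' : Fin (n + 1) → ℂ) (Fin.cons (b₀ : ℂ) b' : Fin (n + 4) → ℂ) =
      (n + 2) * (2 * Real.pi) * (∏ i, Complex.Gamma (B - b₀ - b' i)) *
        (∏ i, Complex.Gamma (a' i + b₀) / Complex.Gamma (B + a' i - b₀)) *
        kernelIntegralValue (fun i => a' i - (b₀ : ℂ) / (n + 1)) (fun i => b' i + (b₀ : ℂ) / (n + 1)) *
        ∏ i, Complex.Gamma (a + (Fin.cons (b₀ : ℂ) b' : Fin (n + 4) → ℂ) i) /
          Complex.Gamma (B + a - (Fin.cons (b₀ : ℂ) b' : Fin (n + 4) → ℂ) i) := by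
  have hs : ∑ k, (Fin.cons (b₀ : ℂ) b' : Fin (n + 4) → ℂ) k = B := by
    rw [Fin.sum_univ_succ, hB]; simp
  have hr : ∏ i, ∏ j, Complex.Gamma ((Fin.cons a a' : Fin (n + 1) → ℂ) i +
        (Fin.cons (b₀ : ℂ) b' : Fin (n + 4) → ℂ) j) /
        Complex.Gamma (B + (Fin.cons a a' : Fin (n + 1) → ℂ) i -
          (Fin.cons (b₀ : ℂ) b' : Fin (n + 4) → ℂ) j) =
      (∏ i, Complex.Gamma (a + (Fin.cons (b₀ : ℂ) b' : Fin (n + 4) → ℂ) i) /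
          Complex.Gamma (B + a - (Fin.cons (b₀ : ℂ) b' : Fin (n + 4) → ℂ) i)) *
        ((∏ i, Complex.Gamma (a' i + b₀) / Complex.Gamma (B + a' i - b₀)) *
          ∏ i, ∏ j, Complex.Gamma (a' i + b' j) / Complex.Gamma (B + a' i - b' j)) := by
    rw [Fin.prod_univ_succ, ← Finset.prod_mul_distrib]
    refine congrArg₂ _ rfl (Finset.prod_congr rfl fun i _ => ?_)
    rw [Fin.cons_succ, Fin.prod_univ_succ]
    rfl
  rw [kernelIntegralValue_sub_add hB, kernelIntegralValue, hs, pairProd_univ_succ, hr,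
    Nat.factorial_succ (n + 1)]
  simp only [Fin.cons_zero, Fin.cons_succ]
  push_cast
  ring

theorem integral_gammaKernel_cons {τ : ℝ} (hτ : τ < 1 / 2) (hbτ : b₀ < τ) (hb₀ : 0 < b₀)
    (ha' : ∀ i, τ < (a' i).re) (hb' : ∀ i, τ < (b' i).re) {β : ℝ} (hβ : (β : ℂ) = b₀ + ∑ i, b' i)
    (hβ1 : 1 < β) (ih : ∀ (a : Fin n → ℂ) (b : Fin (n + 3) → ℂ), (∀ i, 0 < (a i).re) →
      (∀ i, 0 < (b i).re) → ∫ y : Fin n → ℝ, gammaKernel a b (imagPoint y) = kernelIntegralValue a b)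
    {a : ℝ} (ha : 0 < a) :
    ∫ y : Fin (n + 1) → ℝ, gammaKernel (Fin.cons (a : ℂ) a' : Fin (n + 1) → ℂ)
      (Fin.cons (b₀ : ℂ) b' : Fin (n + 4) → ℂ) (imagPoint y) =
      kernelIntegralValue (Fin.cons (a : ℂ) a' : Fin (n + 1) → ℂ)
        (Fin.cons (b₀ : ℂ) b' : Fin (n + 4) → ℂ) := by
  have hnr : (0 : ℝ) ≤ n := Nat.cast_nonneg n
  have hγ0 : 0 ≤ b₀ / (n + 1) := by positivity
  have hγ1 : b₀ / (n + 1) ≤ b₀ := div_le_self hb₀.le (by linarith)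
  have hγc : ((b₀ : ℂ) / (n + 1)).re = b₀ / (n + 1) := by
    rw [← Complex.ofReal_re (b₀ / (n + 1))]; push_cast; rfl
  obtain ⟨c, hc⟩ := exists_integral_gammaKernel_eq (a' := a')
    (b := (Fin.cons (b₀ : ℂ) b' : Fin (n + 4) → ℂ)) (β := β)
    (by rw [hβ, Fin.sum_univ_succ (n := n + 3), Fin.cons_zero]; simp only [Fin.cons_succ]) hβ1 (fun i => by linarith [ha' i])
    (fun i => Fin.cases (by simpa using hb₀) (fun i => by rw [Fin.cons_succ]; linarith [hb' i]) i)
  have h1 := integral_pinchedKernel_eq hτ hbτ hb₀ ha' hb' hβ (by simpa using hβ1) hc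
  simp only [pinchedKernel_eq_gammaKernel (hbτ.trans hτ) hb₀ (fun i => by linarith [hb' i]) hβ] at h1
  rw [MeasureTheory.integral_const_mul, ih _ _ (fun i => by rw [Complex.sub_re, hγc]; linarith [ha' i])
    (fun i => by rw [Complex.add_re, hγc]; linarith [hb' i]), weight] at h1
  have hre : β = b₀ + ∑ i, (b' i).re := by
    have := congrArg Complex.re hβ
    simpa using this
  have hG : Complex.Gamma (β - 2 * b₀) ≠ 0 := Complex.Gamma_ne_zero_of_re_pos (by
    simp; linarith)
  have hX : ∏ i, Complex.Gamma (b' i - b₀) ≠ 0 := Finset.prod_ne_zero_iff.2 fun i _ =>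
    Complex.Gamma_ne_zero_of_re_pos (by simp; linarith [hb' i])
  have hY : ∏ i, Complex.Gamma (β - b₀ - b' i) ≠ 0 := Finset.prod_ne_zero_iff.2 fun i _ =>
    Complex.Gamma_ne_zero_of_re_pos (by
      have h2 : 0 < ∑ j ∈ Finset.univ.erase i, (b' j).re := by
        refine Finset.sum_pos (fun j _ => by linarith [hb' j]) (Finset.card_pos.1 ?_)
        rw [Finset.card_erase_of_mem (Finset.mem_univ i)]; simp
      have h3 := Finset.add_sum_erase Finset.univ (fun j => (b' j).re) (Finset.mem_univ i)
      simp; linarith)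
  rw [hc a ha, kernelIntegralValue_cons a hβ]
  congr 1
  rw [Finset.prod_div_distrib] at h1 ⊢
  refine mul_right_cancel₀ (mul_ne_zero (inv_ne_zero hG) (div_ne_zero hX hY)) (h1.symm.trans ?_)
  generalize kernelIntegralValue _ _ = V
  field_simp

end

theorem re_pos_sum_sub_sub {n : ℕ} {b : Fin (n + 3) → ℂ} (hb : ∀ i, 0 < (b i).re) {i j : Fin (n + 3)}
    (hij : i ≠ j) : 0 < ((∑ k, b k) - b i - b j).re := by
  have h1 := Finset.add_sum_erase Finset.univ (fun k => (b k).re) (Finset.mem_univ i)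
  have h2 := Finset.add_sum_erase (Finset.univ.erase i) (fun k => (b k).re)
    (Finset.mem_erase.2 ⟨hij.symm, Finset.mem_univ j⟩)
  have h3 : 0 < ∑ k ∈ (Finset.univ.erase i).erase j, (b k).re := by
    refine Finset.sum_pos (fun k _ => hb k) (Finset.card_pos.1 ?_)
    rw [Finset.card_erase_of_mem (Finset.mem_erase.2 ⟨hij.symm, Finset.mem_univ j⟩),
      Finset.card_erase_of_mem (Finset.mem_univ i)]
    simp
  simp only [Complex.sub_re, Complex.re_sum]
  linarith

theorem differentiableOn_kernelIntegralValue {n : ℕ} {U : Set ℂ} {a : ℂ → Fin n → ℂ}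
    {b : ℂ → Fin (n + 3) → ℂ} (ha : ∀ i, Differentiable ℂ (fun z => a z i))
    (hb : ∀ i, Differentiable ℂ (fun z => b z i)) (ha0 : ∀ z ∈ U, ∀ i, 0 < (a z i).re)
    (hb0 : ∀ z ∈ U, ∀ i, 0 < (b z i).re) :
    DifferentiableOn ℂ (fun z => kernelIntegralValue (a z) (b z)) U := by
  have hΓ : ∀ f : ℂ → ℂ, Differentiable ℂ f → (∀ z ∈ U, 0 < (f z).re) →
      DifferentiableOn ℂ (fun z => Complex.Gamma (f z)) U := fun f hf hpos z hz => by
    refine ((Complex.differentiableAt_Gamma _ fun m hm => ?_).comp z (hf z)).differentiableWithinAt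
    have := hpos z hz
    rw [hm, Complex.neg_re, Complex.natCast_re] at this
    linarith [Nat.cast_nonneg (α := ℝ) m]
  have hs : Differentiable ℂ (fun z => ∑ k, b z k) := Differentiable.fun_sum fun k _ => hb k
  unfold kernelIntegralValue
  simp only [pairProd_univ, div_eq_mul_inv]
  refine ((DifferentiableOn.fun_finsetProd fun i _ => DifferentiableOn.fun_finsetProd fun j _ =>
    ?_).const_mul _).mul (DifferentiableOn.fun_finsetProd fun i _ =>
      DifferentiableOn.fun_finsetProd fun j hj => ?_)
  · refine (hΓ _ ((ha i).add (hb j)) fun z hz => ?_).mul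
      (Complex.differentiable_one_div_Gamma.comp ((hs.add (ha i)).sub (hb j))).differentiableOn
    rw [Pi.add_apply, Complex.add_re]
    exact add_pos (ha0 z hz i) (hb0 z hz j)
  · exact hΓ _ ((hs.sub (hb i)).sub (hb j)) fun z hz =>
      re_pos_sum_sub_sub (hb0 z hz) (Finset.mem_Ioi.1 hj).ne

/-- If the evaluation of the integral holds along a real segment of parameters on an affine complex
line, then it holds at all parameters on this line that have positive real parts. -/
theorem integral_gammaKernel_of_eventually {n : ℕ} {a₀ a₁ : Fin n → ℂ} {b₀ b₁ : Fin (n + 3) → ℂ} {x₀ : ℝ}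
    (ha₀ : ∀ i, 0 < (a₀ i + x₀ * a₁ i).re) (hb₀ : ∀ i, 0 < (b₀ i + x₀ * b₁ i).re)
    (h : ∀ᶠ x : ℝ in nhds x₀, ∫ y : Fin n → ℝ, gammaKernel (fun i => a₀ i + x * a₁ i)
      (fun i => b₀ i + x * b₁ i) (imagPoint y) =
        kernelIntegralValue (fun i => a₀ i + x * a₁ i) (fun i => b₀ i + x * b₁ i))
    {z : ℂ} (ha : ∀ i, 0 < (a₀ i + z * a₁ i).re) (hb : ∀ i, 0 < (b₀ i + z * b₁ i).re) :
    ∫ y : Fin n → ℝ, gammaKernel (fun i => a₀ i + z * a₁ i) (fun i => b₀ i + z * b₁ i) (imagPoint y) =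
      kernelIntegralValue (fun i => a₀ i + z * a₁ i) (fun i => b₀ i + z * b₁ i) := by
  set U : Set ℂ := (⋂ i, {z : ℂ | 0 < (a₀ i + z * a₁ i).re}) ∩ ⋂ i, {z : ℂ | 0 < (b₀ i + z * b₁ i).re}
  have hmem : ∀ z, z ∈ U ↔ (∀ i, 0 < (a₀ i + z * a₁ i).re) ∧ ∀ i, 0 < (b₀ i + z * b₁ i).re := fun z => by
    simp [U]
  have hU : IsOpen U :=
    (isOpen_iInter_of_finite fun i => isOpen_lt continuous_const (by fun_prop)).inter
      (isOpen_iInter_of_finite fun i => isOpen_lt continuous_const (by fun_prop))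
  have hconv : ∀ c d : ℂ, Convex ℝ {z : ℂ | 0 < (c + z * d).re} := fun c d z hz w hw s t hs ht hst => by
    have hz' : 0 < (c + z * d).re := hz
    have hw' : 0 < (c + w * d).re := hw
    show 0 < (c + (s • z + t • w) * d).re
    have e : c + (s • z + t • w) * d = s * (c + z * d) + t * (c + w * d) := by
      have : (s : ℂ) + t = 1 := by exact_mod_cast hst
      rw [Complex.real_smul, Complex.real_smul]
      linear_combination (-c) * this
    rw [e, Complex.add_re, Complex.re_ofReal_mul, Complex.re_ofReal_mul]
    rcases hs.eq_or_lt with rfl | hs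
    · rw [zero_mul, zero_add]; exact mul_pos (by linarith) hw'
    · exact add_pos_of_pos_of_nonneg (mul_pos hs hz') (mul_nonneg ht hw'.le)
  have hU' : IsPreconnected U :=
    ((convex_iInter fun i => hconv _ _).inter (convex_iInter fun i => hconv _ _)).isPreconnected
  have T := tameOn_gammaKernel (U := U) (a := fun z i => a₀ i + z * a₁ i) (b := fun z i => b₀ i + z * b₁ i)
    (fun i => by fun_prop) (fun i => by fun_prop) (fun z hz => ((hmem z).1 hz).1)
    (fun z hz => ((hmem z).1 hz).2)
  exact eqOn_of_eventually_ofReal hU hU' (T.differentiableOn_integral hU Real.pi_pos fun _ => le_rfl)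
    (differentiableOn_kernelIntegralValue (fun i => by fun_prop) (fun i => by fun_prop)
      (fun z hz => ((hmem z).1 hz).1) (fun z hz => ((hmem z).1 hz).2))
    ((hmem _).2 ⟨ha₀, hb₀⟩) h ((hmem z).2 ⟨ha, hb⟩)

open Filter Topology in
/-- Continues `integral_gammaKernel_cons` from parameters near `a i = 1`, `b 0 = 1 / 4`, `b (i + 1) = 1`
to all positive real parameters. -/
theorem integral_gammaKernel_succ_of_real {n : ℕ}
    (ih : ∀ (a : Fin n → ℂ) (b : Fin (n + 3) → ℂ), (∀ i, 0 < (a i).re) →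
      (∀ i, 0 < (b i).re) → ∫ y : Fin n → ℝ, gammaKernel a b (imagPoint y) = kernelIntegralValue a b)
    {a : Fin (n + 1) → ℝ} {b : Fin (n + 4) → ℝ} (ha : ∀ i, 0 < a i) (hb : ∀ i, 0 < b i) :
    ∫ y : Fin (n + 1) → ℝ, gammaKernel (fun i => (a i : ℂ)) (fun i => (b i : ℂ)) (imagPoint y) =
      kernelIntegralValue (fun i => (a i : ℂ)) (fun i => (b i : ℂ)) := by
  set q : Fin (n + 4) → ℝ := Fin.cons (1 / 4) (fun _ => 1) with hq
  have key := integral_gammaKernel_of_eventually (x₀ := 1) (a₀ := fun i => (a i : ℂ))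
    (a₁ := fun i => ((1 - a i : ℝ) : ℂ)) (b₀ := fun i => (b i : ℂ))
    (b₁ := fun i => ((q i - b i : ℝ) : ℂ)) (z := 0)
    (fun i => by simp) (fun i => by
      have : 0 < q i := by
        refine Fin.cases ?_ (fun i => ?_) i <;> simp [hq]
      simpa using this) ?_ (fun i => by simpa using ha i) (fun i => by simpa using hb i)
  · simpa using key
  have hev : ∀ (c d r : ℝ), r < d → ∀ᶠ x : ℝ in 𝓝 1, r < c + x * (d - c) := fun c d r hr => by
    have h1 : Tendsto (fun x : ℝ => c + x * (d - c)) (𝓝 1) (𝓝 d) :=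
      (by fun_prop : Continuous fun x : ℝ => c + x * (d - c)).tendsto' _ _ (by ring)
    exact h1.eventually_const_lt hr
  have hev' : ∀ᶠ x : ℝ in 𝓝 1, b 0 + x * (q 0 - b 0) < 3 / 8 := by
    have h1 : Tendsto (fun x : ℝ => b 0 + x * (q 0 - b 0)) (𝓝 1) (𝓝 (1 / 4)) :=
      (by fun_prop : Continuous fun x : ℝ => b 0 + x * (q 0 - b 0)).tendsto' _ _ (by simp [hq])
    exact h1.eventually_lt_const (by norm_num)
  have h1 : ∀ i : Fin (n + 3), q i.succ = 1 := fun i => by rw [hq, Fin.cons_succ]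
  have h0 : q 0 = 1 / 4 := rfl
  filter_upwards [hev', hev (b 0) (q 0) 0 (by rw [h0]; norm_num),
    eventually_all.2 fun i : Fin (n + 1) => hev (a i) 1 (3 / 8) (by norm_num),
    eventually_all.2 fun i : Fin (n + 3) => hev (b i.succ) (q i.succ) (3 / 8) (by rw [h1]; norm_num)]
    with x hx1 hx2 hxa hxb
  have hac : (fun i => (a i : ℂ) + x * ((1 - a i : ℝ) : ℂ)) =
      (Fin.cons ((a 0 + x * (1 - a 0) : ℝ) : ℂ) (fun i : Fin n => ((a i.succ + x * (1 - a i.succ) : ℝ) : ℂ)) :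
        Fin (n + 1) → ℂ) := by
    ext i
    refine Fin.cases ?_ (fun i => ?_) i <;> simp
  have hbc : (fun i => (b i : ℂ) + x * ((q i - b i : ℝ) : ℂ)) =
      (Fin.cons ((b 0 + x * (q 0 - b 0) : ℝ) : ℂ)
        (fun i : Fin (n + 3) => ((b i.succ + x * (q i.succ - b i.succ) : ℝ) : ℂ)) : Fin (n + 4) → ℂ) := by
    ext i
    refine Fin.cases ?_ (fun i => ?_) i <;> simp
  rw [hac, hbc]
  refine integral_gammaKernel_cons (τ := 3 / 8)
    (β := (b 0 + x * (q 0 - b 0)) + ∑ i : Fin (n + 3), (b i.succ + x * (q i.succ - b i.succ)))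
    (by norm_num) hx1 hx2 (fun i => ?_) (fun i => ?_) (by push_cast; rfl) ?_ ih (by linarith [hxa 0])
  · rw [Complex.ofReal_re]; exact hxa _
  · rw [Complex.ofReal_re]; exact hxb _
  · rw [Fin.sum_univ_succ, Fin.sum_univ_succ, Fin.sum_univ_succ]
    have h2 : 0 ≤ ∑ i : Fin n, (b i.succ.succ.succ.succ + x * (q i.succ.succ.succ.succ - b i.succ.succ.succ.succ)) :=
      Finset.sum_nonneg fun i _ => by linarith [hxb i.succ.succ.succ]
    have h3 := hxb 0
    have h4 := hxb (Fin.succ 0)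
    have h5 := hxb (Fin.succ (Fin.succ 0))
    linarith

theorem integral_gammaKernel_zero (a : Fin 0 → ℂ) (b : Fin 3 → ℂ) :
    ∫ y : Fin 0 → ℝ, gammaKernel a b (imagPoint y) = kernelIntegralValue a b := by
  have h : ∀ y : Fin 0 → ℝ, imagPoint y = 0 := fun y => by
    ext j
    rw [Fin.eq_zero j, imagPoint, show (0 : Fin (0 + 1)) = Fin.last 0 from rfl, hyperCoord_last]
    simp
  have h3 : pairProd Finset.univ (fun i j : Fin 3 => Complex.Gamma ((∑ k, b k) - b i - b j)) =
      Complex.Gamma (b 2) * Complex.Gamma (b 1) * Complex.Gamma (b 0) := by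
    rw [pairProd_univ, Fin.prod_univ_three, show Finset.Ioi (0 : Fin 3) = {1, 2} by decide,
      show Finset.Ioi (1 : Fin 3) = {2} by decide, show Finset.Ioi (2 : Fin 3) = ∅ by decide,
      Finset.prod_pair (by decide), Finset.prod_singleton, Finset.prod_empty, mul_one,
      Fin.sum_univ_three]
    congr 2 <;> [(congr 1; ring); (congr 1; ring); ring]
  have h1 : pairProd Finset.univ (fun i j : Fin (0 + 1) =>
      pairFactor (∑ k, b k) ((0 : Fin (0 + 1) → ℂ) i) ((0 : Fin (0 + 1) → ℂ) j)) = 1 := by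
    rw [pairProd_univ_succ, pairProd_univ]; simp
  simp only [h, gammaKernel_eq, kernelIntegralValue, h3, h1]
  simp [weight, Fin.prod_univ_three, MeasureTheory.measureReal_def, MeasureTheory.volume_pi]
  ring

theorem integral_gammaKernel {n : ℕ} {a : Fin n → ℂ} {b : Fin (n + 3) → ℂ} (ha : ∀ i, 0 < (a i).re)
    (hb : ∀ i, 0 < (b i).re) :
    ∫ y : Fin n → ℝ, gammaKernel a b (imagPoint y) = kernelIntegralValue a b := by
  induction n with
  | zero => exact integral_gammaKernel_zero a b
  | succ n ih =>
    have hev : ∀ c d : ℝ, 0 < c → ∀ᶠ x : ℝ in nhds 0, 0 < c + x * d := fun c d hc =>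
      ((by fun_prop : Continuous fun x : ℝ => c + x * d).tendsto' 0 c (by ring)).eventually_const_lt hc
    have key := integral_gammaKernel_of_eventually (x₀ := 0) (a₀ := fun i => ((a i).re : ℂ))
      (a₁ := fun i => ((a i).im : ℂ)) (b₀ := fun i => ((b i).re : ℂ)) (b₁ := fun i => ((b i).im : ℂ))
      (z := Complex.I) (fun i => by simpa using ha i) (fun i => by simpa using hb i) ?_
      (fun i => by simpa using ha i) (fun i => by simpa using hb i)
    · have hI : ∀ w : ℂ, (w.re : ℂ) + Complex.I * w.im = w := fun w => by
        rw [mul_comm]; exact Complex.re_add_im w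
      simpa only [hI] using key
    filter_upwards [Filter.eventually_all.2 fun i => hev (a i).re (a i).im (ha i),
      Filter.eventually_all.2 fun i => hev (b i).re (b i).im (hb i)] with x hxa hxb
    have := integral_gammaKernel_succ_of_real (fun a b => @ih a b) hxa hxb
    push_cast at this
    exact this

theorem theorem4p5 (n : ℕ) (a : Fin n → ℂ) (b : Fin (n + 3) → ℂ) (B : ℂ)
    (hB : B = ∑ k, b k) (ha : ∀ i, 0 < (a i).re) (hb : ∀ i, 0 < (b i).re) :
    ImagAxisIntegrable n (fun u => gammaKernel a b (sumZeroExtend u)) ∧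
    1 / (2 * (Real.pi : ℂ) * Complex.I) ^ n *
        imagAxisIntegral n (fun u => gammaKernel a b (sumZeroExtend u)) =
      ((n + 1).factorial : ℂ) *
        (∏ i : Fin n, ∏ j : Fin (n + 3),
          Complex.Gamma (a i + b j) / Complex.Gamma (B + a i - b j)) *
        ∏ i : Fin (n + 3), ∏ j ∈ Finset.Ioi i, Complex.Gamma (B - b i - b j) := by
  have hpi : (Real.pi : ℂ) ≠ 0 := Complex.ofReal_ne_zero.2 Real.pi_ne_zero
  have hI := Complex.I_ne_zero
  simp only [ImagAxisIntegrable, imagAxisIntegral, sumZeroExtend_eq_imagPoint]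
  refine ⟨integrable_gammaKernel ha hb, ?_⟩
  rw [integral_gammaKernel ha hb, kernelIntegralValue, pairProd_univ, ← hB, mul_pow _ Complex.I]
  field_simp
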